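/- Let $n\ge 1$ and $0<\beta<1$. On $\mathbf{C}^n$ take complex coordinates $(u,v_1,\dots,v_{n-1})$, and on the complement of the divisor $\{u=0\}$ let $\omega_{(\beta)}$ be the Kähler form of the model cone metric $|u|^{2\beta-2}|du|^2+\sum_{i=1}^{n-1}|dv_i|^2$, that is, $$\omega_{(\beta)}=\tfrac{i}{2}\Bigl(|u|^{2\beta-2}\,du\wedge d\bar u+\sum_{i=1}^{n-1}dv_i\wedge d\bar v_i\Bigr).$$ Suppose that $\omega'$ is a smooth Kähler metric defined on $\mathbf{C}^n\setminus\{u=0\}$ such that (1) the volume form of $\omega'$ is the same as that of $\omega_{(\beta)}$ at every point of $\mathbf{C}^n\setminus\{u=0\}$; (2) there is a constant $C>0$ such that $C^{-1}\omega_{(\beta)}\le\omega'\le C\,\omega_{(\beta)}$ on $\mathbf{C}^n\setminus\{u=0\}$; (3) $(\mathbf{C}^n,\omega')$ is a metric cone with vertex $0$: the Riemannian distance of $\omega'$ on $\mathbf{C}^n\setminus\{u=0\}$ (the infimum of the lengths of $C^1$ paths in this set) extends to a continuous function $d$ on $\mathbf{C}^n\times\mathbf{C}^n$, and $(\mathbf{C}^n,d)$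 is isometric, by an isometry taking the vertex to $0$, to the Euclidean cone $C(Y)$ over some metric space $Y$, i.e. to the quotient of $[0,\infty)\times Y$ in which $\{0\}\times Y$ is collapsed to the vertex, with the distance $d((r,x),(s,y))^2=r^2+s^2-2rs\cos(\min(d_Y(x,y),\pi))$. Then there is a complex linear isomorphism $g:\mathbf{C}^n\to\mathbf{C}^n$ with $g(\{u=0\})=\{u=0\}$ such that $\omega'=g^*\omega_{(\beta)}$ on $\mathbf{C}^n\setminus\{u=0\}$. -/

import Mathlib

open scoped ENNReal NNReal

noncomputable section

namespace KahlerCone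

/-- Complex Euclidean space `ℂⁿ` with `n = m + 1 ≥ 1`. A point `z` has the coordinates
`(u, v₁, …, vₘ)`, where `u = z 0` and `vᵢ = z i.succ`. -/
abbrev Cn (m : ℕ) : Type := Fin (m + 1) → ℂ

/-- A real-valued differential 2-form on `ℂⁿ`. -/
abbrev TwoForm (m : ℕ) : Type := Cn m → Cn m [⋀^Fin 2]→L[ℝ] ℝ

/-- The complement of the divisor `{u = 0}` in `ℂⁿ`. -/
def divisorCompl (m : ℕ) : Set (Cn m) := {z | z 0 ≠ 0}

/-- The Riemannian metric `g(x, y) = ω(x, iy)` determined by (the value at one point of) a 2-form. -/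
def riem {m : ℕ} (η : Cn m [⋀^Fin 2]→L[ℝ] ℝ) (x y : Cn m) : ℝ :=
  η ![x, Complex.I • y]

/-- `ω` is (the 2-form of) a Kähler metric on the set `U`: a smooth, closed, real 2-form which is
of type `(1,1)` and positive at every point of `U`. -/
structure IsKahlerOn {m : ℕ} (ω : TwoForm m) (U : Set (Cn m)) : Prop where
  smooth : ContDiffOn ℝ ((⊤ : ℕ∞) : WithTop ℕ∞) ω U
  closed : ∀ z ∈ U, extDeriv ω z = 0
  type_one_one : ∀ z ∈ U, ∀ x y : Cn m, ω z ![Complex.I • x, Complex.I • y] = ω z ![x, y]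
  pos : ∀ z ∈ U, ∀ x : Cn m, x ≠ 0 → 0 < riem (ω z) x x

/-- The area form `(i/2) dw ∧ dw̄` on `ℂ`, `(a, b) ↦ Im (ā b)`. -/
def areaForm : ℂ [⋀^Fin 2]→L[ℝ] ℝ :=
  haveI := Complex.finrank_real_complex_fact
  Complex.orientation.volumeForm.mkContinuous 1 fun v => by
    simpa using Complex.orientation.abs_volumeForm_apply_le v

/-- The form `(i/2) dzⱼ ∧ dz̄ⱼ` on `ℂⁿ`. -/
def coordForm {m : ℕ} (j : Fin (m + 1)) : Cn m [⋀^Fin 2]→L[ℝ] ℝ :=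
  areaForm.compContinuousLinearMap (ContinuousLinearMap.proj (R := ℝ) (φ := fun _ => ℂ) j)

/-- The model cone metric of angle `2πβ` along `{u = 0}`, as a Kähler form:
`ω_(β) = (i/2) (|u|^(2β-2) du ∧ dū + ∑ᵢ dvᵢ ∧ dv̄ᵢ)`, the form of the Riemannian metric
`|u|^(2β-2) |du|² + ∑ᵢ |dvᵢ|²`. It is meant on `{u ≠ 0}` only. -/
def modelForm (m : ℕ) (β : ℝ) : TwoForm m := fun z =>
  (‖z 0‖ ^ (2 * β - 2)) • coordForm 0 + ∑ i : Fin m, coordForm i.succ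

/-- The real basis `e₀, i e₀, e₁, i e₁, …` of `ℂⁿ`. -/
def realBasis (m : ℕ) : Module.Basis (Σ _ : Fin (m + 1), Fin 2) ℝ (Cn m) :=
  Pi.basis fun _ => Complex.basisOneI

/-- The Riemannian volume form at a point, `√(det g(e_a, e_b)) dx₀ ∧ dy₀ ∧ dx₁ ∧ dy₁ ∧ …`,
the Gram determinant being taken in the real basis above. For a Kähler form `ω` this is
`ωⁿ / n!`. -/
def volForm {m : ℕ} (η : Cn m [⋀^Fin 2]→L[ℝ] ℝ) :
    Cn m [⋀^(Σ _ : Fin (m + 1), Fin 2)]→ₗ[ℝ] ℝ :=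
  √(Matrix.det (Matrix.of fun a b => riem η (realBasis m a) (realBasis m b))) •
    (realBasis m).det

/-- The length of the path `γ : [0, 1] → ℂⁿ` in the Riemannian metric of `ω`. -/
def pathLength {m : ℕ} (ω : TwoForm m) (γ : ℝ → Cn m) : ℝ≥0∞ :=
  ∫⁻ t in Set.Icc (0 : ℝ) 1, ENNReal.ofReal
    √(riem (ω (γ t)) (derivWithin γ (Set.Icc 0 1) t) (derivWithin γ (Set.Icc 0 1) t))

/-- The Riemannian distance of `ω` on `U`: the infimum of the lengths of the `C¹` paths in `U`
from `p` to `q`. -/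
def pathDist {m : ℕ} (ω : TwoForm m) (U : Set (Cn m)) (p q : Cn m) : ℝ≥0∞ :=
  sInf {ℓ | ∃ γ : ℝ → Cn m, ContDiffOn ℝ 1 γ (Set.Icc 0 1) ∧ Set.MapsTo γ (Set.Icc 0 1) U ∧
    γ 0 = p ∧ γ 1 = q ∧ ℓ = pathLength ω γ}

/-- `d` is the distance function on `ℂⁿ` induced by a metric `ω` which is defined on `{u ≠ 0}`:
the continuous extension to all of `ℂⁿ` of the Riemannian distance of `ω` on the dense open set
`{u ≠ 0}`. There is at most one such `d` with nonnegative values. -/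
structure IsInducedDist {m : ℕ} (ω : TwoForm m) (d : Cn m → Cn m → ℝ) : Prop where
  nonneg : ∀ p q, 0 ≤ d p q
  continuous : Continuous fun x : Cn m × Cn m => d x.1 x.2
  extends_dist : ∀ p ∈ divisorCompl m, ∀ q ∈ divisorCompl m,
    pathDist ω (divisorCompl m) p q = ENNReal.ofReal (d p q)

/-- The Euclidean cone distance on `[0, ∞) × Y`, for a metric space `Y`:
`d((r, x), (s, y))² = r² + s² - 2 r s cos (min (d(x, y), π))`. -/
def coneDist {Y : Type*} [MetricSpace Y] (a b : ℝ≥0 × Y) : ℝ :=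
  √((a.1 : ℝ) ^ 2 + (b.1 : ℝ) ^ 2 - 2 * a.1 * b.1 * Real.cos (min (dist a.2 b.2) Real.pi))

/-- The set `X` with the distance function `d` is a metric cone with vertex `o`: it is isometric to
the cone `C(Y)` over some metric space `Y`, the quotient of `[0, ∞) × Y` which collapses
`{0} × Y` to the vertex, by an isometry which takes the vertex to `o`. The isometry is given
through its composition `Φ` with the quotient map. -/
def IsMetricCone {X : Type} (d : X → X → ℝ) (o : X) : Prop :=
  ∃ (Y : Type) (_ : MetricSpace Y) (Φ : ℝ≥0 × Y → X),
    Function.Surjective Φ ∧ (∀ a b, d (Φ a) (Φ b) = coneDist a b) ∧ ∀ y, Φ (0, y) = o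

/-- `ω` and `ω₀` are uniformly equivalent on `U`: `C⁻¹ ω₀ ≤ ω ≤ C ω₀` for some constant `C > 0`. -/
def UniformlyEquivalentOn {m : ℕ} (ω ω₀ : TwoForm m) (U : Set (Cn m)) : Prop :=
  ∃ C : ℝ, 0 < C ∧ ∀ z ∈ U, ∀ x : Cn m,
    C⁻¹ * riem (ω₀ z) x x ≤ riem (ω z) x x ∧ riem (ω z) x x ≤ C * riem (ω₀ z) x x

end KahlerCone

end

/-! Let `g` be the Riemannian metric of `ω'`. The heart of the matter is that `g(w, w)` is constant
off the divisor for every constant vector `w` tangent to `{u = 0}`. This rests on a homothetic flow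
coming from the cone structure and on a maximum principle coming from the volume form.

The flow. On a cone the law of cosines expresses the squared distance from the vertex through
distances between nearby points (`IsMetricCone.exists_ray`). Those have a Taylor expansion governed
by `g` and its first derivatives (`abs_dist_sq_sub_distJet_le`). So half the squared distance from
`0` has a gradient `X` off the divisor, with `∇X = id` and `|X| = d(·, 0)` (`exists_gradient`). As
`g` is Kähler, `X` is holomorphic. Comparison with the model bounds its growth, and Liouville
arguments in `u` and in `v` make it a linear field (`exists_linear_of_growth`). Its flow consists of
linear maps which multiply `g` by `exp (2t)`.

The maximum principle. The logarithm of the volume density is `(4β - 4) log |u|`, which is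
pluriharmonic, so `g` is Ricci flat. Then the Laplacian of `g(w, w)` is a sum of squares of first
derivatives of `g` along `w` and `I • w` (`hasLaplacian_metric`). Here Laplacians are sums of second
derivatives along the coordinate lines of `e` and `I • e`, for a full real orthonormal frame `e`. On
a Kähler manifold this is twice the Laplacian, because the Christoffel terms cancel between `e` and
`I • e`. Uniform equivalence bounds `g(w, w)`. The flow moves a maximizing sequence into a bounded
region, and the strong maximum principle, valid also at points of the divisor, gives constancy
(`metric_tang_const`).

The end. Constancy kills all derivatives of `g` along `w`. The mixed coefficient `g(∂/∂u, w)` then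
yields a holomorphic function of `u` of size `O(|u|^(β-1))`, hence zero (`metric_mixed_eq_zero`).
The determinant finally forces `g(∂/∂u, ∂/∂u) = k₀ |u|^(2β-2)`, and a linear change of coordinates
normalizes the constants (`exists_linearEquiv_of_tang_const`). -/

noncomputable section

/-! ### Kähler forms as metric tensors. -/

namespace KahlerCone

variable {m : ℕ}

/-- Evaluation of a 2-form at a pair of vectors, as a bilinear map in the vectors. -/
lemma form_apply_eq_curry (η : Cn m [⋀^Fin 2]→L[ℝ] ℝ) (x y : Cn m) :
    η ![x, y] = (η.curryLeft x).curryLeft y ![] := by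
  rfl

lemma form_add_left (η : Cn m [⋀^Fin 2]→L[ℝ] ℝ) (x x' y : Cn m) :
    η ![x + x', y] = η ![x, y] + η ![x', y] := by
  simp only [form_apply_eq_curry, map_add, ContinuousAlternatingMap.curryLeft_add]
  rfl

lemma form_smul_left (η : Cn m [⋀^Fin 2]→L[ℝ] ℝ) (c : ℝ) (x y : Cn m) :
    η ![c • x, y] = c * η ![x, y] := by
  simp only [form_apply_eq_curry, map_smul, ContinuousAlternatingMap.curryLeft_smul]
  rfl

lemma form_add_right (η : Cn m [⋀^Fin 2]→L[ℝ] ℝ) (x y y' : Cn m) :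
    η ![x, y + y'] = η ![x, y] + η ![x, y'] := by
  simp only [form_apply_eq_curry, map_add, ContinuousAlternatingMap.add_apply]

lemma form_smul_right (η : Cn m [⋀^Fin 2]→L[ℝ] ℝ) (c : ℝ) (x y : Cn m) :
    η ![x, c • y] = c * η ![x, y] := by
  simp only [form_apply_eq_curry, map_smul, ContinuousAlternatingMap.smul_apply, smul_eq_mul]

/-- The Riemannian metric of a 2-form at a point, as a continuous bilinear map. -/
def bil (η : Cn m [⋀^Fin 2]→L[ℝ] ℝ) : Cn m →L[ℝ] Cn m →L[ℝ] ℝ :=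
  LinearMap.toContinuousLinearMap
    { toFun := fun x => LinearMap.toContinuousLinearMap
        { toFun := fun y => riem η x y
          map_add' := fun y y' => by simp only [riem, smul_add, form_add_right]
          map_smul' := fun c y => by
            simp only [riem, smul_comm Complex.I c y, form_smul_right, smul_eq_mul,
              RingHom.id_apply] }
      map_add' := fun x x' => by ext y; exact form_add_left _ _ _ _
      map_smul' := fun c x => by ext y; exact form_smul_left _ _ _ _ }

@[simp] lemma bil_apply (η : Cn m [⋀^Fin 2]→L[ℝ] ℝ) (x y : Cn m) : bil η x y = riem η x y := rfl

/-- The metric tensor of a field of 2-forms. -/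
def metric (ω : TwoForm m) (z : Cn m) : Cn m →L[ℝ] Cn m →L[ℝ] ℝ := bil (ω z)

lemma metric_apply (ω : TwoForm m) (z x y : Cn m) :
    metric ω z x y = ω z ![x, Complex.I • y] := rfl

lemma form_swap (η : Cn m [⋀^Fin 2]→L[ℝ] ℝ) (x y : Cn m) : η ![y, x] = - η ![x, y] := by
  have h := η.map_swap ![x, y] (i := 0) (j := 1) (by decide)
  have h2 : (![x, y] : Fin 2 → Cn m) ∘ Equiv.swap 0 1 = ![y, x] := by
    ext i; fin_cases i <;> simp
  rw [h2] at h
  exact h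

lemma I_smul_I_smul (x : Cn m) : Complex.I • Complex.I • x = -x := by
  rw [smul_smul, Complex.I_mul_I, neg_one_smul]

lemma form_neg_right (η : Cn m [⋀^Fin 2]→L[ℝ] ℝ) (x y : Cn m) : η ![x, -y] = - η ![x, y] := by
  simpa using form_smul_right η (-1) x y

/-- A smooth Kähler metric on `U`, through its metric tensor. -/
structure IsKahlerMetricOn (g : Cn m → Cn m →L[ℝ] Cn m →L[ℝ] ℝ) (U : Set (Cn m)) : Prop where
  smooth : ContDiffOn ℝ ((⊤ : ℕ∞) : WithTop ℕ∞) g U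
  symm : ∀ z ∈ U, ∀ x y, g z x y = g z y x
  inv : ∀ z ∈ U, ∀ x y, g z (Complex.I • x) (Complex.I • y) = g z x y
  pos : ∀ z ∈ U, ∀ x, x ≠ 0 → 0 < g z x x
  closed : ∀ z ∈ U, ∀ a b c, fderiv ℝ g z a (Complex.I • b) c + fderiv ℝ g z b (Complex.I • c) a +
    fderiv ℝ g z c (Complex.I • a) b = 0

lemma isOpen_divisorCompl : IsOpen (divisorCompl m) :=
  isOpen_ne_fun (continuous_apply 0) continuous_const

lemma hasFDerivAt_form_apply {ω : TwoForm m} {z : Cn m} (hω : DifferentiableAt ℝ ω z)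
    (v : Fin 2 → Cn m) :
    HasFDerivAt (fun p => ω p v)
      ((ContinuousAlternatingMap.apply ℝ (Cn m) ℝ v).comp (fderiv ℝ ω z)) z :=
  HasFDerivAt.comp (g := ContinuousAlternatingMap.apply ℝ (Cn m) ℝ v) z
    (ContinuousAlternatingMap.apply ℝ (Cn m) ℝ v).hasFDerivAt hω.hasFDerivAt

lemma fderiv_metric_apply {ω : TwoForm m} {z : Cn m} (hω : DifferentiableAt ℝ ω z)
    (hg : DifferentiableAt ℝ (metric ω) z) (a x y : Cn m) :
    fderiv ℝ (metric ω) z a x y = fderiv ℝ ω z a ![x, Complex.I • y] := by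
  have h1 : HasFDerivAt (fun p => metric ω p x y) ((ContinuousLinearMap.apply ℝ ℝ y).comp
      ((ContinuousLinearMap.apply ℝ _ x).comp (fderiv ℝ (metric ω) z))) z :=
    HasFDerivAt.comp (g := ContinuousLinearMap.apply ℝ ℝ y) z
      (ContinuousLinearMap.apply ℝ ℝ y).hasFDerivAt
      (HasFDerivAt.comp (g := ContinuousLinearMap.apply ℝ (Cn m →L[ℝ] ℝ) x) z
        (ContinuousLinearMap.apply ℝ (Cn m →L[ℝ] ℝ) x).hasFDerivAt hg.hasFDerivAt)
  have h2 : HasFDerivAt (fun p => ω p ![x, Complex.I • y])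
      ((ContinuousAlternatingMap.apply ℝ (Cn m) ℝ ![x, Complex.I • y]).comp (fderiv ℝ ω z)) z :=
    hasFDerivAt_form_apply hω _
  have h3 := h1.unique h2
  exact DFunLike.congr_fun h3 a

lemma IsKahlerOn.isKahlerMetricOn {ω : TwoForm m} (h : IsKahlerOn ω (divisorCompl m)) :
    IsKahlerMetricOn (metric ω) (divisorCompl m) := by
  have hsm : ContDiffOn ℝ ((⊤ : ℕ∞) : WithTop ℕ∞) (metric ω) (divisorCompl m) := by
    rw [contDiffOn_clm_apply]
    intro x
    rw [contDiffOn_clm_apply]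
    intro y
    exact (ContinuousAlternatingMap.apply ℝ (Cn m) ℝ ![x, Complex.I • y]).contDiff.comp_contDiffOn
      h.smooth
  have hJ : ∀ z ∈ divisorCompl m, ∀ x y, metric ω z (Complex.I • x) (Complex.I • y) =
      metric ω z x y := fun z hz x y => by
    rw [metric_apply, h.type_one_one z hz]; rfl
  refine ⟨hsm, ?_, hJ, fun z hz x hx => h.pos z hz x hx, ?_⟩
  · intro z hz x y
    rw [metric_apply, metric_apply, ← h.type_one_one z hz x, I_smul_I_smul, form_neg_right,
      form_swap, neg_neg]
  · intro z hz a b c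
    have hU := isOpen_divisorCompl.mem_nhds hz
    have hω : DifferentiableAt ℝ ω z := (h.smooth.contDiffAt hU).differentiableAt (by simp)
    have hg : DifferentiableAt ℝ (metric ω) z := (hsm.contDiffAt hU).differentiableAt (by simp)
    -- The form is recovered from the metric as `ω(b, c) = g(I • b, c)`, so that `closed` is the
    -- cyclic sum expressing `dω = 0`.
    have key : ∀ a b c, fderiv ℝ (metric ω) z a (Complex.I • b) c = fderiv ℝ ω z a ![b, c] := by
      intro a b c
      have hEv : (fun p => metric ω p (Complex.I • b) c) =ᶠ[nhds z] fun p => ω p ![b, c] := by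
        filter_upwards [hU] with p hp
        rw [metric_apply, h.type_one_one p hp]
      rw [fderiv_metric_apply hω hg]
      have h1 : HasFDerivAt (fun p => ω p ![Complex.I • b, Complex.I • c])
          ((ContinuousAlternatingMap.apply ℝ (Cn m) ℝ ![Complex.I • b, Complex.I • c]).comp
            (fderiv ℝ ω z)) z :=
        hasFDerivAt_form_apply hω _
      have h2 : HasFDerivAt (fun p => ω p ![b, c])
          ((ContinuousAlternatingMap.apply ℝ (Cn m) ℝ ![b, c]).comp (fderiv ℝ ω z)) z :=
        hasFDerivAt_form_apply hω _
      have h3 : HasFDerivAt (fun p => ω p ![Complex.I • b, Complex.I • c]) _ z :=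
        h2.congr_of_eventuallyEq hEv
      exact DFunLike.congr_fun (h1.unique h3) a
    rw [key, key, key]
    have hc := congrArg (fun η => η ![a, b, c]) (h.closed z hz)
    simp only [extDeriv, ContinuousAlternatingMap.alternatizeUncurryFin_apply] at hc
    rw [Fin.sum_univ_three] at hc
    have e0 : Fin.removeNth 0 ![a, b, c] = ![b, c] := by
      ext i; fin_cases i <;> simp [Fin.removeNth]
    have e1 : Fin.removeNth 1 ![a, b, c] = ![a, c] := by
      ext i; fin_cases i <;> simp [Fin.removeNth, Fin.succAbove]
    have e2 : Fin.removeNth 2 ![a, b, c] = ![a, b] := by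
      ext i; fin_cases i <;> simp [Fin.removeNth, Fin.succAbove]
    rw [e0, e1, e2] at hc
    -- Antisymmetry absorbs the minus sign of the middle term of the exterior derivative.
    have hs : fderiv ℝ ω z b ![c, a] = - fderiv ℝ ω z b ![a, c] := form_swap _ _ _
    rw [hs]
    simp at hc
    linarith

end KahlerCone
end

/-! ### A Liouville theorem on the punctured plane. -/

noncomputable section

namespace KahlerCone

open Filter Topology Asymptotics

variable {m : ℕ}

/-- A holomorphic function on the punctured plane which is `O(|u|^(-α))` at the origin and
`O(|u|^α)` at infinity, with `α < 1`, is constant. -/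
theorem eq_of_punctured_growth {f : ℂ → ℂ} (hf : DifferentiableOn ℂ f {0}ᶜ) {C α : ℝ}
    (hα : 0 ≤ α) (hα1 : α < 1)
    (hb : ∀ u ≠ 0, ‖f u‖ ≤ C * (1 + ‖u‖ ^ (-α) + ‖u‖ ^ α)) :
    ∀ u ≠ 0, ∀ v ≠ 0, f u = f v := by
  have hC : 0 ≤ C := by
    have := (norm_nonneg _).trans (hb 1 one_ne_zero)
    simp at this; linarith
  -- As `α < 1`, the growth at the origin is `o(1 / |z|)`, so the singularity is removable. The
  -- value `f 0` is arbitrary and only shifts by a constant.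
  have ho : (fun z => f z - f 0) =o[𝓝[≠] 0] fun z => (z - 0)⁻¹ := by
    rw [isLittleO_iff]
    intro c hc
    have ht : Tendsto (fun x : ℝ => C * (x + x ^ (1 - α) + x ^ (1 + α)) + ‖f 0‖ * x) (𝓝 0)
        (𝓝 0) := by
      have : ContinuousAt (fun x : ℝ => C * (x + x ^ (1 - α) + x ^ (1 + α)) + ‖f 0‖ * x) 0 := by
        have h1 : ContinuousAt (fun x : ℝ => x ^ (1 - α)) 0 :=
          Real.continuousAt_rpow_const _ _ (Or.inr (by linarith))
        have h2 : ContinuousAt (fun x : ℝ => x ^ (1 + α)) 0 :=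
          Real.continuousAt_rpow_const _ _ (Or.inr (by linarith))
        fun_prop
      have h0 := this.tendsto
      simpa [Real.zero_rpow (by linarith : (1 - α) ≠ 0),
        Real.zero_rpow (by linarith : (1 + α) ≠ 0)] using h0
    have hn : Tendsto (fun z : ℂ => ‖z‖) (𝓝[≠] 0) (𝓝 0) := by
      have : Tendsto (fun z : ℂ => ‖z‖) (𝓝 0) (𝓝 0) := by
        simpa using (continuous_norm (E := ℂ)).tendsto 0
      exact this.mono_left nhdsWithin_le_nhds
    filter_upwards [(ht.comp hn).eventually (gt_mem_nhds hc), self_mem_nhdsWithin] with z hz hz0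
    have hz0 : z ≠ 0 := hz0
    have hp : 0 < ‖z‖ := norm_pos_iff.mpr hz0
    simp only [Function.comp] at hz
    rw [sub_zero, norm_inv, ← div_eq_mul_inv, le_div_iff₀ hp]
    have e1 : ‖z‖ ^ (1 - α) = ‖z‖ ^ (-α) * ‖z‖ := by
      rw [sub_eq_add_neg, add_comm, Real.rpow_add hp, Real.rpow_one]
    have e2 : ‖z‖ ^ (1 + α) = ‖z‖ ^ α * ‖z‖ := by
      rw [add_comm, Real.rpow_add hp, Real.rpow_one]
    rw [e1, e2] at hz
    have := norm_sub_le (f z) (f 0)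
    have := hb z hz0
    nlinarith
  have hd := Complex.differentiableOn_update_limUnder_of_isLittleO (s := Set.univ) univ_mem
    (by simpa [Set.compl_eq_univ_sdiff] using hf) ho
  set F := Function.update f 0 (limUnder (𝓝[≠] 0) f) with hF
  have hFd : Differentiable ℂ F := differentiableOn_univ.mp hd
  have hFf : ∀ u ≠ 0, F u = f u := fun u hu => by simp [hF, hu]
  -- Cauchy's estimate on circles of radius `R` about `c`. For `R ≥ 2‖c‖ + 2` they lie in `1 ≤ |z| ≤
  -- 2R`, and the bound `O(R^α / R)` tends to zero.
  have hder : ∀ c, deriv F c = 0 := by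
    intro c
    have hbd : ∀ᶠ R : ℝ in atTop, ‖deriv F c‖ ≤ C * (2 + 2 * R ^ α) / R := by
      filter_upwards [eventually_ge_atTop (2 * ‖c‖ + 2)] with R hR
      have hRp : 0 < R := by have := norm_nonneg c; linarith
      apply Complex.norm_deriv_le_of_forall_mem_sphere_norm_le hRp hFd.diffContOnCl
      intro z hz
      have hz' : ‖z - c‖ = R := by simpa [dist_eq_norm] using hz
      have h1 : 1 ≤ ‖z‖ := by
        have := norm_sub_le z c
        have := norm_nonneg c
        linarith
      have h2 : ‖z‖ ≤ 2 * R := by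
        have := norm_sub_norm_le z c
        have := norm_nonneg c
        linarith
      have hz0 : z ≠ 0 := by rintro rfl; simp at h1; linarith
      rw [hFf z hz0]
      refine (hb z hz0).trans (mul_le_mul_of_nonneg_left ?_ hC)
      have h3 : ‖z‖ ^ (-α) ≤ 1 := Real.rpow_le_one_of_one_le_of_nonpos h1 (by linarith)
      have h4 : ‖z‖ ^ α ≤ 2 * R ^ α := by
        calc ‖z‖ ^ α ≤ (2 * R) ^ α := Real.rpow_le_rpow (by linarith) h2 hα
          _ = 2 ^ α * R ^ α := Real.mul_rpow (by norm_num) hRp.le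
          _ ≤ 2 ^ (1 : ℝ) * R ^ α := by
            gcongr
            norm_num
          _ = _ := by rw [Real.rpow_one]
      linarith
    have hlim : Tendsto (fun R : ℝ => C * (2 + 2 * R ^ α) / R) atTop (𝓝 0) := by
      have h1 : Tendsto (fun R : ℝ => R⁻¹) atTop (𝓝 0) := tendsto_inv_atTop_zero
      have h2 : Tendsto (fun R : ℝ => R ^ (-(1 - α))) atTop (𝓝 0) :=
        tendsto_rpow_neg_atTop (by linarith)
      have h3 := ((h1.const_mul 2).add (h2.const_mul 2)).const_mul C
      simp only [mul_zero, add_zero] at h3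
      refine h3.congr' ?_
      filter_upwards [eventually_gt_atTop 0] with R hR
      rw [neg_sub, Real.rpow_sub hR, Real.rpow_one]
      field_simp
    have := ge_of_tendsto hlim hbd
    simpa using this
  intro u hu v hv
  rw [← hFf u hu, ← hFf v hv]
  exact is_const_of_deriv_eq_zero hFd hder u v

/-! ### Second derivatives along real lines. -/

/-- `c` is the second derivative at `z` of `f` in the direction `a`. -/
def HasSecondDeriv (f : Cn m → ℝ) (z a : Cn m) (c : ℝ) : Prop :=
  ∃ f₁ : ℝ → ℝ, (∀ᶠ t in 𝓝 (0 : ℝ), HasDerivAt (fun t : ℝ => f (z + t • a)) (f₁ t) t) ∧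
    HasDerivAt f₁ c 0

lemma HasSecondDeriv.add {f g : Cn m → ℝ} {z a : Cn m} {c d : ℝ} (hf : HasSecondDeriv f z a c)
    (hg : HasSecondDeriv g z a d) : HasSecondDeriv (fun x => f x + g x) z a (c + d) := by
  obtain ⟨f₁, h1, h2⟩ := hf
  obtain ⟨g₁, h3, h4⟩ := hg
  refine ⟨fun t => f₁ t + g₁ t, ?_, h2.add h4⟩
  filter_upwards [h1, h3] with t ht ht' using ht.add ht'

lemma HasSecondDeriv.const_mul {f : Cn m → ℝ} {z a : Cn m} {c : ℝ} (k : ℝ)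
    (hf : HasSecondDeriv f z a c) : HasSecondDeriv (fun x => k * f x) z a (k * c) := by
  obtain ⟨f₁, h1, h2⟩ := hf
  refine ⟨fun t => k * f₁ t, ?_, h2.const_mul k⟩
  filter_upwards [h1] with t ht using ht.const_mul k

lemma HasSecondDeriv.add_const {f : Cn m → ℝ} {z a : Cn m} {c : ℝ} (k : ℝ)
    (hf : HasSecondDeriv f z a c) : HasSecondDeriv (fun x => f x + k) z a c := by
  obtain ⟨f₁, h1, h2⟩ := hf
  refine ⟨f₁, ?_, h2⟩
  filter_upwards [h1] with t ht using ht.add_const k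

lemma HasSecondDeriv.nonpos_of_isLocalMax {f : Cn m → ℝ} {z a : Cn m} {c : ℝ}
    (hf : HasSecondDeriv f z a c) (hmax : IsLocalMax f z) : c ≤ 0 := by
  obtain ⟨f₁, h1, h2⟩ := hf
  set F : ℝ → ℝ := fun t => f (z + t • a) with hF
  have hmaxF : IsLocalMax F 0 := by
    have hc : ContinuousAt (fun t : ℝ => z + t • a) 0 := by fun_prop
    have : Tendsto (fun t : ℝ => z + t • a) (𝓝 0) (𝓝 z) := by simpa using hc.tendsto
    have := this.eventually hmax
    simpa [IsLocalMax, IsMaxFilter, hF] using this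
  by_contra! hcon
  have hd : deriv F =ᶠ[𝓝 0] f₁ := by filter_upwards [h1] with t ht using ht.deriv
  have hdd : deriv (deriv F) 0 = c := by rw [hd.deriv_eq, h2.deriv]
  have hcont : ContinuousAt F 0 := h1.self_of_nhds.continuousAt
  -- A positive second derivative would make the maximum a strict-sense contradiction: the point is
  -- also a local minimum, so `F` is locally constant and the second derivative vanishes.
  have hmin := isLocalMin_of_deriv_deriv_pos (by rw [hdd]; exact hcon) hmaxF.deriv_eq_zero hcont
  have hconst : F =ᶠ[𝓝 0] fun _ => F 0 := by
    filter_upwards [hmin, hmaxF] with t h h' using le_antisymm h' h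
  have hd0 : deriv F =ᶠ[𝓝 0] fun _ => 0 := by
    have := hconst.deriv
    simpa using this
  have : deriv (deriv F) 0 = 0 := by rw [hd0.deriv_eq]; simp
  linarith

/-- The function `f` has at `z` the Laplacian `c` with respect to the frame `e`, `I • e`. -/
def HasLaplacian {ι : Type*} [Fintype ι] (f : Cn m → ℝ) (z : Cn m) (e : ι → Cn m) (c : ℝ) : Prop :=
  ∃ p q : ι → ℝ, (∀ a, HasSecondDeriv f z (e a) (p a)) ∧
    (∀ a, HasSecondDeriv f z (Complex.I • e a) (q a)) ∧ ∑ a, (p a + q a) = c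

end KahlerCone
end

/-! ### Laplacians of the explicit barrier functions. -/

noncomputable section

namespace KahlerCone

open Filter Topology Asymptotics

variable {m : ℕ}

/-- The barriers are all functions of a squared norm, which along a line is a quadratic polynomial
in `t`. The formula is the chain rule at `t = 0`. -/
lemma HasSecondDeriv.of_quadratic {f : Cn m → ℝ} {z a : Cn m} {F F' : ℝ → ℝ} {A B C F'' : ℝ}
    (h : ∀ t : ℝ, f (z + t • a) = F (A + B * t + C * t ^ 2))
    (hF : ∀ᶠ s in 𝓝 A, HasDerivAt F (F' s) s) (hF' : HasDerivAt F' F'' A) :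
    HasSecondDeriv f z a (F'' * B ^ 2 + F' A * (2 * C)) := by
  have hq : ∀ t : ℝ, HasDerivAt (fun t : ℝ => A + B * t + C * t ^ 2) (B + C * (2 * t)) t := by
    intro t
    have := (((hasDerivAt_id t).const_mul B).const_add A).fun_add (((hasDerivAt_id t).pow 2).const_mul C)
    simpa using this
  have hq0 : A + B * 0 + C * 0 ^ 2 = A := by ring
  refine ⟨fun t => F' (A + B * t + C * t ^ 2) * (B + C * (2 * t)), ?_, ?_⟩
  · have hc : Tendsto (fun t : ℝ => A + B * t + C * t ^ 2) (𝓝 0) (𝓝 A) := by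
      have := (hq 0).continuousAt.tendsto
      rwa [hq0] at this
    filter_upwards [hc.eventually hF] with t ht
    have : (fun t : ℝ => f (z + t • a)) = fun t => F (A + B * t + C * t ^ 2) := funext h
    rw [this]
    exact ht.comp t (hq t)
  · have h1 : HasDerivAt (fun t : ℝ => F' (A + B * t + C * t ^ 2)) (F'' * (B + C * (2 * 0))) 0 :=
      HasDerivAt.comp (0 : ℝ) (by rw [hq0]; exact hF') (hq 0)
    have h2 : HasDerivAt (fun t : ℝ => B + C * (2 * t)) (C * 2) 0 := by
      simpa using (((hasDerivAt_id (0 : ℝ)).const_mul 2).const_mul C).const_add B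
    have := h1.mul h2
    convert! this using 1
    rw [hq0]; ring

/-- The squared Euclidean norm of the coordinates in `s`. -/
def sqn (s : Finset (Fin (m + 1))) (x : Cn m) : ℝ := ∑ i ∈ s, ‖x i‖ ^ 2

/-- The real inner product of the coordinates in `s`. -/
def ipn (s : Finset (Fin (m + 1))) (x y : Cn m) : ℝ := ∑ i ∈ s, inner ℝ (x i) (y i)

lemma sqn_nonneg (s : Finset (Fin (m + 1))) (x : Cn m) : 0 ≤ sqn s x :=
  Finset.sum_nonneg fun _ _ => sq_nonneg _

lemma sqn_I_smul (s : Finset (Fin (m + 1))) (x : Cn m) : sqn s (Complex.I • x) = sqn s x := by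
  simp [sqn]

lemma continuous_sqn (s : Finset (Fin (m + 1))) : Continuous (sqn (m := m) s) := by
  unfold sqn; fun_prop

lemma sqn_add_smul (s : Finset (Fin (m + 1))) (x a : Cn m) (t : ℝ) :
    sqn s (x + t • a) = sqn s x + 2 * ipn s x a * t + sqn s a * t ^ 2 := by
  simp only [sqn, ipn, Finset.mul_sum, Finset.sum_mul, ← Finset.sum_add_distrib]
  refine Finset.sum_congr rfl fun i _ => ?_
  rw [Pi.add_apply, Pi.smul_apply, norm_add_sq_real, inner_smul_right, norm_smul, mul_pow,
    Real.norm_eq_abs, sq_abs]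
  ring

/-- The two inner products are, up to sign, the real and imaginary parts of `x̄ a`. This identity is
behind the pluriharmonicity of `log |u|`. -/
lemma inner_sq_add_inner_I_sq (x a : ℂ) :
    inner ℝ x a ^ 2 + inner ℝ x (Complex.I * a) ^ 2 = ‖x‖ ^ 2 * ‖a‖ ^ 2 := by
  simp only [Complex.inner, Complex.sq_norm, Complex.normSq_apply]
  simp
  ring

lemma hasSecondDeriv_sqn (s : Finset (Fin (m + 1))) (q z a : Cn m) :
    HasSecondDeriv (fun x => sqn s (x - q)) z a (2 * sqn s a) := by
  have := HasSecondDeriv.of_quadratic (f := fun x => sqn s (x - q)) (z := z) (a := a) (F := id)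
    (F' := fun _ => 1) (A := sqn s (z - q)) (B := 2 * ipn s (z - q) a) (C := sqn s a) (F'' := 0)
    (fun t => by rw [add_sub_right_comm, sqn_add_smul]; rfl)
    (Eventually.of_forall fun s => hasDerivAt_id s) (hasDerivAt_const _ _)
  simpa using this

lemma hasSecondDeriv_exp_sqn (α : ℝ) (s : Finset (Fin (m + 1))) (q z a : Cn m) :
    HasSecondDeriv (fun x => Real.exp (-α * sqn s (x - q))) z a
      (Real.exp (-α * sqn s (z - q)) * (4 * α ^ 2 * ipn s (z - q) a ^ 2 - 2 * α * sqn s a)) := by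
  have hd : ∀ t : ℝ, HasDerivAt (fun t => Real.exp (-α * t)) (-α * Real.exp (-α * t)) t := by
    intro t
    have := ((hasDerivAt_id t).const_mul (-α)).exp
    simpa [mul_comm] using this
  have := HasSecondDeriv.of_quadratic (f := fun x => Real.exp (-α * sqn s (x - q))) (z := z) (a := a)
    (F := fun t => Real.exp (-α * t))
    (F' := fun t => -α * Real.exp (-α * t)) (A := sqn s (z - q)) (B := 2 * ipn s (z - q) a)
    (C := sqn s a) (F'' := -α * (-α * Real.exp (-α * sqn s (z - q))))
    (fun t => by rw [add_sub_right_comm, sqn_add_smul])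
    (Eventually.of_forall hd) ((hd _).const_mul _)
  convert! this using 1
  ring

lemma norm_zero_add_smul (z a : Cn m) (t : ℝ) :
    ‖(z + t • a) 0‖ ^ 2 = ‖z 0‖ ^ 2 + 2 * inner ℝ (z 0) (a 0) * t + ‖a 0‖ ^ 2 * t ^ 2 := by
  have := sqn_add_smul {0} z a t
  simpa [sqn, ipn] using this

lemma hasSecondDeriv_log (z a : Cn m) (hz : z ∈ divisorCompl m) :
    HasSecondDeriv (fun x => Real.log ‖x 0‖) z a
      (‖a 0‖ ^ 2 / ‖z 0‖ ^ 2 - 2 * inner ℝ (z 0) (a 0) ^ 2 / ‖z 0‖ ^ 4) := by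
  have hp : 0 < ‖z 0‖ := norm_pos_iff.mpr hz
  have hA : ‖z 0‖ ^ 2 ≠ 0 := by positivity
  have := HasSecondDeriv.of_quadratic (f := fun x => Real.log ‖x 0‖) (z := z) (a := a)
    (F := fun s => (1 / 2) * Real.log s) (F' := fun s => (1 / 2) * s⁻¹) (A := ‖z 0‖ ^ 2)
    (B := 2 * inner ℝ (z 0) (a 0)) (C := ‖a 0‖ ^ 2) (F'' := (1 / 2) * -((‖z 0‖ ^ 2) ^ 2)⁻¹)
    (fun t => by rw [← norm_zero_add_smul, Real.log_pow]; push_cast; ring)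
    (by
      filter_upwards [isOpen_ne.mem_nhds hA] with s hs
      exact (Real.hasDerivAt_log hs).const_mul _)
    ((hasDerivAt_inv hA).const_mul _)
  convert! this using 1
  field_simp
  ring

lemma hasSecondDeriv_rpow (β : ℝ) (z a : Cn m) (hz : z ∈ divisorCompl m) :
    HasSecondDeriv (fun x => ‖x 0‖ ^ (2 * β)) z a
      (4 * β * (β - 1) * ‖z 0‖ ^ (2 * β - 4) * inner ℝ (z 0) (a 0) ^ 2 +
        2 * β * ‖z 0‖ ^ (2 * β - 2) * ‖a 0‖ ^ 2) := by
  have hp : 0 < ‖z 0‖ := norm_pos_iff.mpr hz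
  have hA : ‖z 0‖ ^ 2 ≠ 0 := by positivity
  have e : ∀ (x : ℝ) (γ : ℝ), 0 ≤ x → (x ^ 2) ^ γ = x ^ (2 * γ) := fun x γ hx => by
    rw [Real.rpow_mul hx, Real.rpow_two]
  have := HasSecondDeriv.of_quadratic (f := fun x => ‖x 0‖ ^ (2 * β)) (z := z) (a := a)
    (F := fun s => s ^ β) (F' := fun s => β * s ^ (β - 1)) (A := ‖z 0‖ ^ 2)
    (B := 2 * inner ℝ (z 0) (a 0)) (C := ‖a 0‖ ^ 2)
    (F'' := β * ((β - 1) * (‖z 0‖ ^ 2) ^ (β - 1 - 1)))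
    (fun t => by rw [← norm_zero_add_smul, e _ _ (norm_nonneg _)])
    (by
      filter_upwards [isOpen_ne.mem_nhds hA] with s hs
      exact Real.hasDerivAt_rpow_const (Or.inl hs))
    ((Real.hasDerivAt_rpow_const (Or.inl hA)).const_mul _)
  convert! this using 1
  rw [e _ _ hp.le, e _ _ hp.le, show 2 * (β - 1 - 1) = 2 * β - 4 by ring,
    show 2 * (β - 1) = 2 * β - 2 by ring]
  ring

section Laplacian

variable {ι : Type} [Fintype ι]

lemma HasLaplacian.add {f g : Cn m → ℝ} {z : Cn m} {e : ι → Cn m} {c d : ℝ}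
    (hf : HasLaplacian f z e c) (hg : HasLaplacian g z e d) :
    HasLaplacian (fun x => f x + g x) z e (c + d) := by
  obtain ⟨p, q, h1, h2, h3⟩ := hf
  obtain ⟨p', q', h1', h2', h3'⟩ := hg
  refine ⟨fun a => p a + p' a, fun a => q a + q' a, fun a => (h1 a).add (h1' a),
    fun a => (h2 a).add (h2' a), ?_⟩
  rw [← h3, ← h3', ← Finset.sum_add_distrib]
  exact Finset.sum_congr rfl fun a _ => by ring

lemma HasLaplacian.const_mul {f : Cn m → ℝ} {z : Cn m} {e : ι → Cn m} {c : ℝ} (k : ℝ)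
    (hf : HasLaplacian f z e c) : HasLaplacian (fun x => k * f x) z e (k * c) := by
  obtain ⟨p, q, h1, h2, h3⟩ := hf
  refine ⟨fun a => k * p a, fun a => k * q a, fun a => (h1 a).const_mul k,
    fun a => (h2 a).const_mul k, ?_⟩
  rw [← h3, Finset.mul_sum]
  exact Finset.sum_congr rfl fun a _ => by ring

lemma HasLaplacian.add_const {f : Cn m → ℝ} {z : Cn m} {e : ι → Cn m} {c : ℝ} (k : ℝ)
    (hf : HasLaplacian f z e c) : HasLaplacian (fun x => f x + k) z e c := by
  obtain ⟨p, q, h1, h2, h3⟩ := hf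
  exact ⟨p, q, fun a => (h1 a).add_const k, fun a => (h2 a).add_const k, h3⟩

lemma HasLaplacian.nonpos_of_isLocalMax {f : Cn m → ℝ} {z : Cn m} {e : ι → Cn m} {c : ℝ}
    (hf : HasLaplacian f z e c) (hmax : IsLocalMax f z) : c ≤ 0 := by
  obtain ⟨p, q, h1, h2, h3⟩ := hf
  rw [← h3]
  exact Finset.sum_nonpos fun a _ => add_nonpos ((h1 a).nonpos_of_isLocalMax hmax)
    ((h2 a).nonpos_of_isLocalMax hmax)

/-- Each pair `e a`, `I • e a` contributes zero by itself, so no orthonormality is needed. -/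
lemma hasLaplacian_log (z : Cn m) (hz : z ∈ divisorCompl m) (e : ι → Cn m) :
    HasLaplacian (fun x => Real.log ‖x 0‖) z e 0 := by
  refine ⟨_, _, fun a => hasSecondDeriv_log z (e a) hz,
    fun a => hasSecondDeriv_log z (Complex.I • e a) hz, ?_⟩
  refine Finset.sum_eq_zero fun a _ => ?_
  have hp : 0 < ‖z 0‖ := norm_pos_iff.mpr hz
  have h := inner_sq_add_inner_I_sq (z 0) (e a 0)
  have hn : ‖(Complex.I • e a) 0‖ = ‖e a 0‖ := by simp
  have hi : (Complex.I • e a) 0 = Complex.I * e a 0 := rfl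
  rw [hn, hi]
  field_simp
  linarith

/-- The weight `|u|^(2β-2)` is that of the model metric, so for frames of an equivalent metric this
Laplacian stays bounded below up to the divisor. That makes `|u|^(2β)` a barrier there. -/
lemma hasLaplacian_rpow (β : ℝ) (z : Cn m) (hz : z ∈ divisorCompl m) (e : ι → Cn m) :
    HasLaplacian (fun x => ‖x 0‖ ^ (2 * β)) z e
      (4 * β ^ 2 * ∑ a, ‖z 0‖ ^ (2 * β - 2) * ‖e a 0‖ ^ 2) := by
  refine ⟨_, _, fun a => hasSecondDeriv_rpow β z (e a) hz,
    fun a => hasSecondDeriv_rpow β z (Complex.I • e a) hz, ?_⟩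
  rw [Finset.mul_sum]
  refine Finset.sum_congr rfl fun a _ => ?_
  have hp : 0 < ‖z 0‖ := norm_pos_iff.mpr hz
  have h := inner_sq_add_inner_I_sq (z 0) (e a 0)
  have hn : ‖(Complex.I • e a) 0‖ = ‖e a 0‖ := by simp
  have hi : (Complex.I • e a) 0 = Complex.I * e a 0 := rfl
  have hr : ‖z 0‖ ^ (2 * β - 2) = ‖z 0‖ ^ (2 * β - 4) * ‖z 0‖ ^ 2 := by
    rw [← Real.rpow_two, ← Real.rpow_add hp]; congr 1; ring
  rw [hn, hi, hr]
  linear_combination (4 * β * (β - 1) * ‖z 0‖ ^ (2 * β - 4)) * h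

lemma hasLaplacian_sqn (s : Finset (Fin (m + 1))) (q z : Cn m) (e : ι → Cn m) :
    HasLaplacian (fun x => sqn s (x - q)) z e (4 * ∑ a, sqn s (e a)) := by
  refine ⟨_, _, fun a => hasSecondDeriv_sqn s q z (e a),
    fun a => hasSecondDeriv_sqn s q z (Complex.I • e a), ?_⟩
  rw [Finset.mul_sum]
  refine Finset.sum_congr rfl fun a _ => ?_
  rw [sqn_I_smul]; ring

/-- Hopf's barrier. For large `α` the quadratic term wins; the squares of the inner products with `I
• e a` are nonnegative and are dropped. -/
lemma exists_hasLaplacian_exp_sqn (α : ℝ) (s : Finset (Fin (m + 1))) (q z : Cn m) (e : ι → Cn m) :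
    ∃ c, HasLaplacian (fun x => Real.exp (-α * sqn s (x - q))) z e c ∧
      Real.exp (-α * sqn s (z - q)) * (4 * α ^ 2 * ∑ a, ipn s (z - q) (e a) ^ 2 -
        4 * α * ∑ a, sqn s (e a)) ≤ c := by
  refine ⟨_, ⟨_, _, fun a => hasSecondDeriv_exp_sqn α s q z (e a),
    fun a => hasSecondDeriv_exp_sqn α s q z (Complex.I • e a), rfl⟩, ?_⟩
  rw [Finset.mul_sum, Finset.mul_sum, ← Finset.sum_sub_distrib, Finset.mul_sum]
  refine Finset.sum_le_sum fun a _ => ?_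
  rw [sqn_I_smul, ← mul_add]
  refine mul_le_mul_of_nonneg_left ?_ (Real.exp_nonneg _)
  nlinarith [mul_nonneg (sq_nonneg α) (sq_nonneg (ipn s (z - q) (Complex.I • e a)))]

/-! ### The weak maximum principle across the divisor. -/

/-- A maximum principle on a compact set, where the divisor may be ignored because
`log |u|` is pluriharmonic. -/
theorem le_of_hasLaplacian_pos {K P : Set (Cn m)} (hK : IsCompact K) {f : Cn m → ℝ} {M B : ℝ}
    (hf : ContinuousOn f (K ∩ divisorCompl m)) (hB : ∀ z ∈ K ∩ divisorCompl m, f z ≤ B)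
    (hP : ∀ z ∈ K ∩ divisorCompl m, z ∈ P → f z ≤ M)
    (hint : ∀ z ∈ K ∩ divisorCompl m, z ∉ P →
      K ∈ 𝓝 z ∧ ∃ (e : ι → Cn m) (c : ℝ), HasLaplacian f z e c ∧ 0 < c) :
    ∀ z ∈ K ∩ divisorCompl m, f z ≤ M := by
  obtain ⟨R, hR⟩ : ∃ R : ℝ, ∀ z ∈ K, ‖z 0‖ ≤ R := by
    obtain ⟨R, hR⟩ := hK.isBounded.exists_norm_le
    exact ⟨R, fun z hz => (norm_le_pi_norm z 0).trans (hR z hz)⟩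
  set L := Real.log R
  have hL : ∀ z ∈ K ∩ divisorCompl m, Real.log ‖z 0‖ ≤ L := fun z hz =>
    Real.log_le_log (norm_pos_iff.mpr hz.2) (hR z hz.1)
  have hlogc : ContinuousOn (fun z : Cn m => Real.log ‖z 0‖) (divisorCompl m) := by
    intro z hz
    have : ‖z 0‖ ≠ 0 := norm_ne_zero_iff.mpr hz
    exact (((continuous_apply 0).norm.continuousAt (x := z)).log this).continuousWithinAt
  -- The added term has Laplacian zero, is nonpositive on `K` and tends to `-∞` at the divisor, so
  -- the perturbed function has a maximum off the divisor. The claim follows as `κ → 0`.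
  have key : ∀ κ : ℝ, 0 < κ → ∀ z ∈ K ∩ divisorCompl m, f z + κ * (Real.log ‖z 0‖ - L) ≤ M := by
    intro κ hκ z₁ hz₁
    by_contra! hcon
    set F : Cn m → ℝ := fun z => f z + κ * (Real.log ‖z 0‖ - L) with hF
    have hFc : ContinuousOn F (K ∩ divisorCompl m) := by
      refine hf.add ?_
      exact continuousOn_const.mul ((hlogc.mono Set.inter_subset_right).sub continuousOn_const)
    -- Where `|u| < η` the perturbed function is below `F z₁`, so its maximum over `|u| ≥ η` is a
    -- maximum over all of `K` off the divisor.
    obtain ⟨η, hη, hη1, hη2⟩ : ∃ η > 0, η ≤ ‖z₁ 0‖ ∧ B + κ * (Real.log η - L) < F z₁ := by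
      have ht : Tendsto (fun η : ℝ => B + κ * (Real.log η - L)) (𝓝[>] 0) atBot := by
        refine tendsto_atBot_add_const_left _ _ ?_
        refine Tendsto.const_mul_atBot hκ ?_
        exact tendsto_atBot_add_const_right _ _ Real.tendsto_log_nhdsGT_zero
      have h1 := ht.eventually (eventually_lt_atBot (F z₁))
      have h2 : ∀ᶠ η : ℝ in 𝓝[>] 0, η ≤ ‖z₁ 0‖ :=
        nhdsWithin_le_nhds (ge_mem_nhds (norm_pos_iff.mpr hz₁.2))
      obtain ⟨η, ⟨hh1, hh2⟩, hh⟩ := ((h2.and h1).and eventually_mem_nhdsWithin).exists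
      exact ⟨η, hh, hh1, hh2⟩
    set K' := K ∩ {z : Cn m | η ≤ ‖z 0‖} with hK'
    have hK'c : IsCompact K' := hK.inter_right (isClosed_le continuous_const (by fun_prop))
    have hsub : K' ⊆ K ∩ divisorCompl m := fun z hz =>
      ⟨hz.1, norm_pos_iff.mp (hη.trans_le hz.2)⟩
    obtain ⟨z₂, hz₂, hmax⟩ := hK'c.exists_isMaxOn ⟨z₁, hz₁.1, hη1⟩ (hFc.mono hsub)
    have h12 : F z₁ ≤ F z₂ := hmax (show z₁ ∈ K' from ⟨hz₁.1, hη1⟩)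
    have hz₂U := hsub hz₂
    have hall : ∀ z ∈ K ∩ divisorCompl m, F z ≤ F z₂ := by
      intro z hz
      by_cases h : η ≤ ‖z 0‖
      · exact hmax (show z ∈ K' from ⟨hz.1, h⟩)
      · have h3 : Real.log ‖z 0‖ ≤ Real.log η :=
          Real.log_le_log (norm_pos_iff.mpr hz.2) (not_le.mp h).le
        have h4 : F z ≤ B + κ * (Real.log η - L) :=
          add_le_add (hB z hz) (mul_le_mul_of_nonneg_left (by linarith) hκ.le)
        linarith
    have hnP : z₂ ∉ P := by
      intro hp
      have h5 := hP z₂ hz₂U hp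
      have h6 := hL z₂ hz₂U
      have : F z₂ ≤ M := by
        have : κ * (Real.log ‖z₂ 0‖ - L) ≤ 0 :=
          mul_nonpos_of_nonneg_of_nonpos hκ.le (by linarith)
        simp only [hF]; linarith
      linarith
    obtain ⟨hKn, e, c, hlap, hc⟩ := hint z₂ hz₂U hnP
    have hlF : HasLaplacian F z₂ e (c + κ * 0) :=
      hlap.add (((hasLaplacian_log z₂ hz₂U.2 e).add_const (-L)).const_mul κ)
    have hlm : IsLocalMax F z₂ := by
      filter_upwards [hKn, isOpen_divisorCompl.mem_nhds hz₂U.2] with z h h' using hall z ⟨h, h'⟩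
    have := hlF.nonpos_of_isLocalMax hlm
    linarith
  intro z hz
  have ht : Tendsto (fun κ : ℝ => f z + κ * (Real.log ‖z 0‖ - L)) (𝓝[>] 0) (𝓝 (f z)) := by
    have : ContinuousAt (fun κ : ℝ => f z + κ * (Real.log ‖z 0‖ - L)) 0 := by fun_prop
    have h := this.tendsto
    simp only [zero_mul, add_zero] at h
    exact h.mono_left nhdsWithin_le_nhds
  refine le_of_tendsto ht ?_
  filter_upwards [self_mem_nhdsWithin] with κ hκ using key κ hκ z hz

end Laplacian

end KahlerCone
end

/-! ### The strong maximum principle, off the divisor and at the divisor. -/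

noncomputable section

namespace KahlerCone

open Filter Topology Asymptotics

variable {m : ℕ}

/-- The coordinates along the divisor. -/
def tang (m : ℕ) : Finset (Fin (m + 1)) := Finset.univ.erase 0

lemma sqn_univ (x : Cn m) : sqn Finset.univ x = ‖x 0‖ ^ 2 + sqn (tang m) x := by
  rw [sqn, sqn, tang, Finset.add_sum_erase _ (fun i => ‖x i‖ ^ 2) (Finset.mem_univ 0)]

lemma sqn_tang (x : Cn m) : sqn (tang m) x = ∑ i : Fin m, ‖x i.succ‖ ^ 2 := by
  have h1 := sqn_univ x
  rw [sqn, Fin.sum_univ_succ] at h1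
  linarith

/-- The quadratic form of the model metric. -/
def modelQ (β : ℝ) (z x : Cn m) : ℝ := ‖z 0‖ ^ (2 * β - 2) * ‖x 0‖ ^ 2 + sqn (tang m) x

/-- Uniform equivalence of a metric tensor with the model metric. -/
def EquivModel (g : Cn m → Cn m →L[ℝ] Cn m →L[ℝ] ℝ) (β C : ℝ) : Prop :=
  0 < C ∧ ∀ z ∈ divisorCompl m, ∀ x, C⁻¹ * modelQ β z x ≤ g z x x ∧ g z x x ≤ C * modelQ β z x

/-- `Cn m` carries the sup norm; this lemma and `sqn_le_norm_sq` compare it with the Euclidean norm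
used by the barriers. -/
lemma norm_sq_le_sqn (x : Cn m) : ‖x‖ ^ 2 ≤ sqn Finset.univ x := by
  obtain ⟨i, hi⟩ : ∃ i, ‖x‖ = ‖x i‖ := by
    obtain ⟨i, hi⟩ := Finite.exists_max fun i => ‖x i‖
    exact ⟨i, le_antisymm ((pi_norm_le_iff_of_nonneg (norm_nonneg _)).mpr hi)
      (norm_le_pi_norm x i)⟩
  rw [hi]
  exact Finset.single_le_sum (f := fun i => ‖x i‖ ^ 2) (fun _ _ => sq_nonneg _) (Finset.mem_univ i)

lemma sqn_le_norm_sq (s : Finset (Fin (m + 1))) (x : Cn m) : sqn s x ≤ (m + 1) * ‖x‖ ^ 2 := by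
  calc sqn s x ≤ ∑ i ∈ s, ‖x‖ ^ 2 := Finset.sum_le_sum fun i _ =>
        pow_le_pow_left₀ (norm_nonneg _) (norm_le_pi_norm x i) 2
    _ ≤ ∑ i, ‖x‖ ^ 2 := Finset.sum_le_sum_of_subset_of_nonneg (Finset.subset_univ _)
        fun _ _ _ => sq_nonneg _
    _ = _ := by simp

/-- Orthonormal frames of a metric at a point. -/
def IsFrame {ι : Type} [DecidableEq ι] (g : Cn m →L[ℝ] Cn m →L[ℝ] ℝ)
    (e : Module.Basis ι ℝ (Cn m)) : Prop :=
  ∀ a b, g (e a) (e b) = if a = b then 1 else 0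

/-- Cauchy–Schwarz in the coordinates of the frame. It bounds the sum on the right from below, which
is what makes barriers strictly subharmonic. -/
lemma IsFrame.sq_le {ι : Type} [DecidableEq ι] [Fintype ι] {g : Cn m →L[ℝ] Cn m →L[ℝ] ℝ}
    {e : Module.Basis ι ℝ (Cn m)} (he : IsFrame g e) (θ : Cn m →ₗ[ℝ] ℝ) (x : Cn m) :
    θ x ^ 2 ≤ g x x * ∑ a, θ (e a) ^ 2 := by
  have hx := e.sum_repr x
  have h1 : θ x = ∑ a, e.repr x a * θ (e a) := by
    conv_lhs => rw [← hx]
    rw [map_sum]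
    exact Finset.sum_congr rfl fun a _ => by simp
  have h2 : g x x = ∑ a, e.repr x a ^ 2 := by
    conv_lhs => rw [← hx]
    simp only [map_sum, map_smul, sum_apply,
      smul_apply, he _ _, smul_eq_mul]
    simp [sq]
  rw [h1, h2]
  exact Finset.sum_mul_sq_le_sq_mul_sq _ _ _

/-- On a compact set off the divisor the weight `|u|^(2β-2)` lies between positive constants, so `g`
is comparable with the Euclidean metric. -/
lemma exists_bounds_of_isCompact {g : Cn m → Cn m →L[ℝ] Cn m →L[ℝ] ℝ} {β C : ℝ}
    (hC : EquivModel g β C) {K : Set (Cn m)} (hK : IsCompact K) (hKU : K ⊆ divisorCompl m) :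
    ∃ l > 0, ∀ z ∈ K, ∀ x, l * sqn Finset.univ x ≤ g z x x ∧ g z x x ≤ l⁻¹ * sqn Finset.univ x := by
  have hcont : ContinuousOn (fun z : Cn m => ‖z 0‖ ^ (2 * β - 2)) K := by
    intro z hz
    have : ‖z 0‖ ≠ 0 := norm_ne_zero_iff.mpr (hKU hz)
    exact (((continuous_apply 0).norm.continuousAt (x := z)).rpow_const
      (Or.inl this)).continuousWithinAt
  obtain ⟨R, hR⟩ := hK.exists_bound_of_continuousOn hcont
  have hcont' : ContinuousOn (fun z : Cn m => (‖z 0‖ ^ (2 * β - 2))⁻¹) K :=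
    hcont.inv₀ fun z hz => (Real.rpow_pos_of_pos (norm_pos_iff.mpr (hKU hz)) _).ne'
  obtain ⟨R', hR'⟩ := hK.exists_bound_of_continuousOn hcont'
  set S := max 1 (max R R') with hS
  have hS1 : 1 ≤ S := le_max_left _ _
  have hS0 : 0 < S := by linarith
  refine ⟨(C * S)⁻¹, inv_pos.mpr (mul_pos hC.1 hS0), fun z hz x => ?_⟩
  have hp : 0 < ‖z 0‖ ^ (2 * β - 2) := Real.rpow_pos_of_pos (norm_pos_iff.mpr (hKU hz)) _
  have h1 : ‖z 0‖ ^ (2 * β - 2) ≤ S := by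
    have := (le_abs_self _).trans (hR z hz)
    exact this.trans ((le_max_left _ _).trans (le_max_right _ _))
  have h2 : S⁻¹ ≤ ‖z 0‖ ^ (2 * β - 2) := by
    have := (le_abs_self _).trans (hR' z hz)
    have : (‖z 0‖ ^ (2 * β - 2))⁻¹ ≤ S := this.trans ((le_max_right _ _).trans (le_max_right _ _))
    exact inv_le_of_inv_le₀ hp this
  have hT := sqn_nonneg (tang m) x
  have hx0 := sq_nonneg ‖x 0‖
  have hSi : S⁻¹ ≤ 1 := inv_le_one_of_one_le₀ hS1
  obtain ⟨hl, hu⟩ := hC.2 z (hKU hz) x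
  rw [inv_inv, mul_inv, sqn_univ]
  constructor
  · refine le_trans ?_ hl
    rw [mul_assoc]
    refine mul_le_mul_of_nonneg_left ?_ (inv_pos.mpr hC.1).le
    unfold modelQ
    nlinarith
  · refine hu.trans ?_
    rw [mul_assoc]
    refine mul_le_mul_of_nonneg_left ?_ hC.1.le
    unfold modelQ
    nlinarith

/-- `ipn` as a linear functional in its second variable. -/
def ipnL (s : Finset (Fin (m + 1))) (x : Cn m) : Cn m →ₗ[ℝ] ℝ where
  toFun y := ipn s x y
  map_add' y y' := by simp [ipn, inner_add_right, Finset.sum_add_distrib]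
  map_smul' c y := by simp only [ipn, Pi.smul_apply, inner_smul_right, Finset.mul_sum, smul_eq_mul,
    RingHom.id_apply]

lemma ipn_self (s : Finset (Fin (m + 1))) (x : Cn m) : ipn s x x = sqn s x := by
  simp [ipn, sqn]

/-- `h` is subharmonic off the divisor, for the metric `g`. -/
def IsSubharm (ι : Type) [Fintype ι] [DecidableEq ι] (g : Cn m → Cn m →L[ℝ] Cn m →L[ℝ] ℝ)
    (h : Cn m → ℝ) : Prop :=
  ContinuousOn h (divisorCompl m) ∧ ∀ z ∈ divisorCompl m,
    ∃ (e : Module.Basis ι ℝ (Cn m)) (c : ℝ), IsFrame (g z) e ∧ HasLaplacian h z e c ∧ 0 ≤ c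

section

variable {ι : Type} [Fintype ι] [DecidableEq ι] {g : Cn m → Cn m →L[ℝ] Cn m →L[ℝ] ℝ}
  {β C : ℝ} {h : Cn m → ℝ} {M : ℝ}

lemma isCompact_sqn_le (q : Cn m) (R : ℝ) : IsCompact {z : Cn m | sqn Finset.univ (z - q) ≤ R} := by
  refine Metric.isCompact_of_isClosed_isBounded
    (isClosed_le ((continuous_sqn _).comp (by fun_prop)) continuous_const) ?_
  refine (Metric.isBounded_closedBall (x := q) (r := |R| + 1)).subset fun z hz => ?_
  have h1 := (norm_sq_le_sqn (z - q)).trans hz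
  rw [Metric.mem_closedBall, dist_eq_norm]
  have := le_abs_self R
  nlinarith [norm_nonneg (z - q), abs_nonneg R, sq_nonneg (|R|)]

/-- The values strictly below an upper bound propagate to balls (Hopf's barrier). -/
theorem lt_on_ball (hC : EquivModel g β C) (hh : IsSubharm ι g h)
    (hM : ∀ z ∈ divisorCompl m, h z ≤ M) {q : Cn m} {R : ℝ}
    (hsub : {z | sqn Finset.univ (z - q) ≤ R} ⊆ divisorCompl m) (hR : 0 < R) (hq : h q < M) :
    ∀ z, sqn Finset.univ (z - q) < R → h z < M := by
  have hqU : q ∈ divisorCompl m := hsub (by simp [sqn, hR.le])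
  obtain ⟨η, hη, hη'⟩ : ∃ η > 0, h q < M - η := ⟨(M - h q) / 2, by linarith, by linarith⟩
  obtain ⟨δ, hδ, hδR, hδ'⟩ : ∃ δ > 0, δ < R ∧
      ∀ z, sqn Finset.univ (z - q) ≤ δ → h z ≤ M - η := by
    have hcont : ContinuousAt h q := hh.1.continuousAt (isOpen_divisorCompl.mem_nhds hqU)
    obtain ⟨ε, hε, hball⟩ := Metric.eventually_nhds_iff.mp (hcont.eventually (gt_mem_nhds hη'))
    refine ⟨min (R / 2) (ε ^ 2 / 2), by positivity, ?_, fun z hz => (hball ?_).le⟩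
    · exact (min_le_left _ _).trans_lt (by linarith)
    · have h1 := (norm_sq_le_sqn (z - q)).trans (hz.trans (min_le_right _ _))
      rw [dist_eq_norm]
      by_contra! hcon
      nlinarith
  -- The shell between the sphere where `h ≤ M - η` and the outer sphere. Here `R` and `δ` are
  -- squared radii.
  set K := {z : Cn m | sqn Finset.univ (z - q) ≤ R} ∩ {z | δ ≤ sqn Finset.univ (z - q)} with hKdef
  have hcs : Continuous fun z : Cn m => sqn Finset.univ (z - q) :=
    (continuous_sqn _).comp (by fun_prop)
  have hK : IsCompact K := (isCompact_sqn_le q R).inter_right (isClosed_le continuous_const hcs)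
  obtain ⟨l, hl, hb⟩ := exists_bounds_of_isCompact hC hK (fun z hz => hsub hz.1)
  obtain ⟨n, hn⟩ : ∃ n : ℝ, n = Fintype.card ι := ⟨_, rfl⟩
  have hn0 : 0 ≤ n := hn ▸ Nat.cast_nonneg _
  -- On the shell `n * l⁻¹` bounds the sum of `sqn (e a)` from above and `δ * l` bounds the sum of
  -- squared inner products from below, so this `α` gives the barrier a positive Laplacian.
  obtain ⟨α, hα, hα'⟩ : ∃ α > 0, n * l⁻¹ < α * (δ * l) := by
    refine ⟨(n * l⁻¹ + 1) / (δ * l), by positivity, ?_⟩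
    rw [div_mul_cancel₀ _ (by positivity)]; linarith
  set s : Cn m → ℝ := fun z => Real.exp (-α * sqn Finset.univ (z - q))
  -- The barrier term vanishes on the outer sphere, and on the inner one it is at most `η`, the gap
  -- available there. In between it is positive, which gives the strict inequality.
  have hfle : ∀ z ∈ K ∩ divisorCompl m, h z + η * (s z + -Real.exp (-α * R)) ≤ M := by
    refine le_of_hasLaplacian_pos (ι := ι) hK (B := M + η * 1)
      (P := {z | sqn Finset.univ (z - q) = R} ∪ {z | sqn Finset.univ (z - q) = δ}) ?_ ?_ ?_ ?_
    · refine (hh.1.mono Set.inter_subset_right).add (Continuous.continuousOn ?_)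
      exact continuous_const.mul ((Real.continuous_exp.comp (continuous_const.mul hcs)).add
        continuous_const)
    · intro z hz
      refine add_le_add (hM z hz.2) (mul_le_mul_of_nonneg_left ?_ hη.le)
      have h1 : s z ≤ 1 := Real.exp_le_one_iff.mpr (by
        have := sqn_nonneg Finset.univ (z - q); nlinarith)
      have := Real.exp_pos (-α * R)
      linarith
    · rintro z hz (hp | hp)
      · have : s z = Real.exp (-α * R) := by simp only [s]; rw [hp]
        rw [this, add_neg_cancel, mul_zero, add_zero]
        exact hM z hz.2
      · have h1 : s z ≤ 1 := Real.exp_le_one_iff.mpr (by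
          have := sqn_nonneg Finset.univ (z - q); nlinarith)
        have h2 := hδ' z (le_of_eq hp)
        have := Real.exp_pos (-α * R)
        nlinarith
    · intro z hz hnP
      simp only [Set.mem_union, not_or, Set.mem_ofPred_eq] at hnP
      have hzK := hz.1
      have hlt1 : sqn Finset.univ (z - q) < R := lt_of_le_of_ne hz.1.1 hnP.1
      have hlt2 : δ < sqn Finset.univ (z - q) := lt_of_le_of_ne hz.1.2 (Ne.symm hnP.2)
      refine ⟨?_, ?_⟩
      · filter_upwards [(isOpen_lt hcs continuous_const).mem_nhds hlt1,
          (isOpen_lt continuous_const hcs).mem_nhds hlt2] with y h1 h2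
        exact ⟨le_of_lt h1, le_of_lt h2⟩
      · obtain ⟨e, c, he, hlap, hc⟩ := hh.2 z hz.2
        obtain ⟨c', hlap', hc'⟩ := exists_hasLaplacian_exp_sqn α Finset.univ q z e
        refine ⟨e, _, hlap.add ((hlap'.add_const _).const_mul η), ?_⟩
        have h1 : ∑ a, sqn Finset.univ (e a) ≤ n * l⁻¹ := by
          have : ∀ a ∈ Finset.univ, sqn Finset.univ (e a) ≤ l⁻¹ := fun a _ => by
            have h3 := (hb z hzK (e a)).1
            rw [he, if_pos rfl] at h3
            rw [← one_div, le_div_iff₀ hl]; linarith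
          have := Finset.sum_le_card_nsmul _ _ _ this
          simpa [hn] using this
        -- The functional `⟨z - q, ·⟩` is tested on `z - q` itself.
        have h2 : δ * l ≤ ∑ a, ipn Finset.univ (z - q) (e a) ^ 2 := by
          have h3 := he.sq_le (ipnL Finset.univ (z - q)) (z - q)
          change ipn Finset.univ (z - q) (z - q) ^ 2 ≤
            _ * ∑ a, ipn Finset.univ (z - q) (e a) ^ 2 at h3
          rw [ipn_self] at h3
          set X := sqn Finset.univ (z - q)
          set Y' := ∑ a, ipn Finset.univ (z - q) (e a) ^ 2
          have hY : 0 ≤ Y' := Finset.sum_nonneg fun _ _ => sq_nonneg _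
          have h4 := (hb z hzK (z - q)).2
          have h5 : X ^ 2 ≤ l⁻¹ * X * Y' := h3.trans (mul_le_mul_of_nonneg_right h4 hY)
          have hX : 0 < X := hδ.trans hlt2
          have h6 : X * l ≤ Y' := by
            have h7 : X * (X * l) ≤ X * Y' := by
              have := mul_le_mul_of_nonneg_left h5 hl.le
              have e1 : l * (l⁻¹ * X * Y') = X * Y' := by field_simp
              rw [e1] at this
              nlinarith
            exact le_of_mul_le_mul_left h7 hX
          nlinarith
        have h3 : 0 < c' := by
          refine lt_of_lt_of_le (mul_pos (Real.exp_pos _) ?_) hc'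
          have : α * (δ * l) ≤ α * ∑ a, ipn Finset.univ (z - q) (e a) ^ 2 :=
            mul_le_mul_of_nonneg_left h2 hα.le
          nlinarith
        nlinarith
  intro z hz
  by_cases hzδ : sqn Finset.univ (z - q) ≤ δ
  · exact (hδ' z hzδ).trans_lt (by linarith)
  · have h1 := hfle z ⟨⟨hz.le, (not_le.mp hzδ).le⟩, hsub hz.le⟩
    have h2 : Real.exp (-α * R) < s z := Real.exp_lt_exp.mpr (by nlinarith)
    nlinarith

/-- Replacing `u` by `exp` of a free complex variable presents the set as a continuous image of a
vector space. -/
lemma isPreconnected_divisorCompl : IsPreconnected (divisorCompl m) := by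
  have h : divisorCompl m = Set.range fun p : ℂ × Cn m => Function.update p.2 0 (Complex.exp p.1) := by
    ext z
    constructor
    · intro hz
      refine ⟨(Complex.log (z 0), z), ?_⟩
      simp only []
      rw [Complex.exp_log hz, Function.update_eq_self]
    · rintro ⟨p, rfl⟩
      simp [divisorCompl, Complex.exp_ne_zero]
  rw [h]
  exact isPreconnected_range (by fun_prop)

/-- Strong maximum principle off the divisor. -/
theorem lt_of_exists_lt (hC : EquivModel g β C) (hh : IsSubharm ι g h)
    (hM : ∀ z ∈ divisorCompl m, h z ≤ M) {q : Cn m} (hqU : q ∈ divisorCompl m) (hq : h q < M) :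
    ∀ z ∈ divisorCompl m, h z < M := by
  by_contra! hcon
  obtain ⟨p, hpU, hp⟩ := hcon
  set V₁ := {z | z ∈ divisorCompl m ∧ h z < M}
  set V₂ := {z | z ∈ divisorCompl m ∧ M ≤ h z}
  have hV₁ : IsOpen V₁ := hh.1.isOpen_inter_preimage isOpen_divisorCompl isOpen_Iio
  have hV₂ : IsOpen V₂ := by
    rw [isOpen_iff_mem_nhds]
    rintro p ⟨hpU, hp⟩
    obtain ⟨R, hR, hball⟩ := Metric.nhds_basis_closedBall.mem_iff.mp
      (isOpen_divisorCompl.mem_nhds hpU)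
    -- If `h q < M` for some `q` this close to `p`, the Euclidean ball about `q` of radius `R / 2`
    -- misses the divisor and contains `p`, so `lt_on_ball` would give `h p < M`. The factor `m + 1`
    -- pays for the passage from sup norm to Euclidean norm.
    have hR' : 0 < R / (2 * (m + 1)) := by positivity
    filter_upwards [Metric.ball_mem_nhds p hR'] with q hq
    have hqd : ‖p - q‖ < R / (2 * (m + 1)) := by
      rw [← dist_eq_norm, dist_comm]; exact hq
    have hqd1 : ‖p - q‖ * (2 * (m + 1)) < R := by rwa [lt_div_iff₀ (by positivity)] at hqd
    have hn := norm_nonneg (p - q)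
    have hm0 : (0 : ℝ) ≤ m := Nat.cast_nonneg m
    have hqd2 : ‖p - q‖ ≤ R / 2 := by nlinarith
    have hsub : {z | sqn Finset.univ (z - q) ≤ (R / 2) ^ 2} ⊆ divisorCompl m := by
      intro z hz
      apply hball
      have h1 := (norm_sq_le_sqn (z - q)).trans hz
      have h2 : ‖z - q‖ ≤ R / 2 := by
        have := Real.sqrt_le_sqrt h1
        rwa [Real.sqrt_sq (norm_nonneg _), Real.sqrt_sq (by linarith)] at this
      rw [Metric.mem_closedBall, dist_eq_norm]
      have : z - p = (z - q) - (p - q) := by abel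
      rw [this]
      exact (norm_sub_le _ _).trans (by linarith)
    have hqU : q ∈ divisorCompl m := hsub (by simp [sqn]; positivity)
    refine ⟨hqU, ?_⟩
    by_contra! hlt
    have := lt_on_ball hC hh hM hsub (by positivity) hlt p (by
      refine (sqn_le_norm_sq _ _).trans_lt ?_
      have h1 : (m + 1) * ‖p - q‖ < R / 2 := by linarith
      have h2 : ‖p - q‖ ^ 2 * (m + 1) ^ 2 < (R / 2) ^ 2 := by
        have := pow_lt_pow_left₀ h1 (by positivity) two_ne_zero
        rw [mul_pow] at this
        linarith
      nlinarith [sq_nonneg ‖p - q‖])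
    linarith
  obtain ⟨x, -, hx1, hx2⟩ := isPreconnected_divisorCompl V₁ V₂ hV₁ hV₂
    (fun z hz => by
      rcases lt_or_ge (h z) M with h1 | h1
      · exact Or.inl ⟨hz, h1⟩
      · exact Or.inr ⟨hz, h1⟩) ⟨q, hqU, hqU, hq⟩ ⟨p, hpU, hpU, hp⟩
  exact absurd hx1.2 (not_lt.mpr hx2.2)

/-- Strong maximum principle at the divisor. -/
theorem exists_le_near_divisor (hβ : 0 < β) (hC : EquivModel g β C) (hh : IsSubharm ι g h)
    (hM : ∀ z ∈ divisorCompl m, h z < M) {p : Cn m} (hp : p 0 = 0) :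
    ∃ δ > 0, ∀ᶠ z in 𝓝 p, z ∈ divisorCompl m → h z ≤ M - δ := by
  have hC0 := hC.1
  obtain ⟨n, hn⟩ : ∃ n : ℝ, n = Fintype.card ι := ⟨_, rfl⟩
  have hn0 : 0 ≤ n := hn ▸ Nat.cast_nonneg _
  -- The Laplacian of `A |u|^(2β)` is at least `A * (4β² C⁻¹)`, while that of the tangential term
  -- `-|v - p|²` is at least `-4 n C`.
  obtain ⟨A, hA, hA'⟩ : ∃ A > 0, 4 * (n * C) < A * (4 * β ^ 2 * C⁻¹) := by
    refine ⟨(4 * (n * C) + 1) / (4 * β ^ 2 * C⁻¹), by positivity, ?_⟩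
    rw [div_mul_cancel₀ _ (by positivity)]; linarith
  -- This keeps the `u`-part of the barrier below `1/2` for `|u| ≤ η`, whence `s ≤ 1 - |v - p|²` on
  -- `K`.
  obtain ⟨η, hη, hη'⟩ : ∃ η > 0, A * η ^ (2 * β) = 1 / 2 := by
    refine ⟨(1 / (2 * A)) ^ (2 * β)⁻¹, by positivity, ?_⟩
    rw [← Real.rpow_mul (by positivity), inv_mul_cancel₀ (by positivity), Real.rpow_one]
    field_simp
  have hcs : Continuous fun z : Cn m => sqn (tang m) (z - p) := (continuous_sqn _).comp (by fun_prop)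
  have hc0 : Continuous fun z : Cn m => ‖z 0‖ := by fun_prop
  set K : Set (Cn m) := {z | ‖z 0‖ ≤ η ∧ sqn (tang m) (z - p) ≤ 1} with hKdef
  have hK : IsCompact K := by
    refine (isCompact_sqn_le p (η ^ 2 + 1)).of_isClosed_subset
      ((isClosed_le hc0 continuous_const).inter (isClosed_le hcs continuous_const)) fun z hz => ?_
    have h1 : ‖z 0‖ ≤ η := hz.1
    have h2 := hz.2
    simp only [Set.mem_ofPred_eq]
    rw [sqn_univ]
    simp only [Pi.sub_apply, hp, sub_zero]
    have := pow_le_pow_left₀ (norm_nonneg _) h1 2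
    linarith
  set K₁ : Set (Cn m) := K ∩ {z | ‖z 0‖ = η} with hK₁def
  have hK₁ : IsCompact K₁ := hK.inter_right (isClosed_eq hc0 continuous_const)
  obtain ⟨δ, hδ, hδ'⟩ : ∃ δ > 0, ∀ z ∈ K₁, h z ≤ M - δ := by
    rcases K₁.eq_empty_or_nonempty with he | hne
    · exact ⟨1, one_pos, by simp [he]⟩
    · have hsubU : K₁ ⊆ divisorCompl m := fun z hz => by
        have : ‖z 0‖ = η := hz.2
        exact norm_pos_iff.mp (by rw [this]; exact hη)
      obtain ⟨z, hz, hmax⟩ := hK₁.exists_isMaxOn hne (hh.1.mono hsubU)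
      refine ⟨M - h z, by have := hM z (hsubU hz); linarith, fun y hy => ?_⟩
      have : h y ≤ h z := hmax hy
      linarith
  -- On the side `|v - p| = 1` the barrier is nonpositive. On `|u| = η` it is at most one, and there
  -- compactness gives `h ≤ M - δ`. Near `p` it is at least `1/4`.
  set s : Cn m → ℝ := fun z => -1 * sqn (tang m) (z - p) + (A * ‖z 0‖ ^ (2 * β) + 1 / 2)
  have hsle : ∀ z ∈ K, s z ≤ 1 - sqn (tang m) (z - p) := by
    intro z hz
    have h1 : ‖z 0‖ ^ (2 * β) ≤ η ^ (2 * β) :=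
      Real.rpow_le_rpow (norm_nonneg _) hz.1 (by positivity)
    have := mul_le_mul_of_nonneg_left h1 hA.le
    simp only [s]; linarith
  have hfle : ∀ z ∈ K ∩ divisorCompl m, h z + δ * s z ≤ M := by
    refine le_of_hasLaplacian_pos (ι := ι) hK (B := M + δ * 1)
      (P := {z | ‖z 0‖ = η} ∪ {z | sqn (tang m) (z - p) = 1}) ?_ ?_ ?_ ?_
    · refine (hh.1.mono Set.inter_subset_right).add (Continuous.continuousOn ?_)
      refine continuous_const.mul ((continuous_const.mul hcs).add ((continuous_const.mul ?_).add
        continuous_const))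
      exact hc0.rpow_const fun _ => Or.inr (by positivity)
    · intro z hz
      refine add_le_add (hM z hz.2).le (mul_le_mul_of_nonneg_left ?_ hδ.le)
      have := hsle z hz.1
      have := sqn_nonneg (tang m) (z - p)
      linarith
    · rintro z hz (hz1 | hz1)
      · have h1 := hδ' z ⟨hz.1, hz1⟩
        have := hsle z hz.1
        have := sqn_nonneg (tang m) (z - p)
        nlinarith
      · have h1 := hsle z hz.1
        have hz1 : sqn (tang m) (z - p) = 1 := hz1
        have := hM z hz.2
        nlinarith
    · intro z hz hnP
      simp only [Set.mem_union, not_or, Set.mem_ofPred_eq] at hnP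
      have hlt1 : ‖z 0‖ < η := lt_of_le_of_ne hz.1.1 hnP.1
      have hlt2 : sqn (tang m) (z - p) < 1 := lt_of_le_of_ne hz.1.2 hnP.2
      refine ⟨?_, ?_⟩
      · filter_upwards [(isOpen_lt hc0 continuous_const).mem_nhds hlt1,
          (isOpen_lt hcs continuous_const).mem_nhds hlt2] with y h1 h2
        exact ⟨le_of_lt h1, le_of_lt h2⟩
      · obtain ⟨e, c, he, hlap, hc⟩ := hh.2 z hz.2
        refine ⟨e, _, hlap.add ((((hasLaplacian_sqn (tang m) p z e).const_mul (-1)).add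
          (((hasLaplacian_rpow β z hz.2 e).const_mul A).add_const (1 / 2))).const_mul δ), ?_⟩
        have hzp : 0 < ‖z 0‖ := norm_pos_iff.mpr hz.2
        have hw : 0 < ‖z 0‖ ^ (2 * β - 2) := Real.rpow_pos_of_pos hzp _
        have hea : ∀ a, modelQ β z (e a) ≤ C := fun a => by
          have h3 := (hC.2 z hz.2 (e a)).1
          rw [he, if_pos rfl, inv_mul_le_iff₀ hC0] at h3
          linarith
        have h1 : ∑ a, sqn (tang m) (e a) ≤ n * C := by
          have : ∀ a ∈ Finset.univ, sqn (tang m) (e a) ≤ C := fun a _ => by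
            refine le_trans ?_ (hea a)
            unfold modelQ
            have : 0 ≤ ‖z 0‖ ^ (2 * β - 2) * ‖e a 0‖ ^ 2 := by positivity
            linarith
          have := Finset.sum_le_card_nsmul _ _ _ this
          simpa [hn] using this
        -- The functional `Re u` is tested on `∂/∂u`, whose model length squared is `|u|^(2β-2)`.
        have h2 : C⁻¹ ≤ ∑ a, ‖z 0‖ ^ (2 * β - 2) * ‖e a 0‖ ^ 2 := by
          set e₀ : Cn m := Pi.single 0 1
          have h3 := he.sq_le (ipnL {0} e₀) e₀
          have h4 : ∀ x, ipnL {0} e₀ x = (x 0).re := fun x => by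
            change ipn {0} e₀ x = _
            simp [ipn, e₀, Complex.inner]
          simp only [h4] at h3
          have h5 : (e₀ 0).re = 1 := by simp [e₀]
          rw [h5, one_pow] at h3
          have h6 := (hC.2 z hz.2 e₀).2
          have h7 : modelQ β z e₀ = ‖z 0‖ ^ (2 * β - 2) := by
            rw [modelQ, sqn_tang]; simp [e₀]
          rw [h7] at h6
          have h8 : ∑ a, (e a 0).re ^ 2 ≤ ∑ a, ‖e a 0‖ ^ 2 := Finset.sum_le_sum fun a _ => by
            rw [← sq_abs]
            exact pow_le_pow_left₀ (abs_nonneg _) (Complex.abs_re_le_norm _) 2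
          have h9 : 0 ≤ ∑ a, (e a 0).re ^ 2 := Finset.sum_nonneg fun _ _ => sq_nonneg _
          rw [← Finset.mul_sum, inv_le_iff_one_le_mul₀ hC0]
          calc (1 : ℝ) ≤ _ := h3
            _ ≤ (C * ‖z 0‖ ^ (2 * β - 2)) * ∑ a, ‖e a 0‖ ^ 2 :=
              mul_le_mul h6 h8 h9 (by positivity)
            _ = _ := by ring
        have h3 := mul_le_mul_of_nonneg_left h2 (by positivity : 0 ≤ A * (4 * β ^ 2))
        have h4 : 0 < -1 * (4 * ∑ a, sqn (tang m) (e a)) +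
            A * (4 * β ^ 2 * ∑ a, ‖z 0‖ ^ (2 * β - 2) * ‖e a 0‖ ^ 2) := by nlinarith
        nlinarith [mul_pos hδ h4]
  refine ⟨δ / 4, by positivity, ?_⟩
  have hn1 : ∀ᶠ z in 𝓝 p, ‖z 0‖ < η :=
    (isOpen_lt hc0 continuous_const).mem_nhds (by simpa [hp] using hη)
  have hn2 : ∀ᶠ z in 𝓝 p, sqn (tang m) (z - p) < 1 / 4 :=
    (isOpen_lt hcs continuous_const).mem_nhds (by simp [sqn])
  filter_upwards [hn1, hn2] with z h1 h2 hzU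
  have h3 := hfle z ⟨⟨h1.le, by linarith⟩, hzU⟩
  have h4 : 1 / 4 ≤ s z := by
    have : 0 ≤ A * ‖z 0‖ ^ (2 * β) := by positivity
    simp only [s]; linarith
  nlinarith

/-- A subharmonic function whose supremum is approached along a convergent sequence of points,
possibly with limit on the divisor, is constant. -/
theorem eq_of_tendsto_sup (hβ : 0 < β) (hC : EquivModel g β C) (hh : IsSubharm ι g h)
    (hM : ∀ z ∈ divisorCompl m, h z ≤ M) {z : ℕ → Cn m} {p : Cn m}
    (hz : ∀ n, z n ∈ divisorCompl m) (hzp : Tendsto z atTop (𝓝 p))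
    (hhz : Tendsto (fun n => h (z n)) atTop (𝓝 M)) : ∀ x ∈ divisorCompl m, h x = M := by
  by_contra! hcon
  obtain ⟨x, hx, hxM⟩ := hcon
  have hlt := lt_of_exists_lt hC hh hM hx (lt_of_le_of_ne (hM x hx) hxM)
  by_cases hp : p 0 = 0
  · obtain ⟨δ, hδ, hev⟩ := exists_le_near_divisor hβ hC hh hlt hp
    have : M ≤ M - δ := le_of_tendsto hhz ((hzp.eventually hev).mono fun n hn => hn (hz n))
    linarith
  · have hpU : p ∈ divisorCompl m := hp
    have hcont : ContinuousAt h p := hh.1.continuousAt (isOpen_divisorCompl.mem_nhds hpU)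
    have := tendsto_nhds_unique (hcont.tendsto.comp hzp) hhz
    have := hlt p hpU
    linarith

end

end KahlerCone
end

/-! ### Derivatives of determinants and orthonormal frames. -/

noncomputable section

namespace KahlerCone

open Filter Topology Asymptotics

variable {m : ℕ}

section Jacobi

variable {ι : Type} [Fintype ι] [DecidableEq ι]

/-- Jacobi's formula. -/
theorem hasDerivAt_det {Q : ℝ → Matrix ι ι ℝ} {Q' : Matrix ι ι ℝ} {t : ℝ}
    (h : ∀ i j, HasDerivAt (fun s => Q s i j) (Q' i j) t) :
    HasDerivAt (fun s => (Q s).det) ((Q t).adjugate * Q').trace t := by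
  have h1 : HasDerivAt (fun s => (Q s).det)
      (∑ σ : Equiv.Perm ι, ((Equiv.Perm.sign σ : ℤ) : ℝ) *
        ∑ i, (∏ j ∈ Finset.univ.erase i, Q t (σ j) j) • Q' (σ i) i) t := by
    simp only [Matrix.det_apply']
    refine HasDerivAt.fun_sum fun σ _ => ?_
    exact (HasDerivAt.fun_finsetProd fun i _ => h (σ i) i).const_mul _
  convert! h1 using 1
  -- Cramer's rule: the diagonal entries are determinants with one column replaced by its
  -- derivative.
  have h2 : ∀ i, ((Q t).adjugate * Q') i i = ((Q t).updateCol i (fun k => Q' k i)).det := by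
    intro i
    rw [← Matrix.cramer_apply, Matrix.cramer_eq_adjugate_mulVec]
    rfl
  simp only [Matrix.trace, Matrix.diag, h2, Matrix.det_apply', Finset.mul_sum]
  rw [Finset.sum_comm]
  refine Finset.sum_congr rfl fun σ _ => Finset.sum_congr rfl fun i _ => ?_
  rw [← Finset.mul_prod_erase _ _ (Finset.mem_univ i), Matrix.updateCol_self]
  have h3 : ∏ j ∈ Finset.univ.erase i, (Q t).updateCol i (fun k => Q' k i) (σ j) j =
      ∏ j ∈ Finset.univ.erase i, Q t (σ j) j := Finset.prod_congr rfl fun j hj => by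
    rw [Matrix.updateCol_ne (Finset.ne_of_mem_erase hj)]
  rw [h3, smul_eq_mul]
  ring

/-- Differentiate `adj(Q) Q = det(Q) 1` at a point where `Q = 1`. -/
lemma hasDerivAt_adjugate_of_eq_one {Q : ℝ → Matrix ι ι ℝ} {Q' : Matrix ι ι ℝ} {t : ℝ}
    (h : ∀ i j, HasDerivAt (fun s => Q s i j) (Q' i j) t) (h1 : Q t = 1) (i j : ι) :
    HasDerivAt (fun s => (Q s).adjugate i j) ((Q'.trace • (1 : Matrix ι ι ℝ) - Q') i j) t := by
  have hd : ∀ i j, DifferentiableAt ℝ (fun s => (Q s).adjugate i j) t := by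
    intro i j
    simp only [Matrix.adjugate_apply]
    refine HasDerivAt.differentiableAt (hasDerivAt_det
      (Q := fun s => (Q s).updateRow j (Pi.single i 1)) (Q' := Q'.updateRow j 0) fun k l => ?_)
    by_cases hk : k = j
    · subst hk
      simpa using hasDerivAt_const t _
    · simpa [Matrix.updateRow_ne hk] using h k l
  have hdet := hasDerivAt_det h
  rw [h1, Matrix.adjugate_one, one_mul] at hdet
  have hA := (hd i j).hasDerivAt
  set A := deriv (fun s => (Q s).adjugate i j) t
  have hsum : HasDerivAt (fun s => ∑ k, (Q s).adjugate i k * Q s k j)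
      (∑ k, (deriv (fun s => (Q s).adjugate i k) t * Q t k j + (Q t).adjugate i k * Q' k j)) t :=
    HasDerivAt.fun_sum fun k _ => (hd i k).hasDerivAt.mul (h k j)
  have heq : (fun s => ∑ k, (Q s).adjugate i k * Q s k j) =
      fun s => (Q s).det * (1 : Matrix ι ι ℝ) i j := by
    funext s
    have := congrFun (congrFun (Matrix.adjugate_mul (Q s)) i) j
    simpa [Matrix.mul_apply] using this
  rw [heq] at hsum
  have huniq := hsum.unique (hdet.mul_const _)
  rw [h1, Matrix.adjugate_one] at huniq
  simp only [Matrix.one_apply, Finset.sum_add_distrib, mul_ite, mul_one, mul_zero, ite_mul, one_mul,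
    zero_mul, Finset.sum_ite_eq, Finset.sum_ite_eq', Finset.mem_univ, if_true] at huniq
  convert! hA using 1
  simp only [Matrix.sub_apply, Matrix.smul_apply, Matrix.one_apply, smul_eq_mul, mul_ite, mul_one,
    mul_zero]
  linarith

/-- The second derivative of `log det`. -/
theorem hasDerivAt_log_det {Q Q₁ : ℝ → Matrix ι ι ℝ} {Q₂ : Matrix ι ι ℝ}
    (hQ : ∀ᶠ t in 𝓝 (0 : ℝ), ∀ i j, HasDerivAt (fun s => Q s i j) (Q₁ t i j) t)
    (hQ₁ : ∀ i j, HasDerivAt (fun s => Q₁ s i j) (Q₂ i j) 0) (h0 : Q 0 = 1) :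
    ∃ D₁ : ℝ → ℝ, (∀ᶠ t in 𝓝 (0 : ℝ), HasDerivAt (fun s => Real.log (Q s).det) (D₁ t) t) ∧
      HasDerivAt D₁ (Q₂.trace - (Q₁ 0 * Q₁ 0).trace) 0 := by
  have hQ0 := hQ.self_of_nhds
  have hdet0 := hasDerivAt_det hQ0
  have hd1 : (Q 0).det = 1 := by rw [h0, Matrix.det_one]
  refine ⟨fun t => ((Q t).adjugate * Q₁ t).trace / (Q t).det, ?_, ?_⟩
  · have hne : ∀ᶠ t in 𝓝 (0 : ℝ), (Q t).det ≠ 0 :=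
      hdet0.continuousAt.eventually_ne (by rw [hd1]; exact one_ne_zero)
    filter_upwards [hQ, hne] with t ht hne
    exact (hasDerivAt_det ht).log hne
  · have hadj := hasDerivAt_adjugate_of_eq_one hQ0 h0
    have htr : HasDerivAt (fun t => ((Q t).adjugate * Q₁ t).trace)
        (∑ i, ∑ k, ((((Q₁ 0).trace • (1 : Matrix ι ι ℝ) - Q₁ 0) i k) * Q₁ 0 k i +
          (Q 0).adjugate i k * Q₂ k i)) 0 := by
      simp only [Matrix.trace, Matrix.diag, Matrix.mul_apply]
      exact HasDerivAt.fun_sum fun i _ => HasDerivAt.fun_sum fun k _ =>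
        (hadj i k).mul (hQ₁ k i)
    have := htr.div hdet0 (by rw [hd1]; exact one_ne_zero)
    convert! this using 1
    rw [hd1, h0, Matrix.adjugate_one, one_mul]
    simp only [Finset.sum_add_distrib]
    have e1 : ∑ i, ∑ k, ((Q₁ 0).trace • (1 : Matrix ι ι ℝ) - Q₁ 0) i k * Q₁ 0 k i =
        (Q₁ 0).trace * (Q₁ 0).trace - (Q₁ 0 * Q₁ 0).trace := by
      have : ∑ i, ∑ k, ((Q₁ 0).trace • (1 : Matrix ι ι ℝ) - Q₁ 0) i k * Q₁ 0 k i =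
        (((Q₁ 0).trace • (1 : Matrix ι ι ℝ) - Q₁ 0) * Q₁ 0).trace := rfl
      rw [this, Matrix.sub_mul, Matrix.trace_sub, Matrix.smul_mul, Matrix.one_mul,
        Matrix.trace_smul, smul_eq_mul]
    have e2 : ∑ i, ∑ k, (1 : Matrix ι ι ℝ) i k * Q₂ k i = Q₂.trace := by
      have : ∑ i, ∑ k, (1 : Matrix ι ι ℝ) i k * Q₂ k i = ((1 : Matrix ι ι ℝ) * Q₂).trace := rfl
      rw [this, Matrix.one_mul]
    rw [e1, e2]
    ring

end Jacobi

lemma HasSecondDeriv.unique {f f' : Cn m → ℝ} {z a : Cn m} {c d : ℝ} (hff' : f =ᶠ[𝓝 z] f')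
    (hf : HasSecondDeriv f z a c) (hg : HasSecondDeriv f' z a d) : c = d := by
  obtain ⟨f₁, h1, h2⟩ := hf
  obtain ⟨g₁, h3, h4⟩ := hg
  have hc : Tendsto (fun t : ℝ => z + t • a) (𝓝 0) (𝓝 z) := by
    have : ContinuousAt (fun t : ℝ => z + t • a) 0 := by fun_prop
    simpa using this.tendsto
  have h5 : f₁ =ᶠ[𝓝 0] g₁ := by
    filter_upwards [h1, h3, (hc.eventually hff').eventually_nhds] with t ht ht' he
    exact (ht.congr_of_eventuallyEq (he.mono fun s hs => hs.symm)).unique ht'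
  exact h2.unique (h4.congr_of_eventuallyEq h5)

section Frame

variable {ι : Type} [Fintype ι] [DecidableEq ι]

lemma exists_isFrame {g : Cn m →L[ℝ] Cn m →L[ℝ] ℝ} (hs : ∀ x y, g x y = g y x)
    (hp : ∀ x, x ≠ 0 → 0 < g x x) (b : Module.Basis ι ℝ (Cn m)) :
    ∃ e : Module.Basis ι ℝ (Cn m), IsFrame g e := by
  let B : LinearMap.BilinForm ℝ (Cn m) :=
    LinearMap.mk₂ ℝ (fun x y => g x y) (by simp) (by simp) (by simp) (by simp)
  have hB : LinearMap.IsSymm B := ⟨hs⟩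
  obtain ⟨v, hv⟩ := LinearMap.BilinForm.exists_orthogonal_basis hB
  have hvp : ∀ i, 0 < g (v i) (v i) := fun i => hp _ (v.ne_zero i)
  have hu : ∀ i, IsUnit (√(g (v i) (v i)))⁻¹ := fun i =>
    isUnit_iff_ne_zero.mpr (inv_ne_zero (Real.sqrt_pos.mpr (hvp i)).ne')
  have hcard : Fintype.card (Fin (Module.finrank ℝ (Cn m))) = Fintype.card ι := by
    rw [Fintype.card_fin, Module.finrank_eq_card_basis b]
  let r := Fintype.equivOfCardEq hcard
  refine ⟨(v.isUnitSMul hu).reindex r, fun a b => ?_⟩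
  simp only [Module.Basis.reindex_apply, Module.Basis.isUnitSMul_apply, map_smul,
    smul_apply, smul_eq_mul]
  by_cases hab : a = b
  · subst hab
    rw [if_pos rfl]
    have h1 := Real.mul_self_sqrt (hvp (r.symm a)).le
    have h2 := (Real.sqrt_pos.mpr (hvp (r.symm a))).ne'
    field_simp
    rw [sq, h1]
  · rw [if_neg hab]
    have : g (v (r.symm a)) (v (r.symm b)) = 0 :=
      hv (fun h => hab (r.symm.injective h))
    rw [this]; simp

/-- The Gram matrix of `g` in the basis `e`. -/
def gram (g : Cn m →L[ℝ] Cn m →L[ℝ] ℝ) (e : Module.Basis ι ℝ (Cn m)) : Matrix ι ι ℝ :=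
  Matrix.of fun a b => g (e a) (e b)

lemma gram_det_eq (g : Cn m →L[ℝ] Cn m →L[ℝ] ℝ) (b e : Module.Basis ι ℝ (Cn m)) :
    (gram g e).det = (b.toMatrix e).det ^ 2 * (gram g b).det := by
  let B : LinearMap.BilinForm ℝ (Cn m) :=
    LinearMap.mk₂ ℝ (fun x y => g x y) (by simp) (by simp) (by simp) (by simp)
  have h : ∀ c : Module.Basis ι ℝ (Cn m), gram g c = LinearMap.BilinForm.toMatrix c B := fun c => by
    ext i j; rw [LinearMap.BilinForm.toMatrix_apply]; rfl
  rw [h, h, ← LinearMap.BilinForm.toMatrix_mul_basis_toMatrix b e B, Matrix.det_mul, Matrix.det_mul,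
    Matrix.det_transpose]
  ring

end Frame

end KahlerCone
end

/-! ### Derivatives of Kähler metrics and the Laplacian of `g(w, w)`. -/

noncomputable section

namespace KahlerCone

open Filter Topology Asymptotics

variable {m : ℕ}

set_option maxSynthPendingDepth 3

section Kahler

variable {g : Cn m → Cn m →L[ℝ] Cn m →L[ℝ] ℝ} {z : Cn m}

/-- The second derivative of a metric tensor. -/
def snd (g : Cn m → Cn m →L[ℝ] Cn m →L[ℝ] ℝ) (z : Cn m) :
    Cn m →L[ℝ] Cn m →L[ℝ] Cn m →L[ℝ] Cn m →L[ℝ] ℝ := fderiv ℝ (fderiv ℝ g) z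

lemma IsKahlerMetricOn.contDiffAt (hg : IsKahlerMetricOn g (divisorCompl m))
    (hz : z ∈ divisorCompl m) : ContDiffAt ℝ ((⊤ : ℕ∞) : WithTop ℕ∞) g z :=
  hg.smooth.contDiffAt (isOpen_divisorCompl.mem_nhds hz)

lemma IsKahlerMetricOn.hasFDerivAt (hg : IsKahlerMetricOn g (divisorCompl m))
    (hz : z ∈ divisorCompl m) : HasFDerivAt g (fderiv ℝ g z) z :=
  ((hg.contDiffAt hz).differentiableAt (by simp)).hasFDerivAt

lemma IsKahlerMetricOn.contDiffAt_fderiv (hg : IsKahlerMetricOn g (divisorCompl m))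
    (hz : z ∈ divisorCompl m) : ContDiffAt ℝ ((⊤ : ℕ∞) : WithTop ℕ∞) (fderiv ℝ g) z :=
  (hg.contDiffAt hz).fderiv_right (by simp)

lemma IsKahlerMetricOn.hasFDerivAt_fderiv (hg : IsKahlerMetricOn g (divisorCompl m))
    (hz : z ∈ divisorCompl m) : HasFDerivAt (fderiv ℝ g) (snd g z) z :=
  ((hg.contDiffAt_fderiv hz).differentiableAt (by simp)).hasFDerivAt

lemma _root_.HasFDerivAt.apply₂ {F : Type*} [NormedAddCommGroup F] [NormedSpace ℝ F]
    {T : F → Cn m →L[ℝ] Cn m →L[ℝ] ℝ} {T' : F →L[ℝ] Cn m →L[ℝ] Cn m →L[ℝ] ℝ} {z : F}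
    (h : HasFDerivAt T T' z) (x y : Cn m) : HasFDerivAt (fun p => T p x y)
      ((ContinuousLinearMap.apply ℝ ℝ y).comp
        ((ContinuousLinearMap.apply ℝ (Cn m →L[ℝ] ℝ) x).comp T')) z :=
  HasFDerivAt.comp (g := ContinuousLinearMap.apply ℝ ℝ y) z
    (ContinuousLinearMap.apply ℝ ℝ y).hasFDerivAt
    (HasFDerivAt.comp (g := ContinuousLinearMap.apply ℝ (Cn m →L[ℝ] ℝ) x) z
      (ContinuousLinearMap.apply ℝ (Cn m →L[ℝ] ℝ) x).hasFDerivAt h)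

lemma fderiv_comb_eq_zero {F : Type*} [NormedAddCommGroup F] [NormedSpace ℝ F] {f : F → ℝ}
    {f' : F →L[ℝ] ℝ} {z : F} (h : HasFDerivAt f f' z) (h0 : f =ᶠ[𝓝 z] fun _ => 0) (s : F) :
    f' s = 0 := by
  have := h.unique ((hasFDerivAt_const (0 : ℝ) z).congr_of_eventuallyEq h0)
  rw [this]; rfl

section

variable (hg : IsKahlerMetricOn g (divisorCompl m)) (hz : z ∈ divisorCompl m)

include hg hz

lemma fderiv_symm (a x y : Cn m) : fderiv ℝ g z a x y = fderiv ℝ g z a y x := by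
  have h := ((hg.hasFDerivAt hz).apply₂ x y).sub ((hg.hasFDerivAt hz).apply₂ y x)
  have := fderiv_comb_eq_zero h (by
    filter_upwards [isOpen_divisorCompl.mem_nhds hz] with p hp
    simp [hg.symm p hp x y]) a
  simpa [sub_eq_zero] using this

lemma fderiv_inv (a x y : Cn m) :
    fderiv ℝ g z a (Complex.I • x) (Complex.I • y) = fderiv ℝ g z a x y := by
  have h := ((hg.hasFDerivAt hz).apply₂ (Complex.I • x) (Complex.I • y)).sub
    ((hg.hasFDerivAt hz).apply₂ x y)
  have := fderiv_comb_eq_zero h (by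
    filter_upwards [isOpen_divisorCompl.mem_nhds hz] with p hp
    simp [hg.inv p hp x y]) a
  simpa [sub_eq_zero] using this

lemma fderiv_I_left (a x y : Cn m) :
    fderiv ℝ g z a (Complex.I • x) y = -fderiv ℝ g z a x (Complex.I • y) := by
  rw [← fderiv_inv hg hz a x (Complex.I • y), I_smul_I_smul, map_neg, neg_neg]

/-- The Kähler identity for the first derivatives. -/
lemma fderiv_kahler (h c k : Cn m) :
    fderiv ℝ g z (Complex.I • h) c k + fderiv ℝ g z h (Complex.I • c) k =
      fderiv ℝ g z (Complex.I • c) k h + fderiv ℝ g z c k (Complex.I • h) := by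
  have h1 := hg.closed z hz (Complex.I • h) (-(Complex.I • c)) k
  have h2 := hg.closed z hz h c k
  have e1 := fderiv_I_left hg hz k h c
  have e2 := fderiv_I_left hg hz c k h
  simp only [smul_neg, I_smul_I_smul, neg_neg, map_neg, neg_apply] at h1
  have e3 := fderiv_symm hg hz h (Complex.I • c) k
  have e4 := fderiv_inv hg hz (Complex.I • c) k h
  linarith

lemma snd_comm (s t x y : Cn m) : snd g z s t x y = snd g z t s x y := by
  have := (hg.contDiffAt hz).isSymmSndFDerivAt (by
    simp only [minSmoothness_of_isRCLikeNormedField]; exact ENat.LEInfty.out)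
  have := this s t
  unfold snd
  rw [this]

lemma hasFDerivAt_fderiv_apply (t x y : Cn m) :
    HasFDerivAt (fun p => fderiv ℝ g p t x y)
      ((ContinuousLinearMap.apply ℝ ℝ y).comp
        ((ContinuousLinearMap.apply ℝ (Cn m →L[ℝ] ℝ) x).comp
        ((ContinuousLinearMap.apply ℝ (Cn m →L[ℝ] Cn m →L[ℝ] ℝ) t).comp (snd g z)))) z :=
  HasFDerivAt.apply₂ (HasFDerivAt.comp
    (g := ContinuousLinearMap.apply ℝ (Cn m →L[ℝ] Cn m →L[ℝ] ℝ) t) z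
    (ContinuousLinearMap.apply ℝ (Cn m →L[ℝ] Cn m →L[ℝ] ℝ) t).hasFDerivAt
    (hg.hasFDerivAt_fderiv hz)) x y

lemma snd_symm (s t x y : Cn m) : snd g z s t x y = snd g z s t y x := by
  have h := (hasFDerivAt_fderiv_apply hg hz t x y).sub (hasFDerivAt_fderiv_apply hg hz t y x)
  have := fderiv_comb_eq_zero h (by
    filter_upwards [isOpen_divisorCompl.mem_nhds hz] with p hp
    simp [fderiv_symm hg hp t x y]) s
  simpa [sub_eq_zero] using this

lemma snd_I_left (s t x y : Cn m) :
    snd g z s t (Complex.I • x) y = -snd g z s t x (Complex.I • y) := by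
  have h := (hasFDerivAt_fderiv_apply hg hz t (Complex.I • x) y).add
    (hasFDerivAt_fderiv_apply hg hz t x (Complex.I • y))
  have := fderiv_comb_eq_zero h (by
    filter_upwards [isOpen_divisorCompl.mem_nhds hz] with p hp
    simp [fderiv_I_left hg hp t x y]) s
  simp at this
  linarith

lemma snd_kahler (s r c k : Cn m) :
    snd g z s (Complex.I • r) c k + snd g z s r (Complex.I • c) k =
      snd g z s (Complex.I • c) k r + snd g z s c k (Complex.I • r) := by
  have h := ((hasFDerivAt_fderiv_apply hg hz (Complex.I • r) c k).add
    (hasFDerivAt_fderiv_apply hg hz r (Complex.I • c) k)).sub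
    ((hasFDerivAt_fderiv_apply hg hz (Complex.I • c) k r).add
    (hasFDerivAt_fderiv_apply hg hz c k (Complex.I • r)))
  have : snd g z s (Complex.I • r) c k + snd g z s r (Complex.I • c) k -
      (snd g z s (Complex.I • c) k r + snd g z s c k (Complex.I • r)) = 0 :=
    fderiv_comb_eq_zero h (by
    filter_upwards [isOpen_divisorCompl.mem_nhds hz] with p hp
    have := fderiv_kahler hg hp r c k
    simp [this]) s
  linarith

/-- The exchange of directions of derivatives and arguments for Kähler metrics. -/
lemma snd_exchange (w a : Cn m) :
    snd g z w w a a + snd g z (Complex.I • w) (Complex.I • w) a a =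
      snd g z a a w w + snd g z (Complex.I • a) (Complex.I • a) w w := by
  -- The Kähler identity turns both terms into mixed derivatives. Exchanging `w` and `a` fixes the
  -- first and third summands and swaps the other two, by commutation of derivatives and skewness of
  -- `I`.
  have key : ∀ w a : Cn m, snd g z w w a a + snd g z (Complex.I • w) (Complex.I • w) a a =
      snd g z (Complex.I • w) (Complex.I • a) w a + snd g z (Complex.I • w) a (Complex.I • w) a +
      snd g z w a a w - snd g z w (Complex.I • a) a (Complex.I • w) := by
    intro w a
    have h1 := snd_kahler hg hz (Complex.I • w) w a a
    have h2 := snd_kahler hg hz w (Complex.I • w) a a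
    have z1 := snd_I_left hg hz (Complex.I • w) w a a
    have z1' := snd_symm hg hz (Complex.I • w) w a (Complex.I • a)
    have z2 := snd_I_left hg hz w (Complex.I • w) a a
    have z2' := snd_symm hg hz w (Complex.I • w) a (Complex.I • a)
    have s1 := snd_symm hg hz (Complex.I • w) (Complex.I • a) w a
    have s2 := snd_symm hg hz (Complex.I • w) a (Complex.I • w) a
    simp only [I_smul_I_smul, map_neg, neg_apply] at h2
    linarith
  have k1 := key w a
  have k2 := key a w
  have c1 := snd_comm hg hz (Complex.I • w) (Complex.I • a) w a
  have c1' := snd_symm hg hz (Complex.I • a) (Complex.I • w) w a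
  have c2 := snd_comm hg hz w a a w
  have c2' := snd_symm hg hz a w a w
  have c3 := snd_comm hg hz (Complex.I • w) a (Complex.I • w) a
  have c3' := snd_I_left hg hz a (Complex.I • w) w a
  have c4 := snd_comm hg hz w (Complex.I • a) a (Complex.I • w)
  have c4' := snd_I_left hg hz (Complex.I • a) w a w
  linarith

lemma hasSecondDeriv_metric (x y a : Cn m) :
    (∀ᶠ t in 𝓝 (0 : ℝ), HasDerivAt (fun t : ℝ => g (z + t • a) x y)
      (fderiv ℝ g (z + t • a) a x y) t) ∧
      HasDerivAt (fun t : ℝ => fderiv ℝ g (z + t • a) a x y) (snd g z a a x y) 0 := by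
  have hl : ∀ t : ℝ, HasDerivAt (fun t : ℝ => z + t • a) a t := fun t => by
    simpa using ((hasDerivAt_id t).smul_const a).const_add z
  constructor
  · have hc : Tendsto (fun t : ℝ => z + t • a) (𝓝 0) (𝓝 z) := by
      have := (hl 0).continuousAt.tendsto
      simpa using this
    filter_upwards [hc.eventually (isOpen_divisorCompl.mem_nhds hz)] with t ht
    have := ((hg.hasFDerivAt ht).apply₂ x y).comp_hasDerivAt t (hl t)
    simpa [Function.comp_def] using this
  · have h0 : z + (0 : ℝ) • a = z := by simp
    have h1 := hasFDerivAt_fderiv_apply hg hz a x y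
    rw [← h0] at h1
    have := h1.comp_hasDerivAt (0 : ℝ) (hl 0)
    simpa [Function.comp_def] using this

variable {ι : Type} [Fintype ι] [DecidableEq ι]

/-- The Laplacian of `g(w, w)` for a Kähler metric with volume `|u|^(4β-4)`. -/
theorem hasLaplacian_metric {β : ℝ} {b e : Module.Basis ι ℝ (Cn m)} (he : IsFrame (g z) e)
    (hvol : ∀ p ∈ divisorCompl m, (gram (g p) b).det = (‖p 0‖ ^ (2 * β - 2)) ^ 2) (w : Cn m) :
    HasLaplacian (fun p => g p w w) z e (∑ a, ∑ c, (fderiv ℝ g z w (e a) (e c) ^ 2 +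
      fderiv ℝ g z (Complex.I • w) (e a) (e c) ^ 2)) := by
  -- In an orthonormal frame the Gram matrix is the identity at `z`, so the second derivative of
  -- `log det` is `tr Q'' - tr (Q' Q')`.
  have hlog : ∀ w : Cn m, HasSecondDeriv (fun p => Real.log (gram (g p) e).det) z w
      (∑ a, snd g z w w (e a) (e a) - ∑ a, ∑ c, fderiv ℝ g z w (e a) (e c) ^ 2) := by
    intro w
    obtain ⟨D, hD, hD'⟩ := hasDerivAt_log_det (Q := fun t : ℝ => gram (g (z + t • w)) e)
      (Q₁ := fun t : ℝ => gram (fderiv ℝ g (z + t • w) w) e) (Q₂ := gram (snd g z w w) e)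
      (by
        simp only [eventually_all]
        exact fun i j => (hasSecondDeriv_metric hg hz (e i) (e j) w).1)
      (fun i j => (hasSecondDeriv_metric hg hz (e i) (e j) w).2)
      (by
        ext i j
        simp [gram, he i j, Matrix.one_apply])
    refine ⟨D, hD, ?_⟩
    convert! hD' using 1
    congr 1
    simp only [zero_smul, add_zero, Matrix.trace, Matrix.diag, Matrix.mul_apply, gram,
      Matrix.of_apply]
    refine Finset.sum_congr rfl fun a _ => Finset.sum_congr rfl fun c _ => ?_
    rw [fderiv_symm hg hz w (e c) (e a), sq]
  have hzp : 0 < ‖z 0‖ := norm_pos_iff.mpr hz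
  set κ := (b.toMatrix e).det ^ 2
  have hκ : κ ≠ 0 := by
    have h1 := gram_det_eq (g z) b e
    have h2 : (gram (g z) e).det = 1 := by
      have : gram (g z) e = 1 := by ext i j; simp [gram, he i j, Matrix.one_apply]
      rw [this, Matrix.det_one]
    rw [h2] at h1
    intro h
    change κ = 0 at h
    change 1 = κ * _ at h1
    rw [h, zero_mul] at h1
    exact one_ne_zero h1
  -- The volume condition in the fixed frame `e`: the change of basis contributes only the constant
  -- `κ`, and the rest is pluriharmonic.
  have hF : (fun p => Real.log (gram (g p) e).det) =ᶠ[𝓝 z]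
      fun p => (4 * β - 4) * Real.log ‖p 0‖ + Real.log κ := by
    filter_upwards [isOpen_divisorCompl.mem_nhds hz] with p hp
    have hpp : 0 < ‖p 0‖ := norm_pos_iff.mpr hp
    rw [gram_det_eq (g p) b e, hvol p hp, Real.log_mul hκ (by positivity), Real.log_pow (‖p 0‖ ^ (2 * β - 2)) 2,
      Real.log_rpow hpp]
    push_cast
    ring
  have hpl : ∀ w : Cn m, HasSecondDeriv
      (fun p : Cn m => (4 * β - 4) * Real.log ‖p 0‖ + Real.log κ) z w
      ((4 * β - 4) * (‖w 0‖ ^ 2 / ‖z 0‖ ^ 2 - 2 * inner ℝ (z 0) (w 0) ^ 2 / ‖z 0‖ ^ 4)) := fun w =>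
    ((hasSecondDeriv_log z w hz).const_mul _).add_const _
  have h1 := HasSecondDeriv.unique hF (hlog w) (hpl w)
  have h2 := HasSecondDeriv.unique hF (hlog (Complex.I • w)) (hpl (Complex.I • w))
  have hsum : (‖w 0‖ ^ 2 / ‖z 0‖ ^ 2 - 2 * inner ℝ (z 0) (w 0) ^ 2 / ‖z 0‖ ^ 4) +
      (‖(Complex.I • w) 0‖ ^ 2 / ‖z 0‖ ^ 2 -
        2 * inner ℝ (z 0) ((Complex.I • w) 0) ^ 2 / ‖z 0‖ ^ 4) = 0 := by
    have h := inner_sq_add_inner_I_sq (z 0) (w 0)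
    have hn : ‖(Complex.I • w) 0‖ = ‖w 0‖ := by simp
    have hi : (Complex.I • w) 0 = Complex.I * w 0 := rfl
    rw [hn, hi]
    field_simp
    linarith
  refine ⟨fun a => snd g z (e a) (e a) w w, fun a => snd g z (Complex.I • e a) (Complex.I • e a) w w,
    fun a => ⟨_, hasSecondDeriv_metric hg hz w w (e a)⟩,
    fun a => ⟨_, hasSecondDeriv_metric hg hz w w (Complex.I • e a)⟩, ?_⟩
  -- After the exchange of directions the Laplacian is the sum of `tr Q''` over `w` and `I • w`.
  -- Pluriharmonicity equates this with the sum of `tr (Q' Q')`.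
  simp only [← snd_exchange hg hz w, Finset.sum_add_distrib]
  linear_combination h1 + h2 + (4 * β - 4) * hsum

end

end Kahler

end KahlerCone
end

/-! ### Homothetic linear flows and constancy of the tangential metric. -/

noncomputable section

namespace KahlerCone

open Filter Topology Asymptotics

variable {m : ℕ}

set_option maxSynthPendingDepth 3

/-- The one-parameter group generated by a linear vector field. -/
def flow (A : Cn m →L[ℝ] Cn m) (t : ℝ) : Cn m →L[ℝ] Cn m := NormedSpace.exp (t • A)

lemma hasDerivAt_flow (A : Cn m →L[ℝ] Cn m) (t : ℝ) (z : Cn m) :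
    HasDerivAt (fun t => flow A t z) (A (flow A t z)) t := by
  have h := hasDerivAt_exp_smul_const' (𝕂 := ℝ) A t
  have := (ContinuousLinearMap.apply ℝ (Cn m) z).hasFDerivAt.comp_hasDerivAt t h
  exact this

@[simp] lemma flow_zero (A : Cn m →L[ℝ] Cn m) : flow A 0 = 1 := by
  simp [flow]

lemma flow_neg_apply (A : Cn m →L[ℝ] Cn m) (t : ℝ) (z : Cn m) : flow A t (flow A (-t) z) = z := by
  have h : flow A t * flow A (-t) = 1 := by
    unfold flow
    rw [← NormedSpace.exp_add_of_commute_of_mem_ball (𝕂 := ℝ)]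
    · simp
    · exact ((Commute.refl A).smul_left t).smul_right (-t)
    · rw [NormedSpace.expSeries_radius_eq_top]; simp
    · rw [NormedSpace.expSeries_radius_eq_top]; simp
  exact DFunLike.congr_fun h z

/-- The tangent vector `∂/∂u`. -/
def e₀ : Cn m := Pi.single 0 1

section

variable {A : Cn m →L[ℝ] Cn m} {a : ℂ}

lemma flow_apply_zero (h0 : ∀ z, A z 0 = a * z 0) (t : ℝ) (z : Cn m) :
    flow A t z 0 = Complex.exp (t * a) * z 0 := by
  have hd : ∀ t : ℝ, HasDerivAt (fun t : ℝ => Complex.exp (-(t * a)) * flow A t z 0) 0 t := by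
    intro t
    have h1 : HasDerivAt (fun t : ℝ => flow A t z 0) (A (flow A t z) 0) t :=
      (hasDerivAt_pi.mp (hasDerivAt_flow A t z)) 0
    have h2 : HasDerivAt (fun t : ℝ => -((t : ℂ) * a)) (-a) t := by
      simpa using ((Complex.ofRealCLM.hasDerivAt (x := t)).mul_const a).fun_neg
    have := h2.cexp.mul h1
    convert! this using 1
    rw [h0]; ring
  have hc := is_const_of_deriv_eq_zero (fun t => (hd t).differentiableAt) (fun t => (hd t).deriv) t 0
  simp only [Complex.ofReal_zero, zero_mul, neg_zero, Complex.exp_zero, one_mul, flow_zero] at hc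
  have h3 : flow A t z 0 = Complex.exp (t * a) * (Complex.exp (-(t * a)) * flow A t z 0) := by
    rw [← mul_assoc, ← Complex.exp_add]; simp
  rw [h3, hc]; rfl

lemma flow_mem (h0 : ∀ z, A z 0 = a * z 0) (t : ℝ) {z : Cn m} (hz : z ∈ divisorCompl m) :
    flow A t z ∈ divisorCompl m := by
  change flow A t z 0 ≠ 0
  rw [flow_apply_zero h0]
  exact mul_ne_zero (Complex.exp_ne_zero _) hz

lemma flow_e₀ (he : ∀ c : ℂ, A (c • e₀) = (a * c) • e₀) (t : ℝ) (c : ℂ) :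
    flow A t (c • e₀) = (Complex.exp (t * a) * c) • e₀ := by
  have hd : ∀ s : ℝ, HasDerivAt (fun s : ℝ => flow A (-s) ((Complex.exp (s * a) * c) • e₀)) 0 s := by
    intro s
    have h2 : HasDerivAt (fun t : ℝ => (t : ℂ) * a) a s := by
      simpa using (Complex.ofRealCLM.hasDerivAt (x := s)).mul_const a
    have h3 : HasDerivAt (fun s : ℝ => ((Complex.exp (s * a) * c) • (e₀ : Cn m)))
        ((Complex.exp (s * a) * a * c) • e₀) s := (h2.cexp.mul_const c).smul_const e₀
    have h4 : HasDerivAt (fun s : ℝ => flow A (-s)) (-(flow A (-s) * A)) s := by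
      have := (hasDerivAt_exp_smul_const (𝕂 := ℝ) A (-s)).scomp s (hasDerivAt_neg s)
      simpa [flow, Function.comp_def] using this
    have := h4.clm_apply h3
    convert! this using 1
    simp only [neg_apply, mul_apply_eq_comp, he]
    rw [show a * (Complex.exp (s * a) * c) = Complex.exp (s * a) * a * c by ring]
    simp
  have hc := is_const_of_deriv_eq_zero (fun t => (hd t).differentiableAt) (fun t => (hd t).deriv) t 0
  simp only [Complex.ofReal_zero, zero_mul, neg_zero, Complex.exp_zero, one_mul, flow_zero] at hc
  have h5 := congrArg (flow A t) hc
  rw [flow_neg_apply] at h5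
  exact h5.symm

variable {g : Cn m → Cn m →L[ℝ] Cn m →L[ℝ] ℝ} {β C : ℝ}

/-- The hypothesis `hA` is `L_X g = 2 g` for the field `X z = A z`, so `exp (-2t)` times the pulled
back metric is constant in `t`. -/
lemma flow_metric (hg : IsKahlerMetricOn g (divisorCompl m)) (h0 : ∀ z, A z 0 = a * z 0)
    (hA : ∀ z ∈ divisorCompl m, ∀ h k, g z (A h) k + g z h (A k) =
      2 * g z h k - fderiv ℝ g z (A z) h k) {z : Cn m} (hz : z ∈ divisorCompl m) (h k : Cn m)
    (t : ℝ) : g (flow A t z) (flow A t h) (flow A t k) = Real.exp (2 * t) * g z h k := by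
  have hd : ∀ t : ℝ, HasDerivAt (fun t : ℝ => Real.exp (-(2 * t)) *
      g (flow A t z) (flow A t h) (flow A t k)) 0 t := by
    intro t
    have hzt := flow_mem h0 t hz
    have h1 := (hg.hasFDerivAt hzt).comp_hasDerivAt t (hasDerivAt_flow A t z)
    have h2 := (h1.clm_apply (hasDerivAt_flow A t h)).clm_apply (hasDerivAt_flow A t k)
    have h3 : HasDerivAt (fun t : ℝ => -(2 * t)) (-2) t := by
      simpa using ((hasDerivAt_id t).const_mul 2).fun_neg
    have := h3.exp.mul h2
    convert! this using 1
    have h4 := hA _ hzt (flow A t h) (flow A t k)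
    simp only [Function.comp, add_apply]
    linear_combination (-Real.exp (-(2 * t))) * h4
  have hc := is_const_of_deriv_eq_zero (fun t => (hd t).differentiableAt) (fun t => (hd t).deriv) t 0
  simp only [mul_zero, neg_zero, Real.exp_zero, one_mul, flow_zero] at hc
  have h3 : g (flow A t z) (flow A t h) (flow A t k) = Real.exp (2 * t) * (Real.exp (-(2 * t)) *
      g (flow A t z) (flow A t h) (flow A t k)) := by
    rw [← mul_assoc, ← Real.exp_add]; simp
  rw [h3, hc]; rfl

lemma modelQ_of_tang {z w : Cn m} (hw : w 0 = 0) : modelQ β z w = sqn (tang m) w := by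
  simp [modelQ, hw]

lemma modelQ_smul_e₀ (z : Cn m) (c : ℂ) : modelQ β z (c • e₀) = ‖z 0‖ ^ (2 * β - 2) * ‖c‖ ^ 2 := by
  rw [modelQ, sqn_tang]; simp [e₀]

lemma e₀_mem : (e₀ : Cn m) ∈ divisorCompl m := by simp [divisorCompl, e₀]

lemma metric_cauchy {B : Cn m →L[ℝ] Cn m →L[ℝ] ℝ} (hs : ∀ x y, B x y = B y x)
    (hp : ∀ x, 0 ≤ B x x) (x y : Cn m) : B x y ^ 2 ≤ B x x * B y y := by
  have h : ∀ t : ℝ, 0 ≤ B y y * (t * t) + (-2 * B x y) * t + B x x := by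
    intro t
    have h1 := hp (x - t • y)
    simp only [map_sub, map_smul, sub_apply, smul_apply, smul_eq_mul, hs y x] at h1
    linarith
  have := discrim_le_zero h
  unfold discrim at this
  nlinarith

lemma sqn_smul (s : Finset (Fin (m + 1))) (c : ℝ) (x : Cn m) : sqn s (c • x) = c ^ 2 * sqn s x := by
  simp [sqn, mul_pow, Finset.mul_sum]

/-- The function `g(w, w)` is subharmonic and bounded, but its supremum may be approached only at
infinity. The homotheties bring a maximizing sequence back to a bounded region, at the price of
moving `w`. The strong maximum principle applies to a limit `ws` of the moved vectors, and its
conclusion is carried back to `w` by the inverse flow. -/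
theorem metric_tang_const (hg : IsKahlerMetricOn g (divisorCompl m)) (hβ : 0 < β)
    (hC : EquivModel g β C) {ι : Type} [Fintype ι] [DecidableEq ι] (b : Module.Basis ι ℝ (Cn m))
    (hvol : ∀ p ∈ divisorCompl m, (gram (g p) b).det = (‖p 0‖ ^ (2 * β - 2)) ^ 2)
    (h0 : ∀ z, A z 0 = a * z 0) (he : ∀ c : ℂ, A (c • e₀) = (a * c) • e₀)
    (hA : ∀ z ∈ divisorCompl m, ∀ h k, g z (A h) k + g z h (A k) =
      2 * g z h k - fderiv ℝ g z (A z) h k) {w : Cn m} (hw : w 0 = 0) :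
    ∃ M, ∀ z ∈ divisorCompl m, g z w w = M := by
  have hC0 := hC.1
  set S := flow A with hS
  have htan : ∀ {w : Cn m}, w 0 = 0 → ∀ t, S t w 0 = 0 := fun hw t => by
    rw [hS, flow_apply_zero h0, hw, mul_zero]
  have hup : ∀ {z w : Cn m}, z ∈ divisorCompl m → w 0 = 0 → g z w w ≤ C * sqn (tang m) w := by
    intro z w hz hw
    have := (hC.2 z hz w).2
    rwa [modelQ_of_tang hw] at this
  have hlow : ∀ {z w : Cn m}, z ∈ divisorCompl m → w 0 = 0 → sqn (tang m) w ≤ C * g z w w := by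
    intro z w hz hw
    have := (hC.2 z hz w).1
    rwa [modelQ_of_tang hw, inv_mul_le_iff₀ hC0] at this
  -- The homothety property at the base point `e₀`, with the model comparison at both ends, controls
  -- the flow on tangential vectors for positive and negative times alike.
  have hgrow : ∀ {w : Cn m}, w 0 = 0 → ∀ t, sqn (tang m) (S t w) ≤
      C ^ 2 * Real.exp (2 * t) * sqn (tang m) w := by
    intro w hw t
    have h1 := hlow (flow_mem h0 t e₀_mem) (htan hw t)
    rw [hS, flow_metric hg h0 hA e₀_mem] at h1
    have h2 := mul_le_mul_of_nonneg_left (hup (z := e₀) e₀_mem hw) (Real.exp_pos (2 * t)).le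
    have h3 := mul_le_mul_of_nonneg_left h2 hC0.le
    refine h1.trans (h3.trans (le_of_eq ?_))
    ring
  -- The same comparison for `∂/∂u`, whose model length at the moved point involves the eigenvalue
  -- again; this gives the power `2β`.
  have hgrow0 : ∀ t : ℝ, ‖Complex.exp (t * a)‖ ^ (2 * β) ≤ C ^ 2 * Real.exp (2 * t) := by
    intro t
    have hpos : 0 < ‖Complex.exp (t * a)‖ := norm_pos_iff.mpr (Complex.exp_ne_zero _)
    have h1 := (hC.2 _ (flow_mem h0 t (e₀_mem (m := m))) (flow A t ((1 : ℂ) • e₀))).1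
    rw [flow_metric hg h0 hA e₀_mem, flow_e₀ he, modelQ_smul_e₀, flow_apply_zero h0] at h1
    have h2 := (hC.2 (e₀ : Cn m) e₀_mem ((1 : ℂ) • e₀)).2
    rw [modelQ_smul_e₀] at h2
    have h3 : (e₀ : Cn m) 0 = 1 := by simp [e₀]
    simp only [h3, mul_one, norm_one, Real.one_rpow, one_pow] at h1 h2
    have h4 : ‖Complex.exp (t * a)‖ ^ (2 * β - 2) * ‖Complex.exp (t * a)‖ ^ 2 =
        ‖Complex.exp (t * a)‖ ^ (2 * β) := by
      rw [← Real.rpow_two, ← Real.rpow_add hpos]; congr 1; ring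
    rw [h4, inv_mul_le_iff₀ hC0] at h1
    have h5 := mul_le_mul_of_nonneg_left h2 (Real.exp_pos (2 * t)).le
    nlinarith
  set T := (fun z => g z w w) '' divisorCompl m with hT
  have hTne : T.Nonempty := ⟨_, e₀, e₀_mem, rfl⟩
  have hTb : BddAbove T := ⟨C * sqn (tang m) w, by
    rintro _ ⟨z, hz, rfl⟩; exact hup hz hw⟩
  set M := sSup T
  have hM : ∀ z ∈ divisorCompl m, g z w w ≤ M := fun z hz => le_csSup hTb ⟨z, hz, rfl⟩
  obtain ⟨u, -, hu, huT⟩ := exists_seq_tendsto_sSup hTne hTb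
  choose z hz hzu using huT
  simp only at hzu
  -- The size of `z n` as seen by the model cone, where `|u|` counts as `|u|^β`. Flowing for time
  -- `-log ρ` brings the points to unit scale.
  set ρ : ℕ → ℝ := fun n => max (‖z n 0‖ ^ β) (√(sqn (tang m) (z n)))
  have hρ : ∀ n, 0 < ρ n := fun n =>
    lt_max_of_lt_left (Real.rpow_pos_of_pos (norm_pos_iff.mpr (hz n)) _)
  set t : ℕ → ℝ := fun n => Real.log (ρ n)
  have hexp : ∀ n, Real.exp (2 * -t n) = (ρ n ^ 2)⁻¹ := fun n => by
    rw [mul_neg, Real.exp_neg, two_mul, Real.exp_add, Real.exp_log (hρ n), sq]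
  set z' : ℕ → Cn m := fun n => S (-t n) (z n)
  -- With this factor `g(w', w')` at `z'` equals `g(w, w)` at `z n`, and `w'` stays bounded.
  set w' : ℕ → Cn m := fun n => Real.exp (t n) • S (-t n) w
  have hz'U : ∀ n, z' n ∈ divisorCompl m := fun n => flow_mem h0 _ (hz n)
  have hw'0 : ∀ n, w' n 0 = 0 := fun n => by
    simp only [w', Pi.smul_apply, htan hw, smul_zero]
  have hw'b : ∀ n, sqn (tang m) (w' n) ≤ C ^ 2 * sqn (tang m) w := by
    intro n
    rw [sqn_smul, Real.exp_log (hρ n)]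
    have h1 := mul_le_mul_of_nonneg_left (hgrow hw (-t n)) (sq_nonneg (ρ n))
    rw [hexp] at h1
    refine h1.trans (le_of_eq ?_)
    have := (hρ n).ne'
    field_simp
  have hz'b0 : ∀ n, ‖z' n 0‖ ≤ (C ^ 2) ^ (2 * β)⁻¹ := by
    intro n
    have h1 : ‖z' n 0‖ ^ (2 * β) ≤ C ^ 2 := by
      simp only [z', hS]
      rw [flow_apply_zero h0, norm_mul, Real.mul_rpow (norm_nonneg _) (norm_nonneg _)]
      have h2 := hgrow0 (-t n)
      rw [hexp] at h2
      have h3 : ‖z n 0‖ ^ (2 * β) ≤ ρ n ^ 2 := by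
        rw [mul_comm, Real.rpow_mul (norm_nonneg _), Real.rpow_two]
        exact pow_le_pow_left₀ (Real.rpow_nonneg (norm_nonneg _) _) (le_max_left _ _) 2
      calc _ ≤ (C ^ 2 * (ρ n ^ 2)⁻¹) * ρ n ^ 2 :=
            mul_le_mul h2 h3 (Real.rpow_nonneg (norm_nonneg _) _) (by have := hρ n; positivity)
        _ = C ^ 2 := by have := (hρ n).ne'; field_simp
    have h4 := Real.rpow_le_rpow (Real.rpow_nonneg (norm_nonneg _) _) h1
      (by positivity : 0 ≤ (2 * β)⁻¹)
    rwa [← Real.rpow_mul (norm_nonneg _), mul_inv_cancel₀ (by positivity), Real.rpow_one] at h4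
  have hz'bt : ∀ n, sqn (tang m) (z' n) ≤ C ^ 2 := by
    intro n
    set v : Cn m := z n - z n 0 • e₀
    have hv0 : v 0 = 0 := by simp [v, e₀]
    have hsplit : ∀ (x : Cn m) (c : ℂ), sqn (tang m) (x + c • (e₀ : Cn m)) = sqn (tang m) x := fun x c => by
      rw [sqn_tang, sqn_tang]; simp [e₀]
    have hzv : z n = v + z n 0 • e₀ := by simp [v]
    have h1 : sqn (tang m) (z' n) = sqn (tang m) (S (-t n) v) := by
      simp only [z']
      conv_lhs => rw [hzv, map_add, hS, flow_e₀ he, hsplit]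
    have h2 : sqn (tang m) v = sqn (tang m) (z n) := by
      conv_rhs => rw [hzv, hsplit]
    have h3 := hgrow hv0 (-t n)
    rw [hexp, h2] at h3
    have h4 : sqn (tang m) (z n) ≤ ρ n ^ 2 := by
      have := pow_le_pow_left₀ (Real.sqrt_nonneg _)
        (le_max_right (‖z n 0‖ ^ β) (√(sqn (tang m) (z n)))) 2
      rwa [Real.sq_sqrt (sqn_nonneg _ _)] at this
    rw [h1]
    calc _ ≤ _ := h3
      _ ≤ C ^ 2 * (ρ n ^ 2)⁻¹ * ρ n ^ 2 :=
        mul_le_mul_of_nonneg_left h4 (by have := hρ n; positivity)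
      _ = C ^ 2 := by have := (hρ n).ne'; field_simp
  obtain ⟨R, hR⟩ : ∃ R : ℝ, ∀ n, (z' n, w' n) ∈ Metric.closedBall (0 : Cn m × Cn m) R := by
    refine ⟨max (√(((C ^ 2) ^ (2 * β)⁻¹) ^ 2 + C ^ 2)) (√(C ^ 2 * sqn (tang m) w)), fun n => ?_⟩
    rw [mem_closedBall_zero_iff, Prod.norm_def]
    refine max_le_max (Real.le_sqrt_of_sq_le ?_) (Real.le_sqrt_of_sq_le ?_)
    · refine (norm_sq_le_sqn _).trans ?_
      rw [sqn_univ]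
      exact add_le_add (pow_le_pow_left₀ (norm_nonneg _) (hz'b0 n) 2) (hz'bt n)
    · refine (norm_sq_le_sqn _).trans ?_
      rw [sqn_univ]
      simpa [hw'0] using hw'b n
  obtain ⟨⟨zs, ws⟩, -, φ, hφ, hlim⟩ := (isCompact_closedBall (0 : Cn m × Cn m) R).tendsto_subseq hR
  have hzlim : Tendsto (fun n => z' (φ n)) atTop (𝓝 zs) :=
    (continuous_fst.tendsto _).comp hlim
  have hwlim : Tendsto (fun n => w' (φ n)) atTop (𝓝 ws) :=
    (continuous_snd.tendsto _).comp hlim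
  have hws0 : ws 0 = 0 := by
    have := ((continuous_apply (0 : Fin (m + 1))).tendsto ws).comp hwlim
    refine tendsto_nhds_unique this ?_
    simp only [Function.comp_def, hw'0]
    exact tendsto_const_nhds
  have hSw' : ∀ n, S (t n) (w' n) = Real.exp (t n) • w := fun n => by
    simp only [w', map_smul, hS, flow_neg_apply]
  -- The flow permutes the points off the divisor, so `w'` inherits the upper bound `M` of `w`.
  have hw'M : ∀ n, ∀ x ∈ divisorCompl m, g x (w' n) (w' n) ≤ M := by
    intro n x hx
    have h1 := flow_metric hg h0 hA hx (w' n) (w' n) (t n)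
    rw [← hS, hSw'] at h1
    simp only [map_smul, smul_apply, smul_eq_mul] at h1
    rw [two_mul, Real.exp_add, mul_assoc] at h1
    have h2 := mul_left_cancel₀ (Real.exp_pos _).ne' (mul_left_cancel₀ (Real.exp_pos _).ne' h1)
    rw [← h2]
    exact hM _ (flow_mem h0 _ hx)
  have hw'z : ∀ n, g (z' n) (w' n) (w' n) = u n := by
    intro n
    have h1 := flow_metric hg h0 hA (hz'U n) (w' n) (w' n) (t n)
    rw [← hS, hSw'] at h1
    simp only [map_smul, smul_apply, smul_eq_mul] at h1
    rw [two_mul, Real.exp_add, mul_assoc] at h1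
    have h2 := mul_left_cancel₀ (Real.exp_pos _).ne' (mul_left_cancel₀ (Real.exp_pos _).ne' h1)
    rw [← h2]
    simp only [z', hS, flow_neg_apply]
    exact hzu n
  have hquad : ∀ x, Continuous fun w : Cn m => g x w w := fun x => by fun_prop
  have hwsM : ∀ x ∈ divisorCompl m, g x ws ws ≤ M := fun x hx =>
    le_of_tendsto (((hquad x).tendsto ws).comp hwlim)
      (Eventually.of_forall fun n => hw'M (φ n) x hx)
  -- The points `z'` may converge to the divisor, where `g` is undefined. On tangential vectors,
  -- however, `g` is bounded uniformly by `C`, so `w'` can be replaced by its limit.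
  have hwsz : Tendsto (fun n => g (z' (φ n)) ws ws) atTop (𝓝 M) := by
    have h1 : Tendsto (fun n => u (φ n)) atTop (𝓝 M) := hu.comp hφ.tendsto_atTop
    have h2 : Tendsto (fun n => C * √(sqn (tang m) (ws - w' (φ n)) *
        sqn (tang m) (ws + w' (φ n)))) atTop (𝓝 0) := by
      have hcont : Continuous fun y : Cn m => C * √(sqn (tang m) (ws - y) * sqn (tang m) (ws + y)) := by
        have := continuous_sqn (tang m)
        fun_prop
      have := (hcont.tendsto ws).comp hwlim
      have h0 : sqn (tang m) (0 : Cn m) = 0 := by simp [sqn]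
      simpa [h0, Function.comp_def] using this
    have h3 : ∀ n, ‖g (z' (φ n)) ws ws - u (φ n)‖ ≤ C * √(sqn (tang m) (ws - w' (φ n)) *
        sqn (tang m) (ws + w' (φ n))) := by
      intro n
      have hzn := hz'U (φ n)
      have hpos : ∀ x, 0 ≤ g (z' (φ n)) x x := fun x => by
        by_cases hx : x = 0
        · simp [hx]
        · exact (hg.pos _ hzn x hx).le
      have h4 := metric_cauchy (hg.symm _ hzn) hpos (ws - w' (φ n)) (ws + w' (φ n))
      have h5 := hup hzn (w := ws - w' (φ n)) (by simp [hws0, hw'0])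
      have h6 := hup hzn (w := ws + w' (φ n)) (by simp [hws0, hw'0])
      have h7 : g (z' (φ n)) ws ws - u (φ n) = g (z' (φ n)) (ws - w' (φ n)) (ws + w' (φ n)) := by
        rw [← hw'z]
        simp only [map_sub, map_add, sub_apply]
        rw [hg.symm _ hzn (w' (φ n)) ws]
        ring
      rw [h7, Real.norm_eq_abs]
      refine abs_le_of_sq_le_sq ?_ (by positivity)
      rw [mul_pow, Real.sq_sqrt (mul_nonneg (sqn_nonneg _ _) (sqn_nonneg _ _))]
      refine h4.trans ((mul_le_mul h5 h6 (hpos _) (mul_nonneg hC0.le (sqn_nonneg _ _))).trans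
        (le_of_eq (by ring)))
    have h4 := squeeze_zero_norm h3 h2
    have h5 := h4.add h1
    simpa using h5
  have hsub : ∀ w : Cn m, IsSubharm ι g fun p => g p w w := by
    intro w
    refine ⟨fun z hz => ((hg.hasFDerivAt hz).apply₂ w w).continuousAt.continuousWithinAt,
      fun z hz => ?_⟩
    obtain ⟨e, hef⟩ := exists_isFrame (hg.symm z hz) (hg.pos z hz) b
    exact ⟨e, _, hef, hasLaplacian_metric hg hz hef hvol w,
      Finset.sum_nonneg fun _ _ => Finset.sum_nonneg fun _ _ =>
        add_nonneg (sq_nonneg _) (sq_nonneg _)⟩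
  have hconst := eq_of_tendsto_sup hβ hC (hsub ws) hwsM (fun n => hz'U (φ n)) hzlim hwsz
  refine ⟨M, fun x hx => ?_⟩
  -- The normalization of `w'` is undone on the limit `ws`: `g(y, y) = M` everywhere by the flow,
  -- and `y` tends to `w` along the subsequence since the normalized flow is uniformly bounded on
  -- tangential vectors.
  set y : ℕ → Cn m := fun n => Real.exp (-t n) • S (t n) ws
  have hyM : ∀ n, g x (y n) (y n) = M := by
    intro n
    have h1 := flow_metric hg h0 hA (flow_mem h0 (-t n) hx) ws ws (t n)
    rw [flow_neg_apply, hconst _ (flow_mem h0 (-t n) hx), ← hS] at h1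
    simp only [y, map_smul, smul_apply, smul_eq_mul]
    rw [h1, two_mul, Real.exp_add, Real.exp_neg]
    have := (Real.exp_pos (t n)).ne'
    field_simp
  have hylim : Tendsto (fun n => y (φ n)) atTop (𝓝 w) := by
    have h1 : ∀ n, ‖y n - w‖ ≤ √(C ^ 2 * sqn (tang m) (ws - w' n)) := by
      intro n
      have h2 : y n - w = Real.exp (-t n) • S (t n) (ws - w' n) := by
        rw [map_sub, hSw', smul_sub, smul_smul, ← Real.exp_add]
        simp [y]
      have h3 : (ws - w' n) 0 = 0 := by simp [hws0, hw'0]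
      refine Real.le_sqrt_of_sq_le ((norm_sq_le_sqn _).trans ?_)
      rw [sqn_univ, h2]
      simp only [Pi.smul_apply, htan h3, smul_zero, norm_zero]
      rw [sqn_smul]
      have h4 := mul_le_mul_of_nonneg_left (hgrow h3 (t n)) (sq_nonneg (Real.exp (-t n)))
      refine le_trans (le_of_eq ?_) (h4.trans (le_of_eq ?_))
      · ring
      · rw [two_mul, Real.exp_add, Real.exp_neg]
        have := (Real.exp_pos (t n)).ne'
        field_simp
    have h2 : Tendsto (fun n => √(C ^ 2 * sqn (tang m) (ws - w' (φ n)))) atTop (𝓝 0) := by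
      have hcont : Continuous fun y : Cn m => √(C ^ 2 * sqn (tang m) (ws - y)) := by
        have := continuous_sqn (tang m)
        fun_prop
      have := (hcont.tendsto ws).comp hwlim
      have h0 : sqn (tang m) (0 : Cn m) = 0 := by simp [sqn]
      simpa [h0, Function.comp_def] using this
    rw [tendsto_iff_norm_sub_tendsto_zero]
    exact squeeze_zero (fun _ => norm_nonneg _) (fun n => h1 (φ n)) h2
  have h1 := ((hquad x).tendsto w).comp hylim
  simp only [Function.comp_def, hyM] at h1
  exact (tendsto_nhds_unique h1 tendsto_const_nhds)

end

end KahlerCone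
end

/-! ### The model form in coordinates. -/

noncomputable section

namespace KahlerCone

open Filter Topology Asymptotics

variable {m : ℕ}

set_option maxSynthPendingDepth 3

section Model

lemma areaForm_apply (a b : ℂ) : areaForm ![a, b] = ((starRingEnd ℂ) a * b).im := by
  have := Complex.finrank_real_complex_fact
  rw [← Complex.areaForm, Orientation.areaForm_to_volumeForm]
  rfl

lemma coordForm_apply (j : Fin (m + 1)) (x y : Cn m) :
    coordForm j ![x, y] = ((starRingEnd ℂ) (x j) * y j).im := by
  have h : (coordForm j : Cn m [⋀^Fin 2]→L[ℝ] ℝ) ![x, y] = areaForm ![x j, y j] := by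
    unfold coordForm
    rw [ContinuousAlternatingMap.compContinuousLinearMap_apply]
    congr 1
    ext i; fin_cases i <;> rfl
  rw [h, areaForm_apply]

lemma modelForm_apply (β : ℝ) (z x y : Cn m) :
    modelForm m β z ![x, y] = ‖z 0‖ ^ (2 * β - 2) * ((starRingEnd ℂ) (x 0) * y 0).im +
      ∑ i : Fin m, ((starRingEnd ℂ) (x i.succ) * y i.succ).im := by
  have h : modelForm m β z ![x, y] = ‖z 0‖ ^ (2 * β - 2) * coordForm 0 ![x, y] +
      ∑ i : Fin m, coordForm i.succ ![x, y] := by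
    unfold modelForm
    rw [ContinuousAlternatingMap.add_apply, ContinuousAlternatingMap.smul_apply, smul_eq_mul,
      ContinuousAlternatingMap.sum_apply]
  rw [h]
  simp only [coordForm_apply]

lemma riem_modelForm (β : ℝ) (z x y : Cn m) :
    riem (modelForm m β z) x y = ‖z 0‖ ^ (2 * β - 2) * ((starRingEnd ℂ) (x 0) * y 0).re +
      ∑ i : Fin m, ((starRingEnd ℂ) (x i.succ) * y i.succ).re := by
  have h : ∀ a b : ℂ, ((starRingEnd ℂ) a * (Complex.I * b)).im = ((starRingEnd ℂ) a * b).re := by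
    intro a b; simp
  rw [riem, modelForm_apply]
  simp only [Pi.smul_apply, smul_eq_mul, h]

lemma riem_modelForm_self (β : ℝ) (z x : Cn m) : riem (modelForm m β z) x x = modelQ β z x := by
  have h : ∀ a : ℂ, ((starRingEnd ℂ) a * a).re = ‖a‖ ^ 2 := fun a => by
    rw [mul_comm, Complex.mul_conj, Complex.ofReal_re, Complex.normSq_eq_norm_sq]
  rw [riem_modelForm, modelQ, sqn_tang]
  simp only [h]

/-- A 2-form of type `(1,1)` is determined by its quadratic form. -/
lemma form_ext {η₁ η₂ : Cn m [⋀^Fin 2]→L[ℝ] ℝ}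
    (h₁ : ∀ x y : Cn m, η₁ ![Complex.I • x, Complex.I • y] = η₁ ![x, y])
    (h₂ : ∀ x y : Cn m, η₂ ![Complex.I • x, Complex.I • y] = η₂ ![x, y])
    (h : ∀ x, riem η₁ x x = riem η₂ x x) : η₁ = η₂ := by
  have hsym : ∀ {η : Cn m [⋀^Fin 2]→L[ℝ] ℝ},
      (∀ x y : Cn m, η ![Complex.I • x, Complex.I • y] = η ![x, y]) →
      ∀ x y, bil η x y = bil η y x := fun hη x y => by
    rw [bil_apply, bil_apply, riem, riem, ← hη x, I_smul_I_smul, form_neg_right, form_swap, neg_neg]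
  have hb : ∀ x y, bil η₁ x y = bil η₂ x y := by
    intro x y
    have h1 := h (x + y)
    have h2 := h x
    have h3 := h y
    have h4 := hsym h₁ x y
    have h5 := hsym h₂ x y
    simp only [← bil_apply, map_add, add_apply] at h1 h2 h3
    linarith
  have hxy : ∀ x y, η₁ ![x, y] = η₂ ![x, y] := by
    intro x y
    have := hb x (-(Complex.I • y))
    simpa only [bil_apply, riem, smul_neg, I_smul_I_smul, neg_neg] using this
  ext v
  have hv : v = ![v 0, v 1] := by ext i; fin_cases i <;> rfl
  rw [hv]
  exact hxy _ _

end Model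

/-! ### Vanishing of the mixed coefficients and Hermitian normal form. -/

section Final

variable {g : Cn m → Cn m →L[ℝ] Cn m →L[ℝ] ℝ} {β C : ℝ}

lemma HasLaplacian.eq_zero_of_const {ι : Type} [Fintype ι] {f : Cn m → ℝ} {z : Cn m}
    {e : ι → Cn m} {c k : ℝ} (h : HasLaplacian f z e c) (hf : f =ᶠ[𝓝 z] fun _ => k) : c = 0 := by
  obtain ⟨p, q, hp, hq, rfl⟩ := h
  have h0 : ∀ a, HasSecondDeriv (fun _ : Cn m => k) z a 0 := fun a =>
    ⟨fun _ => 0, Eventually.of_forall fun t => hasDerivAt_const _ _, hasDerivAt_const _ _⟩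
  refine Finset.sum_eq_zero fun a _ => ?_
  rw [HasSecondDeriv.unique hf (hp a) (h0 _), HasSecondDeriv.unique hf (hq a) (h0 _), add_zero]

/-- If `g(w, w)` is constant its Laplacian is zero, and by `hasLaplacian_metric` that Laplacian is a
sum of squares containing every derivative of `g` along `w` in an orthonormal frame. -/
lemma fderiv_tang_eq_zero (hg : IsKahlerMetricOn g (divisorCompl m))
    {ι : Type} [Fintype ι] [DecidableEq ι] (b : Module.Basis ι ℝ (Cn m))
    (hvol : ∀ p ∈ divisorCompl m, (gram (g p) b).det = (‖p 0‖ ^ (2 * β - 2)) ^ 2)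
    {w : Cn m} {M : ℝ} (hM : ∀ z ∈ divisorCompl m, g z w w = M) {z : Cn m}
    (hz : z ∈ divisorCompl m) (x y : Cn m) : fderiv ℝ g z w x y = 0 := by
  obtain ⟨e, he⟩ := exists_isFrame (hg.symm z hz) (hg.pos z hz) b
  have hl := hasLaplacian_metric hg hz he hvol w
  have h0 := hl.eq_zero_of_const (k := M) (by
    filter_upwards [isOpen_divisorCompl.mem_nhds hz] with p hp using hM p hp)
  have h1 : ∀ a c, fderiv ℝ g z w (e a) (e c) = 0 := by
    intro a c
    rw [Finset.sum_eq_zero_iff_of_nonneg fun _ _ => Finset.sum_nonneg fun _ _ =>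
      add_nonneg (sq_nonneg _) (sq_nonneg _)] at h0
    have h2 := h0 a (Finset.mem_univ a)
    rw [Finset.sum_eq_zero_iff_of_nonneg fun _ _ => add_nonneg (sq_nonneg _) (sq_nonneg _)] at h2
    have h3 := h2 c (Finset.mem_univ c)
    have h4 := sq_nonneg (fderiv ℝ g z w (e a) (e c))
    have h5 := sq_nonneg (fderiv ℝ g z (Complex.I • w) (e a) (e c))
    exact pow_eq_zero_iff two_ne_zero |>.mp (by linarith)
  rw [← e.sum_repr x, ← e.sum_repr y]
  simp only [map_sum, map_smul, sum_apply, smul_apply, h1]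
  simp

/-- On the line through `z` in the `u`-direction, `g(e₀, w) + i g(e₀, I w)` is holomorphic in `u`
and, by Cauchy–Schwarz and uniform equivalence, of size `O(|u|^(β-1))`. It is therefore constant and
tends to zero at infinity. -/
lemma metric_mixed_eq_zero (hg : IsKahlerMetricOn g (divisorCompl m)) (hβ : 0 < β) (hβ1 : β < 1)
    (hC : EquivModel g β C)
    (hD : ∀ z ∈ divisorCompl m, ∀ w : Cn m, w 0 = 0 → ∀ x y, fderiv ℝ g z w x y = 0)
    {z w : Cn m} (hz : z ∈ divisorCompl m) (hw : w 0 = 0) : g z e₀ w = 0 := by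
  set v : Cn m := z - z 0 • e₀ with hv
  have hv0 : v 0 = 0 := by simp [v, e₀]
  set p : ℂ → Cn m := fun u => u • e₀ + v with hp
  have hp0 : ∀ u, p u 0 = u := fun u => by simp [p, hv0, e₀]
  have hpU : ∀ u ≠ 0, p u ∈ divisorCompl m := fun u hu => by
    change p u 0 ≠ 0; rwa [hp0]
  have hpz : p (z 0) = z := by simp [p, v]
  have hC0 := hC.1
  set L : ℂ →L[ℝ] Cn m := (ContinuousLinearMap.id ℝ ℂ).smulRight (e₀ : Cn m) with hL
  have hpd : ∀ u, HasFDerivAt p L u := fun u => L.hasFDerivAt.add_const v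
  have hgd : ∀ u ≠ 0, ∀ y, HasFDerivAt (fun u => g (p u) e₀ y) _ u := fun u hu y =>
    ((hg.hasFDerivAt (hpU u hu)).comp u (hpd u)).apply₂ e₀ y
  set f : ℂ → ℂ := fun u => (g (p u) e₀ w : ℂ) + Complex.I * (g (p u) e₀ (Complex.I • w) : ℂ)
    with hf
  have hIw : (Complex.I • w) 0 = 0 := by simp [hw]
  have hfd : DifferentiableOn ℂ f {0}ᶜ := by
    intro u hu
    have hu : u ≠ 0 := hu
    have hzU := hpU u hu
    have h1 := Complex.ofRealCLM.hasFDerivAt.comp u (hgd u hu w)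
    have h2 := Complex.ofRealCLM.hasFDerivAt.comp u (hgd u hu (Complex.I • w))
    have h3 := h1.add (h2.const_mul Complex.I)
    have h3 : HasFDerivAt f _ u := h3
    refine DifferentiableAt.differentiableWithinAt ?_
    rw [differentiableAt_complex_iff_differentiableAt_real]
    refine ⟨h3.differentiableAt, ?_⟩
    rw [h3.fderiv]
    -- Without the derivatives along `w` and `I • w`, which vanish, the Kähler identities are the
    -- Cauchy–Riemann equations.
    have e1 := fderiv_kahler hg hzU e₀ w e₀
    have e2 := fderiv_kahler hg hzU e₀ (Complex.I • w) e₀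
    rw [hD _ hzU _ hw, hD _ hzU _ hIw] at e1
    rw [I_smul_I_smul, hD _ hzU _ hIw, hD _ hzU (-w) (by simp [hw])] at e2
    rw [fderiv_symm hg hzU _ w, fderiv_symm hg hzU _ (Complex.I • w)] at e1
    rw [fderiv_symm hg hzU _ (Complex.I • w), fderiv_symm hg hzU _ (-w), map_neg] at e2
    have e1' : fderiv ℝ g (p u) (Complex.I • e₀) e₀ w =
      -fderiv ℝ g (p u) e₀ e₀ (Complex.I • w) := by linarith
    have e2' : fderiv ℝ g (p u) (Complex.I • e₀) e₀ (Complex.I • w) =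
      fderiv ℝ g (p u) e₀ e₀ w := by linarith
    simp [hL, e1', e2']
    ring_nf
    rw [Complex.I_sq]
    ring
  have hsw := sqn_nonneg (tang m) w
  have hbd : ∀ u ≠ 0, ∀ y : Cn m, y 0 = 0 → sqn (tang m) y = sqn (tang m) w →
      |g (p u) e₀ y| ≤ C * √(sqn (tang m) w) * ‖u‖ ^ (-(1 - β)) := by
    intro u hu y hy hyw
    have hzU := hpU u hu
    have hpos : ∀ x, 0 ≤ g (p u) x x := fun x => by
      by_cases hx : x = 0
      · simp [hx]
      · exact (hg.pos _ hzU x hx).le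
    have h1 := metric_cauchy (hg.symm _ hzU) hpos e₀ y
    have h2 := (hC.2 _ hzU ((1 : ℂ) • e₀)).2
    have h3 := (hC.2 _ hzU y).2
    rw [modelQ_smul_e₀, hp0] at h2
    rw [modelQ_of_tang hy, hyw] at h3
    simp only [one_smul, norm_one, one_pow, mul_one] at h2
    have hup : 0 < ‖u‖ := norm_pos_iff.mpr hu
    have h4 : (‖u‖ ^ (-(1 - β))) ^ 2 = ‖u‖ ^ (2 * β - 2) := by
      rw [← Real.rpow_two, ← Real.rpow_mul hup.le]; congr 1; ring
    refine abs_le_of_sq_le_sq ?_ (by positivity)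
    rw [mul_pow, mul_pow, Real.sq_sqrt hsw, h4]
    refine h1.trans ((mul_le_mul h2 h3 (hpos _) (by positivity)).trans (le_of_eq (by ring)))
  set K := 2 * (C * √(sqn (tang m) w)) with hK
  have hfb : ∀ u ≠ 0, ‖f u‖ ≤ K * ‖u‖ ^ (-(1 - β)) := by
    intro u hu
    have h1 := hbd u hu w hw rfl
    have h2 := hbd u hu (Complex.I • w) hIw (sqn_I_smul _ _)
    refine (norm_add_le _ _).trans ?_
    rw [norm_mul, Complex.norm_I, one_mul, Complex.norm_real, Complex.norm_real, Real.norm_eq_abs,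
      Real.norm_eq_abs]
    linarith
  have hconst := eq_of_punctured_growth hfd (C := K) (α := 1 - β) (by linarith) (by linarith)
    (fun u hu => (hfb u hu).trans (by
      have hup : 0 < ‖u‖ := norm_pos_iff.mpr hu
      refine mul_le_mul_of_nonneg_left ?_ (by positivity)
      have := Real.rpow_nonneg hup.le (1 - β)
      linarith))
  have hf0 : f (z 0) = 0 := by
    have hlim : Tendsto (fun R : ℝ => K * R ^ (-(1 - β))) atTop (𝓝 0) := by
      simpa using (tendsto_rpow_neg_atTop (by linarith : 0 < 1 - β)).const_mul K
    have : ‖f (z 0)‖ ≤ 0 := by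
      refine ge_of_tendsto hlim ?_
      filter_upwards [eventually_gt_atTop 0] with R hR
      have hR0 : (R : ℂ) ≠ 0 := by exact_mod_cast hR.ne'
      rw [hconst _ hz _ hR0]
      refine (hfb _ hR0).trans (le_of_eq ?_)
      rw [Complex.norm_real, Real.norm_of_nonneg hR.le]
    exact norm_le_zero_iff.mp this
  have := congrArg Complex.re hf0
  simpa [hf, hpz] using this

lemma complex_smul_eq (r : ℂ) (x : Cn m) : r • x = r.re • x + r.im • (Complex.I • x) := by
  ext i
  simp only [Pi.smul_apply, Pi.add_apply, smul_eq_mul, Complex.real_smul]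
  conv_lhs => rw [← Complex.re_add_im r]
  ring

/-- Coordinates in an orthonormal basis. `V` is abstract, so that the norm given by `core` is the
only one on it. -/
lemma exists_linearEquiv_of_core {V : Type} [AddCommGroup V] [Module ℂ V] [FiniteDimensional ℂ V]
    (core : InnerProductSpace.Core ℂ V) {n : ℕ} (hn : Module.finrank ℂ V = n) :
    ∃ S : V ≃ₗ[ℂ] (Fin n → ℂ), ∀ w, (core.inner w w).re = ∑ i, ‖S w i‖ ^ 2 := by
  let _ : NormedAddCommGroup V := @InnerProductSpace.Core.toNormedAddCommGroup ℂ V _ _ _ core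
  let _ : InnerProductSpace ℂ V := InnerProductSpace.ofCore core.toCore
  let b := (stdOrthonormalBasis ℂ V).reindex (finCongr hn)
  refine ⟨b.repr.toLinearEquiv.trans (WithLp.linearEquiv 2 ℂ (Fin n → ℂ)), fun w => ?_⟩
  have h4 : ∀ i, (b.repr.toLinearEquiv.trans (WithLp.linearEquiv 2 ℂ (Fin n → ℂ))) w i =
      inner ℂ (b i) w := fun i => by
    rw [← b.repr_apply_apply]; rfl
  simp only [h4]
  rw [b.sum_sq_norm_inner_right w]
  exact inner_self_eq_norm_sq (𝕜 := ℂ) w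

/-- A Hermitian inner product on the space of tangential vectors has an orthonormal basis. -/
lemma exists_linearEquiv_sum_sq {B : Cn m →L[ℝ] Cn m →L[ℝ] ℝ} (hs : ∀ x y, B x y = B y x)
    (hJ : ∀ x y, B (Complex.I • x) (Complex.I • y) = B x y) (hp : ∀ x, x ≠ 0 → 0 < B x x) :
    ∃ S : (Fin m → ℂ) ≃ₗ[ℂ] (Fin m → ℂ), ∀ w : Fin m → ℂ,
      B (Fin.cons 0 w : Cn m) (Fin.cons 0 w : Cn m) = ∑ i, ‖S w i‖ ^ 2 := by
  let ι : (Fin m → ℂ) →ₗ[ℂ] Cn m :=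
    { toFun := fun w => Fin.cons 0 w
      map_add' := fun x y => by ext i; refine Fin.cases ?_ (fun j => ?_) i <;> simp
      map_smul' := fun c x => by ext i; refine Fin.cases ?_ (fun j => ?_) i <;> simp }
  have hι : ∀ w, ι w = 0 → w = 0 := fun w hw => by
    ext i
    have := congrFun hw i.succ
    simpa [ι] using this
  have hJ' : ∀ x y, B (Complex.I • x) y = -B x (Complex.I • y) := fun x y => by
    rw [← hJ x, I_smul_I_smul, map_neg, neg_neg]
  -- The Hermitian form `B(x, y) - i B(x, I y)`, conjugate linear in the first variable because `I`
  -- is skew for `B`.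
  let core : InnerProductSpace.Core ℂ (Fin m → ℂ) :=
    { inner := fun x y => (B (ι x) (ι y) : ℂ) - Complex.I * (B (ι x) (Complex.I • ι y) : ℂ)
      conj_inner_symm := fun x y => by
        have h1 := hs (ι y) (ι x)
        have h2 := hJ' (ι x) (ι y)
        have h3 := hs (Complex.I • ι x) (ι y)
        have h4 : B (ι y) (Complex.I • ι x) = -B (ι x) (Complex.I • ι y) := by linarith
        rw [h1, h4]
        simp
        ring
      re_inner_nonneg := fun x => by
        by_cases hx : ι x = 0
        · simp [hx]
        · simpa using (hp _ hx).le
      add_left := fun x y z => by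
        simp only [map_add, add_apply]; push_cast; ring
      smul_left := fun x y r => by
        simp only [map_smul, complex_smul_eq r (ι x), map_add, add_apply, smul_apply, hJ',
          smul_eq_mul, I_smul_I_smul, map_neg]
        have hr : (starRingEnd ℂ) r = r.re - r.im * Complex.I := by
          apply Complex.ext <;> simp
        rw [hr]
        push_cast
        ring_nf
        rw [Complex.I_sq]
        ring
      definite := fun x hx => by
        by_contra hne
        have h1 : ι x ≠ 0 := fun h => hne (hι x h)
        have h2 := congrArg Complex.re hx
        have h3 := hp _ h1
        simp at h2
        linarith }
  obtain ⟨S, hS⟩ := exists_linearEquiv_of_core core (n := m) (by simp)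
  refine ⟨S, fun w => ?_⟩
  rw [← hS]
  change B (ι w) (ι w) = ((B (ι w) (ι w) : ℂ) - Complex.I * (B (ι w) (Complex.I • ι w) : ℂ)).re
  simp

end Final

end KahlerCone
end

/-! ### The volume condition and the normalizing linear map. -/

noncomputable section

namespace KahlerCone

open Filter Topology Asymptotics

variable {m : ℕ}

set_option maxSynthPendingDepth 3

lemma realBasis_apply (a : Σ _ : Fin (m + 1), Fin 2) :
    realBasis m a = Pi.single a.1 (Complex.basisOneI a.2) := by
  rw [realBasis, Pi.basis_apply]

lemma prod_ite_fst_eq_zero (c : ℝ) :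
    ∏ a : Σ _ : Fin (m + 1), Fin 2, (if a.1 = 0 then c else 1) = c ^ 2 := by
  rw [Fintype.prod_sigma, Fin.prod_univ_succ]
  simp [Fin.succ_ne_zero]

lemma basisOneI_pairing (j l : Fin 2) :
    ((starRingEnd ℂ) (Complex.basisOneI j) * Complex.basisOneI l).re = if j = l then 1 else 0 := by
  fin_cases j <;> fin_cases l <;> simp

lemma gram_model (β : ℝ) (z : Cn m) :
    gram (metric (modelForm m β) z) (realBasis m) =
      Matrix.diagonal fun a => if a.1 = 0 then ‖z 0‖ ^ (2 * β - 2) else 1 := by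
  ext a b
  have h1 : gram (metric (modelForm m β) z) (realBasis m) a b =
      riem (modelForm m β z) (realBasis m a) (realBasis m b) := rfl
  obtain ⟨i, j⟩ := a
  obtain ⟨k, l⟩ := b
  rw [h1, riem_modelForm, realBasis_apply, realBasis_apply]
  by_cases hik : i = k
  · subst hik
    have h2 : (⟨i, j⟩ : Σ _ : Fin (m + 1), Fin 2) = ⟨i, l⟩ ↔ j = l := by simp
    rw [Matrix.diagonal_apply]
    simp only [h2]
    refine Fin.cases ?_ (fun i => ?_) i
    · simp only [Pi.single_eq_same, basisOneI_pairing]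
      simp [Fin.succ_ne_zero]
    · simp only [Pi.single_apply, (Fin.succ_ne_zero i).symm, Fin.succ_inj, if_false]
      rw [Finset.sum_eq_single i]
      · simpa using basisOneI_pairing j l
      · intro b _ hb
        simp [hb]
      · simp
  · rw [Matrix.diagonal_apply_ne _ (by simp [hik])]
    have h3 : ∀ p : Fin (m + 1), ((starRingEnd ℂ)
        ((Pi.single i (Complex.basisOneI j) : Cn m) p) *
          (Pi.single k (Complex.basisOneI l) : Cn m) p).re = 0 := by
      intro p
      by_cases hp : p = i
      · have : p ≠ k := fun h => hik (hp ▸ h)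
        simp [Pi.single_apply, this]
      · simp [Pi.single_apply, hp]
    simp only [h3]
    simp

/-- Evaluation on the real basis equates the roots of the Gram determinants. The root for the model
is positive, hence so is the determinant for `ω`, and the roots can be removed. -/
lemma gram_det_of_volForm_eq {ω : TwoForm m} {β : ℝ} {z : Cn m} (hz : z ∈ divisorCompl m)
    (h : volForm (ω z) = volForm (modelForm m β z)) :
    (gram (metric ω z) (realBasis m)).det = (‖z 0‖ ^ (2 * β - 2)) ^ 2 := by
  have h1 := congrArg (fun F => F ⇑(realBasis m)) h
  simp only [volForm, AlternatingMap.smul_apply, Module.Basis.det_self, smul_eq_mul,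
    mul_one] at h1
  have h2 : (gram (metric (modelForm m β) z) (realBasis m)).det = (‖z 0‖ ^ (2 * β - 2)) ^ 2 := by
    rw [gram_model, Matrix.det_diagonal, prod_ite_fst_eq_zero]
  have h3 : 0 < ‖z 0‖ := norm_pos_iff.mpr hz
  have h4 : √(gram (metric ω z) (realBasis m)).det = √((‖z 0‖ ^ (2 * β - 2)) ^ 2) := by
    rw [← h2]; exact h1
  have h5 : 0 < (‖z 0‖ ^ (2 * β - 2)) ^ 2 := by positivity
  have h6 : 0 < √(gram (metric ω z) (realBasis m)).det := h4 ▸ Real.sqrt_pos.mpr h5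
  have h7 := Real.sqrt_pos.mp h6
  rwa [Real.sqrt_inj h7.le h5.le] at h4

/-- Rescaling of the `u`-coordinate by a real factor. -/
def scaleZero (ρ : ℝ) : Cn m →L[ℝ] Cn m :=
  ContinuousLinearMap.pi fun i =>
    (if i = 0 then ρ else 1) • ContinuousLinearMap.proj (R := ℝ) (φ := fun _ => ℂ) i

lemma scaleZero_apply (ρ : ℝ) (x : Cn m) (i : Fin (m + 1)) :
    scaleZero ρ x i = (if i = 0 then ρ else 1) • x i := rfl

lemma scaleZero_realBasis (ρ : ℝ) (a : Σ _ : Fin (m + 1), Fin 2) :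
    scaleZero ρ (realBasis m a) = (if a.1 = 0 then ρ else 1) • realBasis m a := by
  rw [realBasis_apply]
  ext i
  rw [scaleZero_apply, Pi.smul_apply]
  by_cases h : i = a.1
  · rw [h]
  · simp [h]

/-- Two real directions are scaled by `ρ`, and each enters the Gram matrix by row and by column. The
lemma compares split metrics with the same tangential part at two points. -/
lemma gram_det_scaleZero {B B' : Cn m →L[ℝ] Cn m →L[ℝ] ℝ} {ρ : ℝ} (hB : ∀ x y, B x y = B y x)
    (hB' : ∀ x y, B' x y = B' y x)
    (h : ∀ x, B' x x = B (scaleZero ρ x) (scaleZero ρ x)) :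
    (gram B' (realBasis m)).det = (ρ ^ 2) ^ 2 * (gram B (realBasis m)).det := by
  have hp : ∀ x y, B' x y = B (scaleZero ρ x) (scaleZero ρ y) := by
    intro x y
    have h1 := h (x + y)
    have h2 := h x
    have h3 := h y
    have h4 := hB (scaleZero ρ x) (scaleZero ρ y)
    have h5 := hB' x y
    simp only [map_add, add_apply] at h1
    linarith
  have h6 : gram B' (realBasis m) = Matrix.diagonal (fun a => if a.1 = 0 then ρ else 1) *
      gram B (realBasis m) * Matrix.diagonal (fun a => if a.1 = 0 then ρ else 1) := by
    ext a b
    rw [Matrix.mul_diagonal, Matrix.diagonal_mul]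
    simp only [gram, Matrix.of_apply, hp, scaleZero_realBasis, map_smul, smul_apply, smul_eq_mul]
    ring
  rw [h6, Matrix.det_mul, Matrix.det_mul, Matrix.det_diagonal, prod_ite_fst_eq_zero]
  ring

section Splitting

variable {B : Cn m →L[ℝ] Cn m →L[ℝ] ℝ}

lemma apply_smul_e₀_self (hs : ∀ x y, B x y = B y x)
    (hJ : ∀ x y, B (Complex.I • x) (Complex.I • y) = B x y) (c : ℂ) :
    B (c • e₀) (c • e₀) = ‖c‖ ^ 2 * B e₀ e₀ := by
  have h1 : B (Complex.I • e₀) e₀ = -B e₀ (Complex.I • e₀) := by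
    rw [← hJ, I_smul_I_smul, map_neg, neg_apply]
  have h2 := hs (Complex.I • e₀) e₀
  have h3 : B e₀ (Complex.I • e₀) = 0 := by linarith
  rw [complex_smul_eq c e₀]
  simp only [map_add, add_apply, map_smul, smul_apply, smul_eq_mul, hJ, h2, h3]
  rw [← Complex.normSq_eq_norm_sq, Complex.normSq_apply]
  ring

/-- The hypothesis also covers `I • w`, so every complex multiple of `e₀` is orthogonal to the
tangential vectors. -/
lemma apply_self_of_mixed (hs : ∀ x y, B x y = B y x)
    (hJ : ∀ x y, B (Complex.I • x) (Complex.I • y) = B x y) (h : ∀ w : Cn m, w 0 = 0 → B e₀ w = 0)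
    (x : Cn m) :
    B x x = ‖x 0‖ ^ 2 * B e₀ e₀ + B (Function.update x 0 0) (Function.update x 0 0) := by
  set w : Cn m := Function.update x 0 0 with hw
  have hw0 : w 0 = 0 := by simp [w]
  have hx : x = x 0 • e₀ + w := by
    ext i
    refine Fin.cases ?_ (fun j => ?_) i <;> simp [w, e₀, Fin.succ_ne_zero]
  have h1 := h w hw0
  have h2 := h (Complex.I • w) (by simp [hw0])
  have h3 : B (Complex.I • e₀) w = 0 := by
    rw [← hJ, I_smul_I_smul, map_neg, neg_apply, h2, neg_zero]
  have h4 : B (x 0 • e₀) w = 0 := by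
    rw [complex_smul_eq]
    simp [h1, h3]
  conv_lhs => rw [hx]
  simp only [map_add, add_apply, hs w (x 0 • e₀), h4, apply_smul_e₀_self hs hJ]
  ring

end Splitting

/-- A Kähler metric with constant tangential part and with the volume form of the model cone metric
is the pull back of the model cone metric under a linear map. -/
theorem exists_linearEquiv_of_tang_const {ω : TwoForm m} {β C : ℝ} (hβ : 0 < β) (hβ1 : β < 1)
    (hω : IsKahlerOn ω (divisorCompl m))
    (hvol : ∀ z ∈ divisorCompl m, (gram (metric ω z) (realBasis m)).det = (‖z 0‖ ^ (2 * β - 2)) ^ 2)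
    (hC : EquivModel (metric ω) β C)
    (hconst : ∀ w : Cn m, w 0 = 0 → ∃ M, ∀ z ∈ divisorCompl m, metric ω z w w = M) :
    ∃ T : Cn m ≃L[ℂ] Cn m, (T '' {z | z 0 = 0} = {z | z 0 = 0}) ∧
      ∀ z ∈ divisorCompl m, ω z = (modelForm m β (T z)).compContinuousLinearMap
        ((T : Cn m →L[ℂ] Cn m).restrictScalars ℝ) := by
  have hg := hω.isKahlerMetricOn
  set g := metric ω with hgdef
  have hmixed : ∀ z ∈ divisorCompl m, ∀ w : Cn m, w 0 = 0 → g z e₀ w = 0 := fun z hz w hw =>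
    metric_mixed_eq_zero hg hβ hβ1 hC (fun z hz w hw x y => by
      obtain ⟨M, hM⟩ := hconst w hw
      exact fderiv_tang_eq_zero hg (realBasis m) hvol hM hz x y) hz hw
  have hsplit : ∀ z ∈ divisorCompl m, ∀ x, g z x x = ‖x 0‖ ^ 2 * g z e₀ e₀ +
      g e₀ (Function.update x 0 0) (Function.update x 0 0) := fun z hz x => by
    obtain ⟨M, hM⟩ := hconst (Function.update x 0 0) (by simp)
    rw [apply_self_of_mixed (hg.symm z hz) (hg.inv z hz) (hmixed z hz), hM z hz, hM e₀ e₀_mem]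
  have he₀ : (e₀ : Cn m) ≠ 0 := fun h => by simpa [e₀] using congrFun h 0
  have hk₀ := hg.pos e₀ e₀_mem e₀ he₀
  set k₀ := g e₀ e₀ e₀ with hk₀def
  -- At `z` and at `e₀` the metric splits with the same tangential block, so the two differ by a
  -- rescaling of `u`; the prescribed determinants fix its factor.
  have hk : ∀ z ∈ divisorCompl m, g z e₀ e₀ = k₀ * ‖z 0‖ ^ (2 * β - 2) := by
    intro z hz
    have hkz := hg.pos z hz e₀ he₀
    set ρ := √(g z e₀ e₀ / k₀) with hρ
    have hρ2 : ρ ^ 2 = g z e₀ e₀ / k₀ := Real.sq_sqrt (by positivity)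
    have h1 := gram_det_scaleZero (ρ := ρ) (hg.symm e₀ e₀_mem) (hg.symm z hz) (fun x => by
      rw [hsplit z hz, hsplit e₀ e₀_mem (scaleZero ρ x), scaleZero_apply, norm_smul, if_pos rfl, mul_pow,
        Real.norm_eq_abs, sq_abs, hρ2]
      have : Function.update (scaleZero ρ x) 0 0 = Function.update x 0 0 := by
        ext i
        by_cases hi : i = 0
        · subst hi; simp
        · simp [hi, scaleZero_apply]
      rw [this, ← hk₀def]
      field_simp)
    rw [hvol z hz, hvol e₀ e₀_mem, hρ2] at h1
    have h2 : (e₀ : Cn m) 0 = 1 := by simp [e₀]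
    rw [h2, norm_one, Real.one_rpow, one_pow, mul_one] at h1
    have h3 : 0 < ‖z 0‖ := norm_pos_iff.mpr hz
    have h4 := (sq_eq_sq₀ (by positivity) (by positivity)).mp h1
    rw [h4]
    field_simp
  obtain ⟨S, hS⟩ := exists_linearEquiv_sum_sq (hg.symm e₀ e₀_mem) (hg.inv e₀ e₀_mem)
    (hg.pos e₀ e₀_mem)
  -- Chosen so that `u ↦ l u` pulls `|u|^(2β-2) |du|²` back to `k₀` times itself: `l^(2β) = k₀`.
  set l : ℝ := k₀ ^ (2 * β)⁻¹ with hl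
  have hlpos : 0 < l := by positivity
  have hl0 : (l : ℂ) ≠ 0 := by exact_mod_cast hlpos.ne'
  let T₀ : Cn m ≃ₗ[ℂ] Cn m :=
    { toFun := fun x => Fin.cons (l * x 0) (S (Fin.tail x))
      invFun := fun x => Fin.cons ((l : ℂ)⁻¹ * x 0) (S.symm (Fin.tail x))
      map_add' := fun x y => by
        have : Fin.tail (x + y) = Fin.tail x + Fin.tail y := rfl
        rw [this, map_add]
        ext i; refine Fin.cases ?_ (fun j => ?_) i <;> simp [mul_add]
      map_smul' := fun c x => by
        have : Fin.tail (c • x) = c • Fin.tail x := rfl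
        rw [this, map_smul]
        ext i; refine Fin.cases ?_ (fun j => ?_) i <;> simp [mul_left_comm]
      left_inv := fun x => by
        simp only [Fin.cons_zero, Fin.tail_cons, LinearEquiv.symm_apply_apply]
        rw [inv_mul_cancel_left₀ hl0, Fin.cons_self_tail]
      right_inv := fun x => by
        simp only [Fin.cons_zero, Fin.tail_cons, LinearEquiv.apply_symm_apply]
        rw [mul_inv_cancel_left₀ hl0, Fin.cons_self_tail] }
  have hT0 : ∀ x, T₀ x 0 = l * x 0 := fun x => rfl
  have hTs : ∀ x i, T₀ x (Fin.succ i) = S (Fin.tail x) i := fun x i => rfl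
  refine ⟨T₀.toContinuousLinearEquiv, ?_, ?_⟩
  · ext z
    constructor
    · rintro ⟨x, hx, rfl⟩
      have hx : x 0 = 0 := hx
      change T₀ x 0 = 0
      rw [hT0, hx, mul_zero]
    · intro hz
      have hz : z 0 = 0 := hz
      refine ⟨T₀.symm z, ?_, T₀.apply_symm_apply z⟩
      change (l : ℂ)⁻¹ * z 0 = 0
      rw [hz, mul_zero]
  · intro z hz
    have hcomp : ∀ x y : Cn m, (modelForm m β (T₀ z)).compContinuousLinearMap
        (((T₀.toContinuousLinearEquiv : Cn m ≃L[ℂ] Cn m) : Cn m →L[ℂ] Cn m).restrictScalars ℝ)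
          ![x, y] = modelForm m β (T₀ z) ![T₀ x, T₀ y] := fun x y => by
      rw [ContinuousAlternatingMap.compContinuousLinearMap_apply]
      congr 1
      ext i; fin_cases i <;> rfl
    have hIm : ∀ a b : ℂ, ((starRingEnd ℂ) (Complex.I * a) * (Complex.I * b)).im =
        ((starRingEnd ℂ) a * b).im := fun a b => by simp
    refine form_ext (hω.type_one_one z hz) (fun x y => ?_) fun x => ?_
    · refine (hcomp _ _).trans (Eq.trans ?_ (hcomp _ _).symm)
      rw [map_smul, map_smul, modelForm_apply, modelForm_apply]
      simp only [Pi.smul_apply, smul_eq_mul, hIm]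
    · have h1 : riem ((modelForm m β (T₀ z)).compContinuousLinearMap
        (((T₀.toContinuousLinearEquiv : Cn m ≃L[ℂ] Cn m) : Cn m →L[ℂ] Cn m).restrictScalars ℝ))
          x x = modelQ β (T₀ z) (T₀ x) := by
        refine (hcomp _ _).trans ?_
        rw [map_smul, ← riem_modelForm_self]
        rfl
      refine Eq.trans ?_ h1.symm
      have h2 := hsplit z hz x
      have h3 : (Function.update x 0 0 : Cn m) = Fin.cons 0 (Fin.tail x) := by
        conv_lhs => rw [← Fin.cons_self_tail x]
        rw [Fin.update_cons_zero]
      rw [h3, hS, hk z hz] at h2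
      refine h2.trans ?_
      have h4 : 0 < ‖z 0‖ := norm_pos_iff.mpr hz
      rw [modelQ, sqn_tang, hT0, hT0]
      simp only [hTs]
      rw [norm_mul, norm_mul, Complex.norm_real, Real.norm_of_nonneg hlpos.le,
        Real.mul_rpow hlpos.le h4.le]
      have h5 : l ^ (2 * β - 2) * l ^ 2 = k₀ := by
        rw [← Real.rpow_two, ← Real.rpow_add hlpos, hl, ← Real.rpow_mul hk₀.le]
        rw [show (2 * β)⁻¹ * (2 * β - 2 + 2) = 1 by field_simp; ring, Real.rpow_one]
      rw [← h5]
      ring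

end KahlerCone
end

/-! ### Local bounds of the metric and lower bounds for lengths. -/

noncomputable section

namespace KahlerCone

open Filter Topology Asymptotics

variable {m : ℕ}

set_option maxSynthPendingDepth 3

/-- Uniform bounds for a metric tensor and its derivatives on the set `s`. -/
structure MetricBounds (g : Cn m → Cn m →L[ℝ] Cn m →L[ℝ] ℝ) (s : Set (Cn m)) (M : ℝ) : Prop where
  one_le : 1 ≤ M
  lower : ∀ z ∈ s, ∀ v, ‖v‖ ^ 2 ≤ M * g z v v
  upper : ∀ z ∈ s, ‖g z‖ ≤ M
  deriv : ∀ z ∈ s, ‖fderiv ℝ g z‖ ≤ M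
  taylor : ∀ z ∈ s, ∀ z' ∈ s, ‖g z' - g z - fderiv ℝ g z (z' - z)‖ ≤ M * ‖z' - z‖ ^ 2

lemma exists_metricBounds {g : Cn m → Cn m →L[ℝ] Cn m →L[ℝ] ℝ} {β C : ℝ}
    (hg : IsKahlerMetricOn g (divisorCompl m)) (hC : EquivModel g β C) {z₀ : Cn m}
    (hz₀ : z₀ ∈ divisorCompl m) :
    ∃ R > 0, ∃ M, Metric.closedBall z₀ R ⊆ divisorCompl m ∧
      MetricBounds g (Metric.closedBall z₀ R) M := by
  obtain ⟨R, hR, hRU⟩ := Metric.nhds_basis_closedBall.mem_iff.mp (isOpen_divisorCompl.mem_nhds hz₀)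
  have hK : IsCompact (Metric.closedBall z₀ R) := isCompact_closedBall z₀ R
  obtain ⟨l, hl, hlb⟩ := exists_bounds_of_isCompact (g := g) hC hK hRU
  have c0 : ContinuousOn g (Metric.closedBall z₀ R) := fun z hz =>
    (hg.contDiffAt (hRU hz)).continuousAt.continuousWithinAt
  have c1 : ContinuousOn (fderiv ℝ g) (Metric.closedBall z₀ R) := fun z hz =>
    (hg.contDiffAt_fderiv (hRU hz)).continuousAt.continuousWithinAt
  have c2 : ContinuousOn (snd g) (Metric.closedBall z₀ R) := fun z hz =>
    ((hg.contDiffAt_fderiv (hRU hz)).fderiv_right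
      (m := ((⊤ : ℕ∞) : WithTop ℕ∞)) (by simp)).continuousAt.continuousWithinAt
  obtain ⟨M₀, h0⟩ := hK.exists_bound_of_continuousOn c0
  obtain ⟨M₁, h1⟩ := hK.exists_bound_of_continuousOn c1
  obtain ⟨M₂, h2⟩ := hK.exists_bound_of_continuousOn
    (E := Cn m →L[ℝ] Cn m →L[ℝ] Cn m →L[ℝ] Cn m →L[ℝ] ℝ) c2
  refine ⟨R, hR, max 1 (max l⁻¹ (max M₀ (max M₁ M₂))), hRU, le_max_left _ _, ?_, ?_, ?_, ?_⟩
  · intro z hz v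
    have h3 := (hlb z hz v).1
    have h4 := norm_sq_le_sqn v
    have h5 : l⁻¹ ≤ max 1 (max l⁻¹ (max M₀ (max M₁ M₂))) := by simp
    have h6 : 0 ≤ g z v v := le_trans (mul_nonneg hl.le (sqn_nonneg _ _)) h3
    refine h4.trans (le_trans ?_ (mul_le_mul_of_nonneg_right h5 h6))
    rw [le_inv_mul_iff₀ hl]
    exact h3
  · exact fun z hz => (h0 z hz).trans (by simp)
  · exact fun z hz => (h1 z hz).trans (by simp)
  · intro z hz z' hz'
    have hcv : Convex ℝ (Metric.closedBall z₀ R) := convex_closedBall z₀ R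
    have hseg : segment ℝ z z' ⊆ Metric.closedBall z₀ R := hcv.segment_subset hz hz'
    -- The bound on the second derivative controls the variation of the first along the segment; the
    -- mean value inequality then yields the quadratic Taylor remainder.
    have hM : ∀ w ∈ segment ℝ z z', ‖fderiv ℝ g w - fderiv ℝ g z‖ ≤ M₂ * ‖z' - z‖ := by
      intro w hw
      have h3 := hcv.norm_image_sub_le_of_norm_hasFDerivWithin_le (f := fderiv ℝ g) (f' := snd g)
        (fun y hy => (hg.hasFDerivAt_fderiv (hRU hy)).hasFDerivWithinAt) h2 hz (hseg hw)
      refine h3.trans (mul_le_mul_of_nonneg_left ?_ ((norm_nonneg _).trans (h2 z hz)))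
      obtain ⟨t, ht, rfl⟩ := (segment_eq_image' ℝ z z').subset hw
      rw [add_sub_cancel_left, norm_smul, Real.norm_of_nonneg ht.1]
      exact mul_le_of_le_one_left (norm_nonneg _) ht.2
    have h4 := (convex_segment z z').norm_image_sub_le_of_norm_hasFDerivWithin_le' (f := g)
      (fun y hy => (hg.hasFDerivAt (hRU (hseg hy))).hasFDerivWithinAt) hM
      (left_mem_segment ℝ z z') (right_mem_segment ℝ z z')
    refine h4.trans ?_
    rw [mul_assoc, ← sq]
    gcongr
    simp

section Length

variable {ω : TwoForm m} {γ : ℝ → Cn m}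

/-- A function with bounded gradient bounds the length of a path from below. -/
lemma abs_sub_le_of_pathLength_le (hγ : ContDiffOn ℝ 1 γ (Set.Icc 0 1)) {F : Cn m → ℝ}
    {F' : Cn m → Cn m →L[ℝ] ℝ} (hF : ∀ z, HasFDerivAt F (F' z) z) (hF' : Continuous F')
    {T κ ρ : ℝ} (hT : T ∈ Set.Icc (0 : ℝ) 1) (hκ : 0 ≤ κ) (hρ : 0 ≤ ρ)
    (h : ∀ t ∈ Set.Ioo 0 T, ∀ v, F' (γ t) v ^ 2 ≤ κ ^ 2 * metric ω (γ t) v v)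
    (hlen : pathLength ω γ ≤ ENNReal.ofReal ρ) : |F (γ T) - F (γ 0)| ≤ κ * ρ := by
  have hsub : Set.Icc 0 T ⊆ Set.Icc (0 : ℝ) 1 := Set.Icc_subset_Icc_right hT.2
  have hFc : Continuous F := continuous_iff_continuousAt.mpr fun z => (hF z).continuousAt
  set γ' := derivWithin γ (Set.Icc 0 1) with hγ'
  have hγ'c : ContinuousOn γ' (Set.Icc 0 1) :=
    hγ.continuousOn_derivWithin (uniqueDiffOn_Icc zero_lt_one) le_rfl
  have hc' : ContinuousOn (fun t => F' (γ t) (γ' t)) (Set.Icc 0 T) :=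
    (hF'.comp_continuousOn (hγ.continuousOn.mono hsub)).clm_apply (hγ'c.mono hsub)
  have hd : ∀ t ∈ Set.Ioo 0 T, HasDerivAt (fun t => F (γ t)) (F' (γ t) (γ' t)) t := by
    intro t ht
    have ht1 : Set.Icc (0 : ℝ) 1 ∈ 𝓝 t := Icc_mem_nhds ht.1 (ht.2.trans_le hT.2)
    have h1 : HasDerivAt γ (γ' t) t :=
      ((hγ.differentiableOn one_ne_zero t (hsub ⟨ht.1.le, ht.2.le⟩)).hasDerivWithinAt).hasDerivAt ht1
    exact (hF (γ t)).comp_hasDerivAt t h1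
  have hint := intervalIntegral.integral_eq_sub_of_hasDerivAt_of_le hT.1
    (hFc.comp_continuousOn (hγ.continuousOn.mono hsub)) hd
    (ContinuousOn.intervalIntegrable (by rwa [Set.uIcc_of_le hT.1]))
  have h2 : ENNReal.ofReal |F (γ T) - F (γ 0)| ≤ ENNReal.ofReal (κ * ρ) := by
    rw [← Real.enorm_eq_ofReal_abs]
    change ‖(F ∘ γ) T - (F ∘ γ) 0‖ₑ ≤ _
    rw [← hint, intervalIntegral.integral_of_le hT.1]
    calc _ ≤ ∫⁻ t in Set.Ioc 0 T, ‖F' (γ t) (γ' t)‖ₑ :=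
          MeasureTheory.enorm_integral_le_lintegral_enorm _
      _ = ∫⁻ t in Set.Ioo 0 T, ‖F' (γ t) (γ' t)‖ₑ :=
          MeasureTheory.setLIntegral_congr MeasureTheory.Ioo_ae_eq_Ioc.symm
      _ ≤ ∫⁻ t in Set.Ioo 0 T, ENNReal.ofReal κ * ENNReal.ofReal √(riem (ω (γ t)) (γ' t) (γ' t)) := by
          refine MeasureTheory.setLIntegral_mono' measurableSet_Ioo fun t ht => ?_
          rw [← ENNReal.ofReal_mul hκ, Real.enorm_eq_ofReal_abs]
          refine ENNReal.ofReal_le_ofReal ?_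
          have h3 := h t ht (γ' t)
          have h4 : |F' (γ t) (γ' t)| = √(F' (γ t) (γ' t) ^ 2) := (Real.sqrt_sq_eq_abs _).symm
          rw [h4]
          refine (Real.sqrt_le_sqrt h3).trans ?_
          rw [Real.sqrt_mul (sq_nonneg _), Real.sqrt_sq hκ]
          rfl
      _ = ENNReal.ofReal κ * ∫⁻ t in Set.Ioo 0 T, ENNReal.ofReal √(riem (ω (γ t)) (γ' t) (γ' t)) :=
          MeasureTheory.lintegral_const_mul' _ _ ENNReal.ofReal_ne_top
      _ ≤ ENNReal.ofReal κ * pathLength ω γ := by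
          gcongr
          exact MeasureTheory.lintegral_mono_set (Set.Ioo_subset_Icc_self.trans hsub)
      _ ≤ ENNReal.ofReal κ * ENNReal.ofReal ρ := by gcongr
      _ = _ := (ENNReal.ofReal_mul hκ).symm
  exact (ENNReal.ofReal_le_ofReal_iff (by positivity)).mp h2

/-- A path of small length stays in a ball on which the metric is bounded from below. -/
lemma norm_sub_le_of_pathLength_le (hγ : ContDiffOn ℝ 1 γ (Set.Icc 0 1)) {x : Cn m} {R M ρ : ℝ}
    (hM : 1 ≤ M) (hρ : 0 ≤ ρ)
    (hb : ∀ z ∈ Metric.closedBall x R, ∀ v, ‖v‖ ^ 2 ≤ M * metric ω z v v)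
    (h0 : ‖γ 0 - x‖ + M * ρ < R) (hlen : pathLength ω γ ≤ ENNReal.ofReal ρ) :
    ∀ t ∈ Set.Icc (0 : ℝ) 1, ‖γ t - γ 0‖ ≤ M * ρ := by
  have key : ∀ T ∈ Set.Icc (0 : ℝ) 1, (∀ t ∈ Set.Ioo 0 T, ‖γ t - x‖ ≤ R) →
      ‖γ T - γ 0‖ ≤ M * ρ := by
    intro T hT hin
    -- A functional of norm at most one which attains the norm of the displacement serves as the
    -- function with bounded gradient.
    obtain ⟨ℓ, hℓ, hℓ'⟩ := exists_dual_vector'' ℝ (γ T - γ 0)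
    have h1 := abs_sub_le_of_pathLength_le (ω := ω) hγ (F := fun z => ℓ z) (F' := fun _ => ℓ)
      (fun z => ℓ.hasFDerivAt) continuous_const hT (κ := M) (by linarith) hρ (fun t ht v => by
        have h2 := hb (γ t) (by rw [mem_closedBall_iff_norm]; exact hin t ht) v
        have h3 : |ℓ v| ≤ ‖v‖ := by
          refine (ℓ.le_opNorm v).trans ?_
          exact mul_le_of_le_one_left (norm_nonneg _) hℓ
        have h4 : ℓ v ^ 2 ≤ ‖v‖ ^ 2 := sq_le_sq.mpr (by rwa [abs_norm])
        have h5 : 0 ≤ M * metric ω (γ t) v v := (sq_nonneg _).trans h2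
        nlinarith) hlen
    rw [← map_sub, hℓ'] at h1
    simpa using h1
  have hMρ : 0 ≤ M * ρ := by positivity
  -- At the first time the path reaches distance `R`, the estimate `key` for earlier times already
  -- gives a distance smaller than `R`.
  have hall : ∀ t ∈ Set.Icc (0 : ℝ) 1, ‖γ t - x‖ ≤ R := by
    by_contra! hcon
    obtain ⟨t₁, ht₁, hlt⟩ := hcon
    set S := {t ∈ Set.Icc (0 : ℝ) 1 | R ≤ ‖γ t - x‖} with hS
    have hcont : ContinuousOn (fun t => ‖γ t - x‖) (Set.Icc 0 1) :=
      (hγ.continuousOn.sub continuousOn_const).norm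
    have hScl : IsCompact S := by
      have : S = Set.Icc (0 : ℝ) 1 ∩ (fun t => ‖γ t - x‖) ⁻¹' Set.Ici R := rfl
      rw [this]
      exact isCompact_Icc.of_isClosed_subset
        (hcont.preimage_isClosed_of_isClosed isClosed_Icc isClosed_Ici) Set.inter_subset_left
    have hSm := hScl.sInf_mem ⟨t₁, ht₁, hlt.le⟩
    have h1 := key (sInf S) hSm.1 (fun t ht => by
      by_contra! hc
      exact absurd (csInf_le hScl.bddBelow ⟨⟨ht.1.le, ht.2.le.trans hSm.1.2⟩, hc.le⟩)
        (not_le.mpr ht.2))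
    have h2 := hSm.2
    have h3 : ‖γ (sInf S) - x‖ ≤ ‖γ (sInf S) - γ 0‖ + ‖γ 0 - x‖ := norm_sub_le_norm_sub_add_norm_sub _ _ _
    linarith
  exact fun t ht => key t ht fun s hs => hall s ⟨hs.1.le, hs.2.le.trans ht.2⟩

end Length

end KahlerCone
end

/-! ### The distance near the diagonal: lower bound by calibration. -/

noncomputable section

namespace KahlerCone

open Filter Topology Asymptotics

variable {m : ℕ}

set_option maxSynthPendingDepth 3

section Jet

variable {B : Cn m →L[ℝ] Cn m →L[ℝ] ℝ} {D : Cn m →L[ℝ] Cn m →L[ℝ] Cn m →L[ℝ] ℝ} {M : ℝ}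

/-- Riesz representation for a positive bilinear form. -/
lemma exists_representer (hM : 1 ≤ M) (hlow : ∀ v, ‖v‖ ^ 2 ≤ M * B v v) (ℓ : Cn m →ₗ[ℝ] ℝ) {K : ℝ}
    (hK : ∀ y, ℓ y ≤ K * ‖y‖) : ∃ Γ, (∀ y, B Γ y = ℓ y) ∧ ‖Γ‖ ≤ M * K := by
  let T : Cn m →ₗ[ℝ] Module.Dual ℝ (Cn m) :=
    { toFun := fun x => (B x : Cn m →ₗ[ℝ] ℝ)
      map_add' := fun x y => by ext; simp
      map_smul' := fun c x => by ext; simp }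
  have hT : Function.Injective T := by
    rw [injective_iff_map_eq_zero]
    intro x hx
    have h1 : B x x = 0 := LinearMap.congr_fun hx x
    have h2 := hlow x
    rw [h1, mul_zero] at h2
    exact norm_eq_zero.mp (pow_eq_zero_iff two_ne_zero |>.mp (le_antisymm h2 (sq_nonneg _)))
  obtain ⟨Γ, hΓ⟩ := (LinearMap.injective_iff_surjective_of_finrank_eq_finrank
    (Subspace.dual_finrank_eq (K := ℝ) (V := Cn m)).symm).mp hT ℓ
  have hΓ' : ∀ y, B Γ y = ℓ y := fun y => LinearMap.congr_fun hΓ y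
  refine ⟨Γ, hΓ', ?_⟩
  have h1 := hlow Γ
  rw [hΓ'] at h1
  have h2 := h1.trans (mul_le_mul_of_nonneg_left (hK Γ) (by linarith))
  rcases (norm_nonneg Γ).eq_or_lt with h3 | h3
  · have h4 : 0 ≤ K := by
      by_cases hne : ∃ y : Cn m, ‖y‖ ≠ 0
      · obtain ⟨y, hy⟩ := hne
        have h5 := hK y
        have h6 := hK (-y)
        rw [map_neg, norm_neg] at h6
        have h7 : 0 < ‖y‖ := lt_of_le_of_ne (norm_nonneg _) (Ne.symm hy)
        nlinarith
      · push Not at hne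
        have := hne (e₀ : Cn m)
        have h8 : (e₀ : Cn m) = 0 := norm_eq_zero.mp this
        have := congrFun h8 0
        simp [e₀] at this
    rw [← h3]; positivity
  · nlinarith

lemma trilinear_le (hD : ‖D‖ ≤ M) (x y z : Cn m) : |D x y z| ≤ M * ‖x‖ * ‖y‖ * ‖z‖ := by
  have h1 : ‖D x y z‖ ≤ ‖D x y‖ * ‖z‖ := (D x y).le_opNorm z
  have h2 : ‖D x y‖ ≤ ‖D x‖ * ‖y‖ := (D x).le_opNorm y
  have h3 : ‖D x‖ ≤ ‖D‖ * ‖x‖ := D.le_opNorm x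
  rw [← Real.norm_eq_abs]
  calc _ ≤ ‖D x y‖ * ‖z‖ := h1
    _ ≤ ‖D‖ * ‖x‖ * ‖y‖ * ‖z‖ := by gcongr; exact h2.trans (by gcongr)
    _ ≤ _ := by gcongr

lemma bilinear_le (hB : ‖B‖ ≤ M) (x y : Cn m) : |B x y| ≤ M * ‖x‖ * ‖y‖ := by
  have h2 : ‖B x y‖ ≤ ‖B x‖ * ‖y‖ := (B x).le_opNorm y
  have h3 : ‖B x‖ ≤ ‖B‖ * ‖x‖ := B.le_opNorm x
  rw [← Real.norm_eq_abs]
  calc _ ≤ ‖B x‖ * ‖y‖ := h2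
    _ ≤ ‖B‖ * ‖x‖ * ‖y‖ := by gcongr
    _ ≤ _ := by gcongr

/-- The third order Taylor polynomial of `(a, b) ↦ d(x + a, x + b)²`, for the distance of a metric
with value `B` and derivative `D` at `x`. -/
def distJet (B : Cn m →L[ℝ] Cn m →L[ℝ] ℝ) (D : Cn m →L[ℝ] Cn m →L[ℝ] Cn m →L[ℝ] ℝ)
    (a b : Cn m) : ℝ := B (b - a) (b - a) + 1 / 2 * D (a + b) (b - a) (b - a)

lemma distJet_le (hM : 1 ≤ M) (hB : ‖B‖ ≤ M) (hD : ‖D‖ ≤ M) {ε : ℝ} (hε : ε ≤ 1) {a b : Cn m}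
    (ha : ‖a‖ ≤ ε) (hb : ‖b‖ ≤ ε) : distJet B D a b ≤ 8 * M * ε ^ 2 := by
  have h1 := le_of_abs_le (bilinear_le hB (b - a) (b - a))
  have h2 := le_of_abs_le (trilinear_le hD (a + b) (b - a) (b - a))
  have h3 : ‖b - a‖ ≤ 2 * ε := (norm_sub_le _ _).trans (by linarith)
  have h4 : ‖a + b‖ ≤ 2 * ε := (norm_add_le _ _).trans (by linarith)
  have hε0 : 0 ≤ ε := (norm_nonneg _).trans ha
  have h5 : M * ‖b - a‖ * ‖b - a‖ ≤ M * (2 * ε) * (2 * ε) := by gcongr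
  have h6 : M * ‖a + b‖ * ‖b - a‖ * ‖b - a‖ ≤ M * (2 * ε) * (2 * ε) * (2 * ε) := by gcongr
  have h7 : M * ε ^ 2 * ε ≤ M * ε ^ 2 * 1 := by gcongr
  unfold distJet
  nlinarith

/-- A function whose gradient at `x` is `k`, and whose gradient has almost constant length. -/
def calib (B : Cn m →L[ℝ] Cn m →L[ℝ] ℝ) (D : Cn m →L[ℝ] Cn m →L[ℝ] Cn m →L[ℝ] ℝ)
    (x k z : Cn m) : ℝ :=
  B k (z - x) + 1 / 2 * D (z - x) (z - x) k - 1 / 4 * D k (z - x) (z - x)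

/-- The derivative of `calib`. -/
def calibDeriv (B : Cn m →L[ℝ] Cn m →L[ℝ] ℝ) (D : Cn m →L[ℝ] Cn m →L[ℝ] Cn m →L[ℝ] ℝ)
    (x k z : Cn m) : Cn m →L[ℝ] ℝ :=
  B k + (1 / 2 : ℝ) • (D (z - x)).flip k + (1 / 2 : ℝ) • ((D.flip (z - x)).flip k)
    - (1 / 4 : ℝ) • D k (z - x) - (1 / 4 : ℝ) • (D k).flip (z - x)

lemma calibDeriv_apply (x k z v : Cn m) : calibDeriv B D x k z v =
    B k v + 1 / 2 * D (z - x) v k + 1 / 2 * D v (z - x) k - 1 / 4 * D k (z - x) v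
      - 1 / 4 * D k v (z - x) := by
  simp [calibDeriv]

lemma continuous_calibDeriv (x k : Cn m) : Continuous (calibDeriv B D x k) := by
  rw [continuous_clm_apply]
  intro v
  simp only [calibDeriv_apply]
  have h1 : Continuous fun z : Cn m => z - x := by fun_prop
  have h2 : Continuous fun z : Cn m => D (z - x) v k :=
    ((D.continuous.comp h1).clm_apply continuous_const).clm_apply continuous_const
  have h3 : Continuous fun z : Cn m => D v (z - x) k :=
    ((D v).continuous.comp h1).clm_apply continuous_const
  have h4 : Continuous fun z : Cn m => D k (z - x) v :=
    ((D k).continuous.comp h1).clm_apply continuous_const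
  have h5 : Continuous fun z : Cn m => D k v (z - x) := (D k v).continuous.comp h1
  fun_prop

lemma hasFDerivAt_calib (x k z : Cn m) :
    HasFDerivAt (calib B D x k) (calibDeriv B D x k z) z := by
  have h1 : HasFDerivAt (fun z : Cn m => z - x) (ContinuousLinearMap.id ℝ (Cn m)) z :=
    (hasFDerivAt_id z).sub_const x
  have h2 : HasFDerivAt (fun z => B k (z - x)) _ z := (B k).hasFDerivAt.comp z h1
  have h3 : HasFDerivAt (fun z => D (z - x) (z - x)) _ z :=
    (D.hasFDerivAt.comp z h1).clm_apply h1
  have h4 : HasFDerivAt (fun z => D (z - x) (z - x) k) _ z :=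
    h3.clm_apply (hasFDerivAt_const k z)
  have h5 : HasFDerivAt (fun z => D k (z - x) (z - x)) _ z :=
    ((D k).hasFDerivAt.comp z h1).clm_apply h1
  have h6 := (h2.add (h4.const_mul (1 / 2))).sub (h5.const_mul (1 / 4))
  refine h6.congr_fderiv ?_
  ext v
  simp [calibDeriv]
  ring

/-- The coefficient `1/4` is half of that in `distJet`, because this difference is later squared and
divided by `B(b - a, b - a)`. -/
lemma calib_sub (hDs : ∀ a x y, D a x y = D a y x) (x a b : Cn m) :
    calib B D x (b - a) (x + b) - calib B D x (b - a) (x + a) =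
      B (b - a) (b - a) + 1 / 4 * D (a + b) (b - a) (b - a) := by
  simp only [calib, add_sub_cancel_left, map_sub, map_add, sub_apply, add_apply]
  have h1 := hDs a a b
  have h2 := hDs b a b
  linarith

/-- The derivative is `B(k, v + Γ)`, where `Γ` is the Christoffel vector of `z - x` and `v` for the
jet `(B, D)`. Cauchy–Schwarz leaves `B(v + Γ, v + Γ)`, which agrees with the first-order expansion
of the metric at `z` up to the quadratic term `B(Γ, Γ)`. -/
lemma calibDeriv_sq_le (hM : 1 ≤ M) (hBs : ∀ x y, B x y = B y x)
    (hDs : ∀ a x y, D a x y = D a y x) (hlow : ∀ v, ‖v‖ ^ 2 ≤ M * B v v) (hB : ‖B‖ ≤ M)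
    (hD : ‖D‖ ≤ M) (x k z v : Cn m) :
    calibDeriv B D x k z v ^ 2 ≤
      B k k * (B v v + D (z - x) v v + 3 * M ^ 5 * ‖z - x‖ ^ 2 * ‖v‖ ^ 2) := by
  set c := z - x with hc
  let ℓ : Cn m →ₗ[ℝ] ℝ :=
    { toFun := fun y => 1 / 2 * (D c v y + D v c y - D y c v)
      map_add' := fun y y' => by simp only [map_add, add_apply]; ring
      map_smul' := fun r y => by
        simp only [map_smul, smul_apply, smul_eq_mul, RingHom.id_apply]; ring }
  obtain ⟨Γ, hΓ, hΓn⟩ := exists_representer hM hlow ℓ (K := 3 / 2 * M * ‖c‖ * ‖v‖) (fun y => by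
    have h1 := le_of_abs_le (trilinear_le hD c v y)
    have h2 := le_of_abs_le (trilinear_le hD v c y)
    have h3 := neg_le_of_abs_le (trilinear_le hD y c v)
    change 1 / 2 * (D c v y + D v c y - D y c v) ≤ _
    linarith)
  have hΓ' : ∀ y, B Γ y = 1 / 2 * (D c v y + D v c y - D y c v) := hΓ
  have hpos : ∀ y, 0 ≤ B y y := fun y => by
    have := (sq_nonneg _).trans (hlow y)
    exact nonneg_of_mul_nonneg_right this (by linarith)
  have h1 := metric_cauchy hBs hpos k (v + Γ)
  have h2 : B k (v + Γ) = calibDeriv B D x k z v := by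
    rw [calibDeriv_apply, map_add, hBs k Γ, hΓ', hDs k v]
    ring
  have h3 : B (v + Γ) (v + Γ) = B v v + D c v v + B Γ Γ := by
    simp only [map_add, add_apply]
    rw [hBs v Γ, hΓ']
    ring
  have h4 : B Γ Γ ≤ 3 * M ^ 5 * ‖c‖ ^ 2 * ‖v‖ ^ 2 := by
    calc B Γ Γ ≤ M * ‖Γ‖ * ‖Γ‖ := le_of_abs_le (bilinear_le hB Γ Γ)
      _ ≤ M * (M * (3 / 2 * M * ‖c‖ * ‖v‖)) * (M * (3 / 2 * M * ‖c‖ * ‖v‖)) := by gcongr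
      _ = 9 / 4 * (M ^ 5 * ‖c‖ ^ 2 * ‖v‖ ^ 2) := by ring
      _ ≤ 3 * (M ^ 5 * ‖c‖ ^ 2 * ‖v‖ ^ 2) := by gcongr; norm_num
      _ = _ := by ring
  rw [← h2]
  refine h1.trans (mul_le_mul_of_nonneg_left ?_ (hpos k))
  rw [h3]
  linarith

end Jet

section Distance

variable {ω : TwoForm m} {d : Cn m → Cn m → ℝ} {x : Cn m} {R M : ℝ}

/-- A short path stays near `x`, where the gradient of `calib` has length at most `√(B(k, k))` up to
a relative error `O(ε²)`. The increment of `calib` along the path then bounds its length from below.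
-/
lemma distJet_le_of_path (hb : MetricBounds (metric ω) (Metric.closedBall x R) M)
    (hs : ∀ u v, metric ω x u v = metric ω x v u)
    (hds : ∀ a u v, fderiv ℝ (metric ω) x a u v = fderiv ℝ (metric ω) x a v u)
    {ε : ℝ} (hε : 0 < ε) (hε1 : ε ≤ 1) (hεR : 4 * M ^ 2 * ε < R) {a b : Cn m} (ha : ‖a‖ ≤ ε)
    (hbε : ‖b‖ ≤ ε) {γ : ℝ → Cn m} (hγ : ContDiffOn ℝ 1 γ (Set.Icc 0 1)) (h0 : γ 0 = x + a)
    (h1 : γ 1 = x + b) {ρ : ℝ} (hρ : 0 ≤ ρ) (hlen : pathLength ω γ ≤ ENNReal.ofReal ρ) :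
    distJet (metric ω x) (fderiv ℝ (metric ω) x) a b ≤ (1 + 64 * M ^ 10 * ε ^ 2) * ρ ^ 2 := by
  have hM := hb.one_le
  have hM0 : 0 < M := by linarith
  have hR0 : 0 ≤ R := le_trans (by positivity) hεR.le
  have hxs : x ∈ Metric.closedBall x R := Metric.mem_closedBall_self hR0
  set B := metric ω x with hB
  set D := fderiv ℝ (metric ω) x with hD
  have hBn : ‖B‖ ≤ M := hb.upper x hxs
  have hDn : ‖D‖ ≤ M := hb.deriv x hxs
  have hlow : ∀ v, ‖v‖ ^ 2 ≤ M * B v v := hb.lower x hxs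
  -- For long paths the crude bound of `distJet` by `8 M ε²` suffices.
  by_cases hbig : 3 * M * ε ≤ ρ
  · have h2 := distJet_le hM hBn hDn hε1 ha hbε
    have h3 : (3 * M * ε) ^ 2 ≤ ρ ^ 2 := by gcongr
    have h4 : 8 * M * ε ^ 2 ≤ (3 * M * ε) ^ 2 := by
      have : M * ε ^ 2 * 1 ≤ M * ε ^ 2 * M := by gcongr
      nlinarith [sq_nonneg ε]
    have h5 : 0 ≤ 64 * M ^ 10 * ε ^ 2 * ρ ^ 2 := by positivity
    linarith
  push Not at hbig
  have hMM : M * ρ ≤ 3 * M ^ 2 * ε := by nlinarith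
  have hεM : ε ≤ M ^ 2 * ε := le_mul_of_one_le_left hε.le (one_le_pow₀ hM)
  have hstay := norm_sub_le_of_pathLength_le hγ hM hρ (fun z hz => hb.lower z hz)
    (by rw [h0, add_sub_cancel_left]; linarith) hlen
  have hball : ∀ t ∈ Set.Icc (0 : ℝ) 1, ‖γ t - x‖ ≤ 4 * M ^ 2 * ε := by
    intro t ht
    have h2 := hstay t ht
    have h3 : ‖γ t - x‖ ≤ ‖γ t - γ 0‖ + ‖γ 0 - x‖ := norm_sub_le_norm_sub_add_norm_sub _ _ _
    rw [h0, add_sub_cancel_left] at h3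
    rw [h0] at h2
    linarith
  set k := b - a with hk
  have hpos : ∀ y, 0 ≤ B y y := fun y =>
    nonneg_of_mul_nonneg_right ((sq_nonneg _).trans (hlow y)) hM0
  have hmain := abs_sub_le_of_pathLength_le (ω := ω) hγ (hasFDerivAt_calib (B := B) (D := D) x k)
    (continuous_calibDeriv x k) (T := 1) (by simp)
    (Real.sqrt_nonneg (B k k * (1 + 64 * M ^ 10 * ε ^ 2))) hρ (fun t ht v => by
      rw [Real.sq_sqrt (mul_nonneg (hpos k) (by positivity)), mul_assoc]
      refine (calibDeriv_sq_le hM hs hds hlow hBn hDn x k (γ t) v).trans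
        (mul_le_mul_of_nonneg_left ?_ (hpos k))
      have hbt := hball t ⟨ht.1.le, ht.2.le⟩
      have hts : γ t ∈ Metric.closedBall x R := by
        rw [mem_closedBall_iff_norm]; exact hbt.trans hεR.le
      have h2 := hb.taylor x hxs (γ t) hts
      have h3 := neg_le_of_abs_le (bilinear_le h2 v v)
      simp only [sub_apply] at h3
      have h4 := hb.lower (γ t) hts v
      have h5 : ‖γ t - x‖ ^ 2 ≤ 16 * M ^ 4 * ε ^ 2 := by
        calc _ ≤ (4 * M ^ 2 * ε) ^ 2 := by gcongr
          _ = _ := by ring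
      have h6 : M ≤ M ^ 5 := le_self_pow₀ hM (by norm_num)
      have h7 : M * ‖γ t - x‖ ^ 2 * ‖v‖ ^ 2 ≤ M ^ 5 * ‖γ t - x‖ ^ 2 * ‖v‖ ^ 2 := by gcongr
      have h8 : 4 * M ^ 5 * ‖γ t - x‖ ^ 2 * ‖v‖ ^ 2 ≤
          4 * M ^ 5 * (16 * M ^ 4 * ε ^ 2) * (M * metric ω (γ t) v v) := by gcongr
      have h9 : 4 * M ^ 5 * (16 * M ^ 4 * ε ^ 2) * (M * metric ω (γ t) v v) =
        64 * M ^ 10 * ε ^ 2 * metric ω (γ t) v v := by ring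
      have h10 : B v v + D (γ t - x) v v ≤ metric ω (γ t) v v + M * ‖γ t - x‖ ^ 2 * ‖v‖ ^ 2 := by
        have : M * ‖γ t - x‖ ^ 2 * ‖v‖ * ‖v‖ = M * ‖γ t - x‖ ^ 2 * ‖v‖ ^ 2 := by ring
        linarith
      linarith) hlen
  rw [h0, h1, calib_sub hds] at hmain
  by_cases hk0 : k = 0
  · have : distJet B D a b = 0 := by simp [distJet, ← hk, hk0]
    rw [this]; positivity
  have hG : 0 < B k k := by
    have h2 := hlow k
    have h3 : 0 < ‖k‖ ^ 2 := by positivity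
    exact pos_of_mul_pos_right (h3.trans_le h2) hM0.le
  have h2 := sq_le_sq' (by
    have := neg_le_of_abs_le hmain; linarith) (le_of_abs_le hmain)
  rw [mul_pow, Real.sq_sqrt (by positivity)] at h2
  have h3 : distJet B D a b = B k k + 1 / 2 * D (a + b) k k := rfl
  rw [h3]
  -- With `δ = D(a + b)(k, k)`, the squared increment is `(B(k, k) + δ/4)² = B(k, k) * distJet +
  -- (δ/4)²`, and the last square has the favourable sign.
  refine le_of_mul_le_mul_left ?_ hG
  nlinarith [sq_nonneg (1 / 4 * D (a + b) k k)]

end Distance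

end KahlerCone
end

/-! ### The distance near the diagonal: upper bound by segments. -/

noncomputable section

namespace KahlerCone

open Filter Topology Asymptotics

variable {m : ℕ}

set_option maxSynthPendingDepth 3

section Distance

variable {ω : TwoForm m} {d : Cn m → Cn m → ℝ}

/-- The distance is at most the length of any path. -/
lemma IsInducedDist.le_of_path (hd : IsInducedDist ω d) {γ γ' : ℝ → Cn m}
    (hγ : ∀ t, HasDerivAt γ (γ' t) t) (hγ' : ContinuousOn γ' (Set.Icc 0 1))
    (hU : ∀ t ∈ Set.Icc (0 : ℝ) 1, γ t ∈ divisorCompl m) {S : ℝ → ℝ}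
    (hS : ContinuousOn S (Set.Icc 0 1))
    (h : ∀ t ∈ Set.Icc (0 : ℝ) 1, √(metric ω (γ t) (γ' t) (γ' t)) ≤ S t) :
    d (γ 0) (γ 1) ≤ ∫ t in (0 : ℝ)..1, S t := by
  have hud : UniqueDiffOn ℝ (Set.Icc (0 : ℝ) 1) := uniqueDiffOn_Icc zero_lt_one
  have hder : ∀ t ∈ Set.Icc (0 : ℝ) 1, derivWithin γ (Set.Icc 0 1) t = γ' t := fun t ht =>
    (hγ t).hasDerivWithinAt.derivWithin (hud t ht)
  have hC1 : ContDiffOn ℝ 1 γ (Set.Icc 0 1) := by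
    rw [contDiffOn_one_iff_derivWithin hud]
    exact ⟨fun t _ => (hγ t).differentiableAt.differentiableWithinAt, hγ'.congr hder⟩
  have hS0 : ∀ t ∈ Set.Icc (0 : ℝ) 1, 0 ≤ S t := fun t ht => (Real.sqrt_nonneg _).trans (h t ht)
  have h1 : pathDist ω (divisorCompl m) (γ 0) (γ 1) ≤ pathLength ω γ :=
    sInf_le ⟨γ, hC1, hU, rfl, rfl, rfl⟩
  have h2 : pathLength ω γ ≤ ENNReal.ofReal (∫ t in (0 : ℝ)..1, S t) := by
    rw [intervalIntegral.integral_of_le zero_le_one, ← MeasureTheory.integral_Icc_eq_integral_Ioc,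
      MeasureTheory.ofReal_integral_eq_lintegral_ofReal (hS.integrableOn_compact isCompact_Icc)]
    · refine MeasureTheory.setLIntegral_mono' measurableSet_Icc fun t ht => ?_
      rw [hder t ht]
      exact ENNReal.ofReal_le_ofReal (h t ht)
    · filter_upwards [MeasureTheory.ae_restrict_mem measurableSet_Icc] with t ht using hS0 t ht
  have h3 := h1.trans h2
  rw [hd.extends_dist _ (hU 0 (by simp)) _ (hU 1 (by simp))] at h3
  refine (ENNReal.ofReal_le_ofReal_iff ?_).mp h3
  exact intervalIntegral.integral_nonneg zero_le_one hS0

lemma IsInducedDist.exists_path (hd : IsInducedDist ω d) {p q : Cn m} (hp : p ∈ divisorCompl m)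
    (hq : q ∈ divisorCompl m) {ρ : ℝ} (h : d p q < ρ) :
    ∃ γ : ℝ → Cn m, ContDiffOn ℝ 1 γ (Set.Icc 0 1) ∧ Set.MapsTo γ (Set.Icc 0 1) (divisorCompl m) ∧
      γ 0 = p ∧ γ 1 = q ∧ pathLength ω γ ≤ ENNReal.ofReal ρ := by
  have h1 : pathDist ω (divisorCompl m) p q < ENNReal.ofReal ρ := by
    rw [hd.extends_dist p hp q hq]
    exact (ENNReal.ofReal_lt_ofReal_iff_of_nonneg (hd.nonneg p q)).mpr h
  obtain ⟨_, ⟨γ, hγ, hU, h0, h1, rfl⟩, hlt⟩ := sInf_lt_iff.mp h1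
  exact ⟨γ, hγ, hU, h0, h1, hlt.le⟩

/-- The best choice is `c = δ`. It lets the arithmetic–geometric mean inequality replace the
integral of a square root by the integral of an affine function. -/
lemma sq_le_of_forall_add_div {δ P : ℝ} (hδ : 0 ≤ δ) (hP : 0 ≤ P)
    (h : ∀ c > 0, δ ≤ (P / c + c) / 2) : δ ^ 2 ≤ P := by
  rcases hδ.eq_or_lt with h0 | h0
  · rw [← h0]; simpa using hP
  · have h1 := h δ h0
    have h2 : P / δ * δ = P := div_mul_cancel₀ _ h0.ne'
    nlinarith

variable {x : Cn m} {R M : ℝ}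

/-- On the straight segment the squared speed is at most a function `P` affine in `t`, whose mean
over `[0, 1]` is the right hand side. -/
lemma dist_sq_le_distJet (hd : IsInducedDist ω d)
    (hb : MetricBounds (metric ω) (Metric.closedBall x R) M)
    (hU : Metric.closedBall x R ⊆ divisorCompl m) {ε : ℝ} (hεR : ε ≤ R) {a b : Cn m}
    (ha : ‖a‖ ≤ ε) (hbε : ‖b‖ ≤ ε) :
    d (x + a) (x + b) ^ 2 ≤
      distJet (metric ω x) (fderiv ℝ (metric ω) x) a b + 4 * M * ε ^ 4 := by
  have hM := hb.one_le
  have hε0 : 0 ≤ ε := (norm_nonneg a).trans ha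
  have hxs : x ∈ Metric.closedBall x R := Metric.mem_closedBall_self (hε0.trans hεR)
  set B := metric ω x with hB
  set D := fderiv ℝ (metric ω) x with hD
  set k := b - a with hk
  set P : ℝ → ℝ := fun t => B k k + D a k k + t * D k k k + 4 * M * ε ^ 4 with hP
  have hkn : ‖k‖ ≤ 2 * ε := (norm_sub_le _ _).trans (by linarith)
  have hnorm : ∀ t ∈ Set.Icc (0 : ℝ) 1, ‖a + t • k‖ ≤ ε := by
    intro t ht
    have : a + t • k = (1 - t) • a + t • b := by rw [hk]; module
    rw [this]
    refine (norm_add_le _ _).trans ?_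
    rw [norm_smul, norm_smul, Real.norm_of_nonneg ht.1, Real.norm_of_nonneg (by linarith [ht.2])]
    nlinarith [ht.1, ht.2]
  have hmem : ∀ t ∈ Set.Icc (0 : ℝ) 1, x + (a + t • k) ∈ Metric.closedBall x R := fun t ht => by
    rw [mem_closedBall_iff_norm, add_sub_cancel_left]
    exact (hnorm t ht).trans hεR
  have hPb : ∀ t ∈ Set.Icc (0 : ℝ) 1, metric ω (x + (a + t • k)) k k ≤ P t := by
    intro t ht
    have h1 := hb.taylor x hxs _ (hmem t ht)
    rw [add_sub_cancel_left] at h1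
    have h2 := le_of_abs_le (bilinear_le h1 k k)
    simp only [sub_apply, map_add, map_smul, add_apply, smul_apply, smul_eq_mul] at h2
    have h3 := hnorm t ht
    have h4 : M * ‖a + t • k‖ ^ 2 * ‖k‖ * ‖k‖ ≤ M * ε ^ 2 * (2 * ε) * (2 * ε) := by gcongr
    have h5 : M * ε ^ 2 * (2 * ε) * (2 * ε) = 4 * M * ε ^ 4 := by ring
    simp only [hP]
    linarith
  have hpos : ∀ t ∈ Set.Icc (0 : ℝ) 1, 0 ≤ metric ω (x + (a + t • k)) k k := fun t ht =>
    nonneg_of_mul_nonneg_right ((sq_nonneg _).trans (hb.lower _ (hmem t ht) k)) (by linarith)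
  have hjet : distJet B D a b + 4 * M * ε ^ 4 = (P 0 + P 1) / 2 := by
    have : D b = D a + D k := by rw [hk, map_sub]; abel
    simp only [hP, distJet, ← hk, map_add, add_apply, this]
    ring
  have h0 := (hpos 0 (by simp)).trans (hPb 0 (by simp))
  have h1 := (hpos 1 (by simp)).trans (hPb 1 (by simp))
  rw [hjet]
  refine sq_le_of_forall_add_div (hd.nonneg _ _) (by linarith) fun c hc => ?_
  have hγ : ∀ t : ℝ, HasDerivAt (fun t : ℝ => x + (a + t • k)) k t := fun t => by
    simpa using (((hasDerivAt_id t).smul_const k).const_add a).const_add x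
  have h2 := hd.le_of_path hγ continuousOn_const (fun t ht => hU (hmem t ht))
    (S := fun t => (P t / c + c) / 2) (by fun_prop) (fun t ht => by
      have h3 := hPb t ht
      have h4 := hpos t ht
      have h5 := Real.sq_sqrt h4
      have h6 := div_le_div_of_nonneg_right h3 hc.le
      have h7 : metric ω (x + (a + t • k)) k k / c * c = metric ω (x + (a + t • k)) k k :=
        div_mul_cancel₀ _ hc.ne'
      set σ := √(metric ω (x + (a + t • k)) k k)
      have h8 : σ ≤ (metric ω (x + (a + t • k)) k k / c + c) / 2 := by
        have := sq_nonneg (σ - c)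
        refine le_of_mul_le_mul_right ?_ hc
        nlinarith
      linarith)
  have h3 : (fun t => (P t / c + c) / 2) = fun t =>
      ((B k k + D a k k + 4 * M * ε ^ 4) / c + c) / 2 + (D k k k / c / 2) * t := by
    funext t; simp only [hP]; ring
  rw [h3, intervalIntegral.integral_add (by simp) (by
    exact (continuous_const.mul continuous_id).intervalIntegrable _ _),
    intervalIntegral.integral_const_mul, integral_id] at h2
  simp only [zero_smul, add_zero, one_smul, intervalIntegral.integral_const, smul_eq_mul] at h2
  have h4 : a + k = b := by rw [hk]; abel
  rw [h4] at h2
  refine h2.trans (le_of_eq ?_)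
  simp only [hP]
  ring

/-- The distance function near the diagonal, to third order. -/
theorem abs_dist_sq_sub_distJet_le (hd : IsInducedDist ω d)
    (hg : IsKahlerMetricOn (metric ω) (divisorCompl m))
    (hb : MetricBounds (metric ω) (Metric.closedBall x R) M)
    (hU : Metric.closedBall x R ⊆ divisorCompl m) {ε : ℝ} (hε : 0 < ε) (hε1 : ε ≤ 1)
    (hεR : 4 * M ^ 2 * ε < R) {a b : Cn m} (ha : ‖a‖ ≤ ε) (hbε : ‖b‖ ≤ ε) :
    |d (x + a) (x + b) ^ 2 - distJet (metric ω x) (fderiv ℝ (metric ω) x) a b| ≤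
      768 * M ^ 11 * ε ^ 4 := by
  have hM := hb.one_le
  have hM0 : 0 < M := by linarith
  have hR0 : 0 ≤ R := le_trans (by positivity) hεR.le
  have hxs : x ∈ Metric.closedBall x R := Metric.mem_closedBall_self hR0
  have hεM : ε ≤ 4 * M ^ 2 * ε := le_mul_of_one_le_left hε.le (by nlinarith)
  have hup := dist_sq_le_distJet hd hb hU (hεM.trans hεR.le) ha hbε
  have hjet := distJet_le hM (hb.upper x hxs) (hb.deriv x hxs) hε1 ha hbε
  have hmem : ∀ c : Cn m, ‖c‖ ≤ ε → x + c ∈ divisorCompl m := fun c hc => hU (by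
    rw [mem_closedBall_iff_norm, add_sub_cancel_left]; exact hc.trans (hεM.trans hεR.le))
  have hd0 := hd.nonneg (x + a) (x + b)
  have hlow : distJet (metric ω x) (fderiv ℝ (metric ω) x) a b ≤
      (1 + 64 * M ^ 10 * ε ^ 2) * d (x + a) (x + b) ^ 2 := by
    have hlim : Tendsto (fun ρ : ℝ => (1 + 64 * M ^ 10 * ε ^ 2) * ρ ^ 2)
        (𝓝[>] (d (x + a) (x + b))) (𝓝 ((1 + 64 * M ^ 10 * ε ^ 2) * d (x + a) (x + b) ^ 2)) := by
      have : Continuous fun ρ : ℝ => (1 + 64 * M ^ 10 * ε ^ 2) * ρ ^ 2 := by fun_prop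
      exact this.continuousWithinAt
    refine ge_of_tendsto hlim ?_
    filter_upwards [self_mem_nhdsWithin] with ρ hρ
    obtain ⟨γ, hγ, -, h0, h1, hlen⟩ := hd.exists_path (hmem a ha) (hmem b hbε) hρ
    exact distJet_le_of_path hb (hg.symm x (hU hxs)) (fderiv_symm hg (hU hxs)) hε hε1 hεR ha hbε hγ
      h0 h1 (hd0.trans hρ.le) hlen
  have hε4 : ε ^ 4 ≤ ε ^ 2 := pow_le_pow_of_le_one hε.le hε1 (by norm_num)
  -- This crude bound turns the relative error `64 M^10 ε²` of the lower estimate into the absolute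
  -- error `768 M^11 ε⁴`.
  have h1 : d (x + a) (x + b) ^ 2 ≤ 12 * M * ε ^ 2 := by nlinarith
  have h2 : 64 * M ^ 10 * ε ^ 2 * d (x + a) (x + b) ^ 2 ≤ 64 * M ^ 10 * ε ^ 2 * (12 * M * ε ^ 2) := by
    gcongr
  have h3 : M ≤ M ^ 11 := le_self_pow₀ hM (by norm_num)
  have h4 : M * ε ^ 4 ≤ M ^ 11 * ε ^ 4 := by gcongr
  have h5 : 0 ≤ M ^ 11 * ε ^ 4 := by positivity
  rw [abs_le]
  constructor <;> nlinarith

end Distance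

end KahlerCone
end

/-! ### The law of cosines and the expansion of the squared radius at a fixed scale. -/

noncomputable section

namespace KahlerCone

open Filter Topology Asymptotics

variable {m : ℕ}

set_option maxSynthPendingDepth 3

section Cone

lemma coneDist_sq {Y : Type*} [MetricSpace Y] (a b : ℝ≥0 × Y) : coneDist a b ^ 2 =
    (a.1 : ℝ) ^ 2 + (b.1 : ℝ) ^ 2 - 2 * a.1 * b.1 * Real.cos (min (dist a.2 b.2) Real.pi) := by
  rw [coneDist, Real.sq_sqrt]
  have h1 := Real.cos_le_one (min (dist a.2 b.2) Real.pi)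
  have h2 : 0 ≤ (a.1 : ℝ) * b.1 := by positivity
  nlinarith [sq_nonneg ((a.1 : ℝ) - b.1)]

/-- The point `q` lies on the ray through `x` at `1 + s` times its radius, so `x` and `q` make the
same angle with `p`. Eliminating its cosine expresses `d(p, o)` through `d(p, x)` and `d(p, q)`,
which for small `s` are distances between nearby points. -/
lemma IsMetricCone.exists_ray {X : Type} {d : X → X → ℝ} {o : X} (h : IsMetricCone d o) (x : X)
    {s : ℝ} (hs : 0 ≤ s) (hd : ∀ p q, 0 ≤ d p q) :
    ∃ q, d x q = s * d x o ∧
      ∀ p, d p q ^ 2 = (1 + s) * d p x ^ 2 - s * d p o ^ 2 + s * (1 + s) * d x o ^ 2 := by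
  obtain ⟨Y, _, Φ, hsurj, hdist, ho⟩ := h
  obtain ⟨⟨r, y⟩, rfl⟩ := hsurj x
  lift s to ℝ≥0 using hs
  have hr : ∀ (r : ℝ≥0) y, d (Φ (r, y)) o ^ 2 = (r : ℝ) ^ 2 := fun r y => by
    rw [← ho y, hdist, coneDist_sq]; simp
  refine ⟨Φ ((1 + s) * r, y), ?_, fun p => ?_⟩
  · have h0 : d (Φ (r, y)) o = r := by
      have := hr r y
      rwa [sq_eq_sq₀ (hd _ _) r.coe_nonneg] at this
    rw [← sq_eq_sq₀ (hd _ _) (mul_nonneg s.coe_nonneg (hd _ _)), h0, hdist, coneDist_sq]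
    have : min (dist y y) Real.pi = 0 := by
      rw [dist_self]; exact min_eq_left Real.pi_pos.le
    simp only [this, Real.cos_zero]
    push_cast
    ring
  · obtain ⟨⟨ρ, y'⟩, rfl⟩ := hsurj p
    rw [hr, hr, hdist, hdist, coneDist_sq, coneDist_sq]
    push_cast
    ring

end Cone

section Distance

variable {ω : TwoForm m} {d : Cn m → Cn m → ℝ} {x : Cn m} {R M : ℝ}

lemma dense_divisorCompl : Dense (divisorCompl m) := by
  intro q
  by_cases hq : q ∈ divisorCompl m
  · exact subset_closure hq
  have hq0 : q 0 = 0 := not_not.mp hq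
  have hc : Continuous fun t : ℝ => q + t • (e₀ : Cn m) := by fun_prop
  have hlim : Tendsto (fun t : ℝ => q + t • (e₀ : Cn m)) (𝓝[>] 0) (𝓝 q) := by
    have := (hc.tendsto 0).mono_left (nhdsWithin_le_nhds (s := Set.Ioi 0))
    simpa using this
  refine mem_closure_of_tendsto hlim ?_
  filter_upwards [self_mem_nhdsWithin] with t ht
  have ht : t ≠ 0 := (Set.mem_Ioi.mp ht).ne'
  simp [divisorCompl, hq0, e₀, ht]

/-- A point which is close to `x` in the induced distance is close to `x` in norm. -/
lemma norm_sub_le_of_dist_lt (hd : IsInducedDist ω d)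
    (hb : MetricBounds (metric ω) (Metric.closedBall x R) M) (hx : x ∈ divisorCompl m) {q : Cn m}
    (hq : M * d x q < R) : ‖q - x‖ ≤ M * d x q := by
  have hM := hb.one_le
  have key : ∀ q ∈ divisorCompl m, M * d x q < R → ‖q - x‖ ≤ M * d x q := by
    intro q hqU hq
    have hlim : Tendsto (fun ρ : ℝ => M * ρ) (𝓝[>] (d x q)) (𝓝 (M * d x q)) := by
      have : Continuous fun ρ : ℝ => M * ρ := by fun_prop
      exact this.continuousWithinAt
    refine ge_of_tendsto hlim ?_
    filter_upwards [self_mem_nhdsWithin, hlim.eventually (gt_mem_nhds hq)] with ρ hρ hρR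
    obtain ⟨γ, hγ, -, h0, h1, hlen⟩ := hd.exists_path hx hqU hρ
    have := norm_sub_le_of_pathLength_le hγ hM ((hd.nonneg _ _).trans hρ.le)
      (fun z hz => hb.lower z hz) (by rw [h0]; simpa using hρR) hlen 1 (by simp)
    rwa [h0, h1] at this
  -- Points of the divisor are reached by density, since both sides are continuous.
  have hcont : Continuous fun q => M * d x q :=
    continuous_const.mul (hd.continuous.comp (continuous_const.prodMk continuous_id))
  have hopen : IsOpen {q | M * d x q < R} := isOpen_lt hcont continuous_const
  have hcl : IsClosed {q | ‖q - x‖ ≤ M * d x q} :=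
    isClosed_le (by fun_prop) hcont
  have h1 := dense_divisorCompl.open_subset_closure_inter hopen hq
  exact hcl.closure_subset_iff.mpr (fun p hp => key p hp.2 hp.1) h1

set_option maxHeartbeats 400000 in
/-- The second order expansion of half the squared distance from the vertex, at scale `ε`. -/
lemma exists_expansion_at_scale (hd : IsInducedDist ω d) (hcone : IsMetricCone d 0)
    (hg : IsKahlerMetricOn (metric ω) (divisorCompl m))
    (hb : MetricBounds (metric ω) (Metric.closedBall x R) M)
    (hU : Metric.closedBall x R ⊆ divisorCompl m) {Λ : ℝ} (hΛ : 1 ≤ Λ) (hr : d x 0 ≤ Λ)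
    {ε : ℝ} (hε : 0 < ε) (hε1 : M * Λ * ε ≤ 1) (hεR : 4 * M ^ 2 * (M * Λ * ε) < R) :
    ∃ (b : Cn m) (ℓ : Cn m →L[ℝ] ℝ), ‖b‖ ≤ M * Λ ∧
      (∀ h, |ℓ h - metric ω x b h| ≤ 2000 * M ^ 15 * Λ ^ 4 * ε * ‖h‖) ∧
      |metric ω x b b - d x 0 ^ 2| ≤ 2000 * M ^ 15 * Λ ^ 4 * ε ∧
      ∀ h, ‖h‖ ≤ ε → |d (x + h) 0 ^ 2 / 2 - d x 0 ^ 2 / 2 - ℓ h - (1 / 2 * metric ω x h h +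
        1 / 2 * fderiv ℝ (metric ω) x h h b - 1 / 4 * fderiv ℝ (metric ω) x b h h)| ≤
          2000 * M ^ 15 * Λ ^ 4 * ε ^ 3 := by
  have hM := hb.one_le
  have hM0 : 0 < M := by linarith
  have hΛ0 : 0 < Λ := by linarith
  have hR0 : 0 ≤ R := le_trans (by positivity) hεR.le
  have hxs : x ∈ Metric.closedBall x R := Metric.mem_closedBall_self hR0
  have hxU := hU hxs
  -- The ray is prolonged by the fraction `ε`, so `q` is at distance `ε * d x 0` from `x`.
  obtain ⟨q, hxq, hq⟩ := hcone.exists_ray x hε.le hd.nonneg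
  set r := d x 0 with hrdef
  have hr0 : 0 ≤ r := hd.nonneg _ _
  have hMΛ : 1 ≤ M * Λ := one_le_mul_of_one_le_of_one_le hM hΛ
  set η := M * Λ * ε with hη
  have hεη : ε ≤ η := le_mul_of_one_le_left hε.le hMΛ
  have hη0 : 0 < η := hε.trans_le hεη
  have hη4 : η ≤ 4 * M ^ 2 * η := le_mul_of_one_le_left hη0.le (by nlinarith)
  have hMd : M * d x q ≤ η := by
    rw [hxq, hη]
    have : M * (ε * r) ≤ M * (ε * Λ) := by gcongr
    linarith
  have hqn : ‖q - x‖ ≤ η :=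
    (norm_sub_le_of_dist_lt hd hb hxU (by linarith)).trans hMd
  set B := metric ω x with hB
  set D := fderiv ℝ (metric ω) x with hD
  have hBs : ∀ u v, B u v = B v u := hg.symm x hxU
  have hDs : ∀ a u v, D a u v = D a v u := fderiv_symm hg hxU
  have hDn : ‖D‖ ≤ M := hb.deriv x hxs
  -- A difference quotient along the ray, an approximation at scale `ε` of the radial vector.
  set b : Cn m := ε⁻¹ • (q - x) with hbdef
  have hqb : q = x + ε • b := by rw [hbdef, smul_inv_smul₀ hε.ne']; abel
  have hbn : ‖b‖ ≤ M * Λ := by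
    rw [hbdef, norm_smul, Real.norm_of_nonneg (by positivity), inv_mul_le_iff₀ hε]
    linarith
  have hεb : ‖ε • b‖ ≤ η := by rwa [hbdef, smul_inv_smul₀ hε.ne']
  set Q := M ^ 15 * Λ ^ 4 with hQ
  have hQ1 : 1 ≤ Q := one_le_mul_of_one_le_of_one_le (one_le_pow₀ hM) (one_le_pow₀ hΛ)
  have hMQ : M ≤ Q := by
    have h1 : M ≤ M ^ 15 := le_self_pow₀ hM (by norm_num)
    have h2 : M ^ 15 * 1 ≤ Q := by
      rw [hQ]; gcongr; exact one_le_pow₀ hΛ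
    linarith
  have hQ3 : M * (M * Λ) ^ 3 ≤ Q := by
    have h1 : M ^ 4 ≤ M ^ 15 := pow_le_pow_right₀ hM (by norm_num)
    have h2 : Λ ^ 3 ≤ Λ ^ 4 := pow_le_pow_right₀ hΛ (by norm_num)
    calc M * (M * Λ) ^ 3 = M ^ 4 * Λ ^ 3 := by ring
      _ ≤ _ := by rw [hQ]; gcongr
  have hQ2 : M * (M * Λ) ^ 2 ≤ Q := by
    exact (mul_le_mul_of_nonneg_left (pow_le_pow_right₀ hMΛ (by norm_num)) hM0.le).trans hQ3
  have hη4Q : 768 * M ^ 11 * η ^ 4 = 768 * Q * ε ^ 4 := by rw [hη, hQ]; ring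
  have hest : ∀ u v : Cn m, ‖u‖ ≤ η → ‖v‖ ≤ η →
      |d (x + u) (x + v) ^ 2 - distJet B D u v| ≤ 768 * Q * ε ^ 4 := fun u v hu hv => by
    rw [← hη4Q]
    exact abs_dist_sq_sub_distJet_le hd hg hb hU hη0 hε1 hεR hu hv
  have hε1' : ε ≤ 1 := hεη.trans hε1
  have hN0 : |(ε * r) ^ 2 - distJet B D 0 (ε • b)| ≤ 768 * Q * ε ^ 4 := by
    have := hest 0 (ε • b) (by simpa using hη0.le) hεb
    rwa [add_zero, ← hqb, hxq] at this
  have hN0' : distJet B D 0 (ε • b) = ε ^ 2 * (B b b + 1 / 2 * ε * D b b b) := by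
    simp only [distJet, sub_zero, zero_add, map_smul, smul_apply, smul_eq_mul]
    ring
  -- The linear part in `h` of the jet combination below, divided by `2ε`; it differs from `B b` by
  -- `O(ε)`.
  obtain ⟨ℓ, hℓ⟩ : ∃ ℓ : Cn m →L[ℝ] ℝ,
      ∀ h, ℓ h = B b h + ε * (1 / 2 * D b b h - 1 / 4 * D h b b) :=
    ⟨LinearMap.toContinuousLinearMap
      { toFun := fun h => B b h + ε * (1 / 2 * D b b h - 1 / 4 * D h b b)
        map_add' := fun u v => by simp only [map_add, add_apply]; ring
        map_smul' := fun c u => by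
          simp only [map_smul, smul_apply, smul_eq_mul, RingHom.id_apply]; ring }, fun h => rfl⟩
  refine ⟨b, ℓ, hbn, fun h => ?_, ?_, fun h hh => ?_⟩
  · rw [hℓ, add_sub_cancel_left, abs_mul, abs_of_pos hε]
    have h1 := abs_le.mp (trilinear_le hDn b b h)
    have h2 := abs_le.mp (trilinear_le hDn h b b)
    have h3 : M * ‖b‖ * ‖b‖ * ‖h‖ ≤ M * (M * Λ) * (M * Λ) * ‖h‖ := by gcongr
    have h4 : M * (M * Λ) * (M * Λ) * ‖h‖ = M * (M * Λ) ^ 2 * ‖h‖ := by ring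
    have h5 : M * (M * Λ) ^ 2 * ‖h‖ ≤ Q * ‖h‖ := by gcongr
    have h6 : 0 ≤ Q * ‖h‖ := by positivity
    have h7 : |1 / 2 * D b b h - 1 / 4 * D h b b| ≤ 2000 * Q * ‖h‖ := by
      rw [abs_le]
      constructor <;> linarith
    calc _ ≤ ε * (2000 * Q * ‖h‖) := by gcongr
      _ = _ := by rw [hQ]; ring
  · have h1 := abs_le.mp (trilinear_le hDn b b b)
    have h3 : M * ‖b‖ * ‖b‖ * ‖b‖ ≤ M * (M * Λ) * (M * Λ) * (M * Λ) := by gcongr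
    have h4 : M * (M * Λ) * (M * Λ) * (M * Λ) = M * (M * Λ) ^ 3 := by ring
    have h5 : |B b b + 1 / 2 * ε * D b b b - r ^ 2| ≤ 768 * Q * ε ^ 2 := by
      rw [hN0', show (ε * r) ^ 2 - ε ^ 2 * (B b b + 1 / 2 * ε * D b b b) =
        -(ε ^ 2 * (B b b + 1 / 2 * ε * D b b b - r ^ 2)) by ring, abs_neg, abs_mul,
        abs_of_pos (by positivity : 0 < ε ^ 2)] at hN0
      refine le_of_mul_le_mul_left (hN0.trans (le_of_eq (by ring))) (by positivity : 0 < ε ^ 2)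
    have h6 : Q * ε ^ 2 ≤ Q * ε := by
      gcongr; nlinarith
    have h7 : |ε * D b b b| ≤ ε * Q := by
      rw [abs_mul, abs_of_pos hε]
      gcongr
      rw [abs_le]
      constructor <;> linarith
    have h8 : 2000 * M ^ 15 * Λ ^ 4 * ε = 2000 * (Q * ε) := by rw [hQ]; ring
    rw [h8]
    have h5' := abs_le.mp h5
    have h7' := abs_le.mp h7
    have h9 : 0 ≤ Q * ε := by positivity
    rw [abs_le]
    constructor <;> linarith
  · have h1 := hest h 0 (hh.trans hεη) (by simpa using hη0.le)
    have h2 := hest h (ε • b) (hh.trans hεη) hεb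
    rw [add_zero] at h1
    rw [← hqb, hq] at h2
    set p := x + h with hp
    -- The law of cosines with each squared distance replaced by its jet. The errors of order `ε⁴`
    -- become `ε³` after division by `2ε`.
    have hjet : (1 + ε) * distJet B D h 0 - distJet B D h (ε • b) + distJet B D 0 (ε • b) =
        2 * ε * (ℓ h + (1 / 2 * B h h + 1 / 2 * D h h b - 1 / 4 * D b h h) + 1 / 4 * D h h h) := by
      rw [hℓ]
      simp only [distJet, sub_zero, zero_sub, zero_add, add_zero, map_smul, smul_apply, smul_eq_mul,
        map_sub, sub_apply, map_add, add_apply, map_neg, neg_apply, hBs h b, hDs h b h, hDs b h b]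
      ring
    have h3 := abs_le.mp (trilinear_le hDn h h h)
    have h4 : M * ‖h‖ * ‖h‖ * ‖h‖ ≤ M * ε * ε * ε := by gcongr
    have h5 : M * ε ^ 3 ≤ Q * ε ^ 3 := by gcongr
    have h6 : |2 * ε * (d p 0 ^ 2 / 2 - r ^ 2 / 2 - ℓ h -
        (1 / 2 * B h h + 1 / 2 * D h h b - 1 / 4 * D b h h) - 1 / 4 * D h h h)| ≤
          2 * ε * (1536 * Q * ε ^ 3) := by
      have e1 : 2 * ε * (d p 0 ^ 2 / 2 - r ^ 2 / 2 - ℓ h -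
          (1 / 2 * B h h + 1 / 2 * D h h b - 1 / 4 * D b h h) - 1 / 4 * D h h h) =
          (1 + ε) * (d p x ^ 2 - distJet B D h 0) -
          ((1 + ε) * d p x ^ 2 - ε * d p 0 ^ 2 + ε * (1 + ε) * r ^ 2 - distJet B D h (ε • b)) +
          ((ε * r) ^ 2 - distJet B D 0 (ε • b)) := by
        linear_combination hjet
      rw [e1]
      have h7 : |(1 + ε) * (d p x ^ 2 - distJet B D h 0)| ≤ 2 * (768 * Q * ε ^ 4) := by
        rw [abs_mul, abs_of_pos (by linarith : 0 < 1 + ε)]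
        gcongr
        linarith
      have h2' := abs_le.mp h2
      have h7' := abs_le.mp h7
      have h8 := abs_le.mp hN0
      rw [abs_le]
      constructor <;> linarith
    rw [abs_mul, abs_of_pos (by positivity : 0 < 2 * ε)] at h6
    have h7 := abs_le.mp (le_of_mul_le_mul_left h6 (by positivity))
    have h8 : 2000 * M ^ 15 * Λ ^ 4 * ε ^ 3 = 2000 * (Q * ε ^ 3) := by rw [hQ]; ring
    rw [h8]
    have h9 : 0 ≤ Q * ε ^ 3 := by positivity
    rw [abs_le]
    constructor <;> linarith

end Distance

end KahlerCone
end

/-! ### Passage to the limit of small scales. -/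

noncomputable section

namespace KahlerCone

open Filter Topology Asymptotics

variable {m : ℕ}

set_option maxSynthPendingDepth 3

lemma opNorm_le_div {T : Cn m →L[ℝ] ℝ} {ε c : ℝ} (hε : 0 < ε) (hc : 0 ≤ c)
    (h : ∀ k, ‖k‖ ≤ ε → |T k| ≤ c) : ‖T‖ ≤ c / ε := by
  refine T.opNorm_le_bound (by positivity) fun k => ?_
  rcases (norm_nonneg k).eq_or_lt with h0 | h0
  · rw [← h0, norm_eq_zero.mp h0.symm]; simp
  · have h1 := h ((ε / ‖k‖) • k) (by
      rw [norm_smul, Real.norm_of_nonneg (by positivity), div_mul_cancel₀ _ h0.ne'])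
    rw [map_smul, smul_eq_mul, abs_mul, abs_of_pos (by positivity)] at h1
    rw [Real.norm_eq_abs, div_mul_eq_mul_div, le_div_iff₀ hε]
    rw [div_mul_eq_mul_div, div_le_iff₀ h0] at h1
    linarith

/-- Only scales of ratio at most two are compared. The values at `ε₀ / 2^n` form a Cauchy sequence,
and any `ε` lies between two successive such scales. -/
lemma exists_limit_of_dyadic {V : Type*} [NormedAddCommGroup V] [CompleteSpace V] {F : ℝ → V}
    {K ε₀ : ℝ} (hε₀ : 0 < ε₀) (hK : 0 ≤ K)
    (h : ∀ ε ε', 0 < ε' → ε' ≤ ε → ε ≤ 2 * ε' → ε ≤ ε₀ → ‖F ε - F ε'‖ ≤ K * ε ^ 2) :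
    ∃ L, ∀ ε, 0 < ε → ε ≤ ε₀ → ‖F ε - L‖ ≤ 12 * K * ε ^ 2 := by
  set u : ℕ → V := fun n => F (ε₀ * (1 / 2) ^ n) with hu
  have hle : ∀ n : ℕ, ε₀ * (1 / 2) ^ n ≤ ε₀ := fun n =>
    mul_le_of_le_one_right hε₀.le (pow_le_one₀ (by norm_num) (by norm_num))
  have hpow : ∀ n : ℕ, ((1 / 2 : ℝ) ^ n) ^ 2 = (1 / 4) ^ n := fun n => by
    rw [← pow_mul, mul_comm, pow_mul]; norm_num
  have hstep : ∀ n, dist (u n) (u (n + 1)) ≤ K * ε₀ ^ 2 * (1 / 4) ^ n := by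
    intro n
    have hp : 0 < ε₀ * (1 / 2) ^ n := by positivity
    rw [dist_eq_norm]
    refine (h (ε₀ * (1 / 2) ^ n) (ε₀ * (1 / 2) ^ (n + 1)) (by positivity) ?_ ?_ (hle n)).trans
      (le_of_eq ?_)
    · rw [pow_succ]; linarith
    · rw [pow_succ]; linarith
    · rw [mul_pow, hpow]; ring
  obtain ⟨L, hL⟩ := cauchySeq_tendsto_of_complete
    (cauchySeq_of_le_geometric (1 / 4) (K * ε₀ ^ 2) (by norm_num) hstep)
  have hlim := dist_le_of_le_geometric_of_tendsto (1 / 4) (K * ε₀ ^ 2) (by norm_num) hstep hL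
  refine ⟨L, fun ε hε hε' => ?_⟩
  obtain ⟨n, hn1, hn2⟩ := exists_nat_pow_near_of_lt_one (x := ε / ε₀) (y := 1 / 2) (by positivity)
    (by rwa [div_le_one hε₀]) (by norm_num) (by norm_num)
  rw [lt_div_iff₀ hε₀] at hn1
  rw [div_le_iff₀ hε₀] at hn2
  rw [pow_succ] at hn1
  have h1 := h (ε₀ * (1 / 2) ^ n) ε hε (by linarith) (by linarith) (hle n)
  have h2 := hlim n
  rw [dist_eq_norm] at h2
  have h3 : (ε₀ * (1 / 2) ^ n) ^ 2 ≤ 4 * ε ^ 2 := by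
    calc (ε₀ * (1 / 2) ^ n) ^ 2 ≤ (2 * ε) ^ 2 :=
          pow_le_pow_left₀ (by positivity) (by linarith) 2
      _ = _ := by ring
  have h4 : K * ε₀ ^ 2 * (1 / 4) ^ n = K * (ε₀ * (1 / 2) ^ n) ^ 2 := by rw [mul_pow, hpow]; ring
  rw [h4] at h2
  have h5 : K * (ε₀ * (1 / 2) ^ n) ^ 2 ≤ K * (4 * ε ^ 2) := by gcongr
  have h6 : ‖F ε - L‖ ≤ ‖F (ε₀ * (1 / 2) ^ n) - F ε‖ + ‖u n - L‖ := by
    rw [← norm_neg (F _ - F ε), neg_sub]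
    exact norm_sub_le_norm_sub_add_norm_sub _ _ _
  have h7 : K * (ε₀ * (1 / 2) ^ n) ^ 2 / (1 - 1 / 4) = 4 / 3 * (K * (ε₀ * (1 / 2) ^ n) ^ 2) := by
    ring
  rw [h7] at h2
  have h8 : 0 ≤ K * ε ^ 2 := by positivity
  linarith

lemma nonpos_of_forall_le_mul {a K ε₀ : ℝ} (hε₀ : 0 < ε₀) (h : ∀ ε, 0 < ε → ε ≤ ε₀ → a ≤ K * ε) :
    a ≤ 0 := by
  have hlim : Tendsto (fun ε : ℝ => K * ε) (𝓝[>] 0) (𝓝 0) := by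
    have : Continuous fun ε : ℝ => K * ε := by fun_prop
    simpa using (this.tendsto 0).mono_left nhdsWithin_le_nhds
  refine ge_of_tendsto hlim ?_
  filter_upwards [Ioc_mem_nhdsGT hε₀] with ε hε using h ε hε.1 hε.2

/-- The quadratic part of the expansion of half the squared distance from the vertex. -/
def coneJet (B : Cn m →L[ℝ] Cn m →L[ℝ] ℝ) (D : Cn m →L[ℝ] Cn m →L[ℝ] Cn m →L[ℝ] ℝ)
    (X h : Cn m) : ℝ := 1 / 2 * B h h + 1 / 2 * D h h X - 1 / 4 * D X h h

/-- Evenness lets the linear term be isolated by subtracting expansions at `h` and `-h`. -/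
lemma coneJet_neg (B : Cn m →L[ℝ] Cn m →L[ℝ] ℝ) (D : Cn m →L[ℝ] Cn m →L[ℝ] Cn m →L[ℝ] ℝ)
    (X h : Cn m) : coneJet B D X (-h) = coneJet B D X h := by
  simp only [coneJet, map_neg, neg_apply, neg_neg]

lemma coneJet_sub_le {B : Cn m →L[ℝ] Cn m →L[ℝ] ℝ} {D : Cn m →L[ℝ] Cn m →L[ℝ] Cn m →L[ℝ] ℝ}
    {M : ℝ} (hD : ‖D‖ ≤ M) (b X h : Cn m) :
    |coneJet B D b h - coneJet B D X h| ≤ M * ‖b - X‖ * ‖h‖ ^ 2 := by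
  have h1 : coneJet B D b h - coneJet B D X h = 1 / 2 * D h h (b - X) - 1 / 4 * D (b - X) h h := by
    simp only [coneJet, map_sub, sub_apply]; ring
  have h2 := abs_le.mp (trilinear_le hD h h (b - X))
  have h3 := abs_le.mp (trilinear_le hD (b - X) h h)
  have h4 : M * ‖h‖ * ‖h‖ * ‖b - X‖ = M * ‖b - X‖ * ‖h‖ ^ 2 := by ring
  have h5 : M * ‖b - X‖ * ‖h‖ * ‖h‖ = M * ‖b - X‖ * ‖h‖ ^ 2 := by ring
  have h6 : 0 ≤ M * ‖b - X‖ * ‖h‖ ^ 2 := by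
    have := (norm_nonneg D).trans hD
    positivity
  rw [h1, abs_le]
  constructor <;> linarith

section Distance

variable {ω : TwoForm m} {d : Cn m → Cn m → ℝ} {x : Cn m} {R M : ℝ}

/-- The second order expansion of half the squared distance from the vertex. -/
theorem exists_expansion (hd : IsInducedDist ω d) (hcone : IsMetricCone d 0)
    (hg : IsKahlerMetricOn (metric ω) (divisorCompl m))
    (hb : MetricBounds (metric ω) (Metric.closedBall x R) M)
    (hU : Metric.closedBall x R ⊆ divisorCompl m) {Λ : ℝ} (hΛ : 1 ≤ Λ) (hr : d x 0 ≤ Λ)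
    {ε₀ : ℝ} (hε₀ : 0 < ε₀) (hε1 : M * Λ * ε₀ ≤ 1) (hεR : 4 * M ^ 2 * (M * Λ * ε₀) < R) :
    ∃ X, metric ω x X X = d x 0 ^ 2 ∧ ∀ h, ‖h‖ ≤ ε₀ →
      |d (x + h) 0 ^ 2 / 2 - d x 0 ^ 2 / 2 - metric ω x X h -
        coneJet (metric ω x) (fderiv ℝ (metric ω) x) X h| ≤
          100 * M ^ 2 * (2000 * M ^ 15 * Λ ^ 4) * ‖h‖ ^ 3 := by
  have hM := hb.one_le
  have hM0 : 0 < M := by linarith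
  have hΛ0 : 0 < Λ := by linarith
  have hR0 : 0 ≤ R := le_trans (by positivity) hεR.le
  have hxs : x ∈ Metric.closedBall x R := Metric.mem_closedBall_self hR0
  have hBn := hb.upper x hxs
  have hDn := hb.deriv x hxs
  have hlow := hb.lower x hxs
  have hMΛ : 1 ≤ M * Λ := one_le_mul_of_one_le_of_one_le hM hΛ
  have hε₀1 : ε₀ ≤ 1 := (le_mul_of_one_le_left hε₀.le hMΛ).trans hε1
  have hall := fun (ε : ℝ) (hε : 0 < ε ∧ ε ≤ ε₀) =>
    exists_expansion_at_scale hd hcone hg hb hU hΛ hr hε.1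
      ((mul_le_mul_of_nonneg_left hε.2 (by positivity)).trans hε1)
      ((mul_le_mul_of_nonneg_left (mul_le_mul_of_nonneg_left hε.2 (by positivity))
        (by positivity)).trans_lt hεR)
  choose! b ℓ hbn hℓ hbb hexp using hall
  set C := 2000 * M ^ 15 * Λ ^ 4 with hC
  have hC0 : 0 ≤ C := by positivity
  set B := metric ω x with hB
  set D := fderiv ℝ (metric ω) x with hD
  set r := d x 0 with hrdef
  have hexp' : ∀ ε, 0 < ε ∧ ε ≤ ε₀ → ∀ h, ‖h‖ ≤ ε →
      |d (x + h) 0 ^ 2 / 2 - r ^ 2 / 2 - ℓ ε h - coneJet B D (b ε) h| ≤ C * ε ^ 3 := hexp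
  -- The odd parts of the expansions at two comparable scales differ by `O(ε³)` on a ball of radius
  -- `ε'`, so the functionals differ by `O(ε²)`.
  obtain ⟨L, hL⟩ := exists_limit_of_dyadic (F := ℓ) (K := 4 * C) hε₀ (by positivity)
    (fun ε ε' hε' hle hle2 hε => by
      have hεp : 0 < ε := hε'.trans_le hle
      have h1 := opNorm_le_div (T := ℓ ε - ℓ ε') hε' (c := 2 * C * ε ^ 3) (by positivity)
        (fun k hk => by
          have e1 := abs_le.mp (hexp' ε ⟨hεp, hε⟩ k (hk.trans hle))
          have e2 := abs_le.mp (hexp' ε ⟨hεp, hε⟩ (-k) (by rw [norm_neg]; exact hk.trans hle))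
          have e3 := abs_le.mp (hexp' ε' ⟨hε', hle.trans hε⟩ k hk)
          have e4 := abs_le.mp (hexp' ε' ⟨hε', hle.trans hε⟩ (-k) (by rwa [norm_neg]))
          rw [coneJet_neg, map_neg] at e2 e4
          have e5 : C * ε' ^ 3 ≤ C * ε ^ 3 := by gcongr
          rw [sub_apply, abs_le]
          constructor <;> linarith)
      refine h1.trans ?_
      rw [div_le_iff₀ hε']
      have : C * ε ^ 2 * ε ≤ C * ε ^ 2 * (2 * ε') := by gcongr
      nlinarith)
  obtain ⟨X, hX, -⟩ := exists_representer hM hlow (L : Cn m →ₗ[ℝ] ℝ) (K := ‖L‖)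
    (fun y => le_of_abs_le (L.le_opNorm y))
  have hX : ∀ y, B X y = L y := hX
  -- The functionals `B (b ε)` and `ℓ ε` differ by `O(ε)`, and `ℓ ε` tends to `B X`; positivity of
  -- `B` transfers the rate to the vectors.
  have hbX : ∀ ε, 0 < ε → ε ≤ ε₀ → ‖b ε - X‖ ≤ 49 * M * C * ε := by
    intro ε hε hε'
    set w := b ε - X with hw
    have h1 := hlow w
    have h2 : B w w = (B (b ε) w - ℓ ε w) + (ℓ ε - L) w := by
      have : B w = B (b ε) - B X := by rw [hw, map_sub]
      rw [this, sub_apply, sub_apply, hX]; ring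
    have h3 := abs_le.mp (hℓ ε ⟨hε, hε'⟩ w)
    have h4 := abs_le.mp (((ℓ ε - L).le_opNorm w).trans
      (mul_le_mul_of_nonneg_right (hL ε hε hε') (norm_nonneg w)))
    have h5 : ε ^ 2 ≤ ε := by nlinarith
    have h6 : 12 * (4 * C) * ε ^ 2 * ‖w‖ ≤ 12 * (4 * C) * ε * ‖w‖ := by gcongr
    have h7 : B w w ≤ 49 * C * ε * ‖w‖ := by linarith
    have h8 : ‖w‖ ^ 2 ≤ 49 * M * C * ε * ‖w‖ := by
      calc _ ≤ M * B w w := h1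
        _ ≤ M * (49 * C * ε * ‖w‖) := by gcongr
        _ = _ := by ring
    rcases (norm_nonneg w).eq_or_lt with h9 | h9
    · rw [← h9]; positivity
    · rw [sq] at h8
      exact le_of_mul_le_mul_right h8 h9
  refine ⟨X, ?_, fun h hh => ?_⟩
  · have h1 : |B X X - r ^ 2| ≤ 0 := by
      refine nonpos_of_forall_le_mul (K := C + M * (49 * M * C) * (M * Λ + ‖X‖)) hε₀
        fun ε hε hε' => ?_
      have h2 := abs_le.mp (hbb ε ⟨hε, hε'⟩)
      have h3 : B (b ε) (b ε) - B X X = B (b ε - X) (b ε) + B X (b ε - X) := by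
        simp only [map_sub, sub_apply]; ring
      have h4 := abs_le.mp (bilinear_le hBn (b ε - X) (b ε))
      have h5 := abs_le.mp (bilinear_le hBn X (b ε - X))
      have h6 := hbX ε hε hε'
      have h7 : M * ‖b ε - X‖ * ‖b ε‖ ≤ M * (49 * M * C * ε) * (M * Λ) := by
        gcongr
        exact hbn ε ⟨hε, hε'⟩
      have h8 : M * ‖X‖ * ‖b ε - X‖ ≤ M * ‖X‖ * (49 * M * C * ε) := by gcongr
      rw [abs_le]
      constructor <;> linarith
    linarith [abs_nonpos_iff.mp h1]
  · rcases (norm_nonneg h).eq_or_lt with h0 | h0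
    · have : h = 0 := norm_eq_zero.mp h0.symm
      subst this
      simp [coneJet, hrdef]
    · have h1 := abs_le.mp (hexp' ‖h‖ ⟨h0, hh⟩ h le_rfl)
      have h2 := abs_le.mp (coneJet_sub_le (B := B) hDn (b ‖h‖) X h)
      have h3 := hbX ‖h‖ h0 hh
      have h4 : M * ‖b ‖h‖ - X‖ * ‖h‖ ^ 2 ≤ M * (49 * M * C * ‖h‖) * ‖h‖ ^ 2 := by gcongr
      have h5 := abs_le.mp (((ℓ ‖h‖ - L).le_opNorm h).trans
        (mul_le_mul_of_nonneg_right (hL ‖h‖ h0 hh) h0.le))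
      rw [sub_apply] at h5
      rw [hX]
      have h6 : C * ‖h‖ ^ 3 ≤ M ^ 2 * C * ‖h‖ ^ 3 := by
        gcongr
        exact le_mul_of_one_le_left hC0 (one_le_pow₀ hM)
      have h7 : 0 ≤ C * ‖h‖ ^ 3 := by positivity
      have h8 : M * (49 * M * C * ‖h‖) * ‖h‖ ^ 2 = 49 * (M ^ 2 * C * ‖h‖ ^ 3) := by ring
      have h9 : 12 * (4 * C) * ‖h‖ ^ 2 * ‖h‖ = 48 * (C * ‖h‖ ^ 3) := by ring
      have h10 : 100 * M ^ 2 * C * ‖h‖ ^ 3 = 100 * (M ^ 2 * C * ‖h‖ ^ 3) := by ring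
      rw [h10]
      rw [h9] at h5
      rw [h8] at h4
      rw [abs_le]
      constructor <;> linarith

/-- The second order expansion of half the squared distance from the vertex, locally uniformly. -/
theorem exists_uniform_expansion {β K : ℝ} (hd : IsInducedDist ω d) (hcone : IsMetricCone d 0)
    (hg : IsKahlerMetricOn (metric ω) (divisorCompl m)) (hC : EquivModel (metric ω) β K)
    {z₀ : Cn m} (hz₀ : z₀ ∈ divisorCompl m) :
    ∃ ε > 0, ∃ C, 0 ≤ C ∧ ∀ x ∈ Metric.ball z₀ ε, x ∈ divisorCompl m ∧
      ∃ X, metric ω x X X = d x 0 ^ 2 ∧ ∀ h, ‖h‖ ≤ ε →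
        |d (x + h) 0 ^ 2 / 2 - d x 0 ^ 2 / 2 - metric ω x X h -
          coneJet (metric ω x) (fderiv ℝ (metric ω) x) X h| ≤ C * ‖h‖ ^ 3 := by
  obtain ⟨R, hR, M, hRU, hb⟩ := exists_metricBounds hg hC hz₀
  have hM := hb.one_le
  have hM0 : 0 < M := by linarith
  have hdc : Continuous fun x => d x 0 := hd.continuous.comp (continuous_id.prodMk continuous_const)
  obtain ⟨Λ₀, hΛ₀⟩ := (isCompact_closedBall z₀ R).bddAbove_image hdc.continuousOn
  set Λ := max 1 Λ₀ with hΛ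
  have hΛ1 : 1 ≤ Λ := le_max_left _ _
  have hΛ0 : 0 < Λ := by linarith
  set ε := min (R / 2) (min (M * Λ)⁻¹ (R / 4 / (4 * M ^ 2 * (M * Λ)))) with hε
  have hε0 : 0 < ε := by positivity
  have h1 : ε ≤ R / 2 := min_le_left _ _
  have h2 : M * Λ * ε ≤ 1 := by
    have : ε ≤ (M * Λ)⁻¹ := (min_le_right _ _).trans (min_le_left _ _)
    calc M * Λ * ε ≤ M * Λ * (M * Λ)⁻¹ := by gcongr
      _ = 1 := mul_inv_cancel₀ (by positivity)
  have h3 : 4 * M ^ 2 * (M * Λ * ε) < R / 2 := by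
    have : ε ≤ R / 4 / (4 * M ^ 2 * (M * Λ)) := (min_le_right _ _).trans (min_le_right _ _)
    rw [le_div_iff₀ (by positivity)] at this
    linarith
  refine ⟨ε, hε0, 100 * M ^ 2 * (2000 * M ^ 15 * Λ ^ 4), by positivity, fun x hx => ?_⟩
  have hsub : Metric.closedBall x (R / 2) ⊆ Metric.closedBall z₀ R := by
    refine Metric.closedBall_subset_closedBall' ?_
    have := (Metric.mem_ball.mp hx).le
    linarith
  have hxs : x ∈ Metric.closedBall z₀ R := hsub (Metric.mem_closedBall_self (by positivity))
  have hb' : MetricBounds (metric ω) (Metric.closedBall x (R / 2)) M :=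
    ⟨hM, fun z hz => hb.lower z (hsub hz), fun z hz => hb.upper z (hsub hz),
      fun z hz => hb.deriv z (hsub hz), fun z hz z' hz' => hb.taylor z (hsub hz) z' (hsub hz')⟩
  exact ⟨hRU hxs, exists_expansion hd hcone hg hb' (hsub.trans hRU) hΛ1
    ((hΛ₀ (Set.mem_image_of_mem _ hxs)).trans (le_max_right _ _)) hε0 h2 h3⟩

end Distance

end KahlerCone
end

/-! ### The radial vector field: differentiability, `∇X = id` and holomorphy. -/

noncomputable section

namespace KahlerCone

open Filter Topology Asymptotics

variable {m : ℕ}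

set_option maxSynthPendingDepth 3

section Expansion

variable {g : Cn m → Cn m →L[ℝ] Cn m →L[ℝ] ℝ} {φ : Cn m → ℝ}

/-- `φ` has a second order expansion at `x`, with gradient `X`, as half the squared distance from
the vertex of a cone has. -/
def HasConeExpansion (g : Cn m → Cn m →L[ℝ] Cn m →L[ℝ] ℝ) (φ : Cn m → ℝ) (x X : Cn m)
    (ε C : ℝ) : Prop :=
  ∀ h, ‖h‖ ≤ ε → |φ (x + h) - φ x - g x X h - coneJet (g x) (fderiv ℝ g x) X h| ≤ C * ‖h‖ ^ 3

/-- The jet depends on `X` also in its quadratic part, but that part is even; the odd parts at small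
scales determine `g x X`. -/
lemma HasConeExpansion.unique {x X X' : Cn m} {ε ε' C C' : ℝ} (hpos : ∀ v, v ≠ 0 → 0 < g x v v)
    (hε : 0 < ε) (hε' : 0 < ε') (hC : 0 ≤ C) (hC' : 0 ≤ C') (h : HasConeExpansion g φ x X ε C)
    (h' : HasConeExpansion g φ x X' ε' C') : X = X' := by
  have h1 : ‖g x (X - X')‖ ≤ 0 := by
    refine nonpos_of_forall_le_mul (K := C + C') (ε₀ := min 1 (min ε ε')) (by positivity)
      fun t ht ht' => ?_
    have ht1 : t ≤ 1 := ht'.trans (min_le_left _ _)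
    have ht2 : t ≤ ε := ht'.trans ((min_le_right _ _).trans (min_le_left _ _))
    have ht3 : t ≤ ε' := ht'.trans ((min_le_right _ _).trans (min_le_right _ _))
    refine (opNorm_le_div (c := (C + C') * t ^ 3) ht (by positivity) fun k hk => ?_).trans ?_
    · have e1 := abs_le.mp (h k (hk.trans ht2))
      have e2 := abs_le.mp (h (-k) (by rw [norm_neg]; exact hk.trans ht2))
      have e3 := abs_le.mp (h' k (hk.trans ht3))
      have e4 := abs_le.mp (h' (-k) (by rw [norm_neg]; exact hk.trans ht3))
      rw [coneJet_neg, map_neg, norm_neg] at e2 e4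
      have e5 : C * ‖k‖ ^ 3 ≤ C * t ^ 3 := by gcongr
      have e6 : C' * ‖k‖ ^ 3 ≤ C' * t ^ 3 := by gcongr
      rw [map_sub, sub_apply, abs_le]
      constructor <;> linarith
    · rw [div_le_iff₀ ht]
      have : (C + C') * t ^ 2 * t ≤ (C + C') * t ^ 2 * 1 := by gcongr
      linarith
  have h2 : g x (X - X') (X - X') = 0 := by
    rw [norm_le_zero_iff.mp h1]; rfl
  by_contra hne
  exact (hpos _ (sub_ne_zero.mpr hne)).ne' h2

/-- The Hessian of a function with a second order expansion as above. -/
lemma exists_coneHess (B : Cn m →L[ℝ] Cn m →L[ℝ] ℝ)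
    (D : Cn m →L[ℝ] Cn m →L[ℝ] Cn m →L[ℝ] ℝ) (X : Cn m) :
    ∃ A : Cn m →L[ℝ] Cn m →L[ℝ] ℝ, ∀ h k,
      A h k = B h k + 1 / 2 * (D h k X + D k h X - D X h k) :=
  ⟨LinearMap.toContinuousLinearMap
    { toFun := fun h => LinearMap.toContinuousLinearMap
        { toFun := fun k => B h k + 1 / 2 * (D h k X + D k h X - D X h k)
          map_add' := fun k k' => by simp only [map_add, add_apply]; ring
          map_smul' := fun c k => by
            simp only [map_smul, smul_apply, smul_eq_mul, RingHom.id_apply]; ring }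
      map_add' := fun h h' => by
        ext k
        change B (h + h') k + 1 / 2 * (D (h + h') k X + D k (h + h') X - D X (h + h') k) =
          (B h k + 1 / 2 * (D h k X + D k h X - D X h k)) +
          (B h' k + 1 / 2 * (D h' k X + D k h' X - D X h' k))
        simp only [map_add, add_apply]; ring
      map_smul' := fun c h => by
        ext k
        change B (c • h) k + 1 / 2 * (D (c • h) k X + D k (c • h) X - D X (c • h) k) =
          c * (B h k + 1 / 2 * (D h k X + D k h X - D X h k))
        simp only [map_smul, smul_apply, smul_eq_mul]; ring }, fun h k => rfl⟩

/-- A converse of Taylor's theorem. -/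
lemma hasFDerivAt_of_expansion {X : Cn m → Cn m} {z : Cn m} {ε C : ℝ} (hε : 0 < ε) (hC : 0 ≤ C)
    (hds : ∀ a u v, fderiv ℝ g z a u v = fderiv ℝ g z a v u) (hs : ∀ u v, g z u v = g z v u)
    (h : ∀ x ∈ Metric.ball z ε, HasConeExpansion g φ x (X x) ε C)
    {A : Cn m →L[ℝ] Cn m →L[ℝ] ℝ} (hA : ∀ h k, A h k = g z h k + 1 / 2 *
      (fderiv ℝ g z h k (X z) + fderiv ℝ g z k h (X z) - fderiv ℝ g z (X z) h k)) :
    HasFDerivAt (fun x => g x (X x)) A z := by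
  rw [hasFDerivAt_iff_isLittleO_nhds_zero]
  have hO : (fun k : Cn m => g (z + k) (X (z + k)) - g z (X z) - A k) =O[𝓝 0]
      fun k : Cn m => ‖k‖ ^ 2 := by
    refine IsBigO.of_bound (9 * C) ?_
    filter_upwards [Metric.ball_mem_nhds (0 : Cn m) (by positivity : 0 < ε / 2)] with k hk
    rw [mem_ball_zero_iff] at hk
    rw [Real.norm_of_nonneg (by positivity)]
    rcases (norm_nonneg k).eq_or_lt with h0 | h0
    · have : k = 0 := norm_eq_zero.mp h0.symm
      subst this
      simp
    -- The expansions at `z + k` in the directions `±l` are compared with those at `z` in the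
    -- directions `k ± l`. The part odd in `l` isolates the increment of `g X`, with an error cubic
    -- in `k`.
    have hbd := opNorm_le_div (T := g (z + k) (X (z + k)) - g z (X z) - A k) h0
      (c := 9 * C * ‖k‖ ^ 3) (by positivity) (fun l hl => by
        have hz := h z (Metric.mem_ball_self hε)
        have hzk := h (z + k) (by rw [mem_ball_iff_norm, add_sub_cancel_left]; linarith)
        have e1 := abs_le.mp (hzk l (by linarith))
        have e2 := abs_le.mp (hzk (-l) (by rw [norm_neg]; linarith))
        have n1 : ‖k + l‖ ≤ 2 * ‖k‖ := (norm_add_le _ _).trans (by linarith)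
        have n2 : ‖k - l‖ ≤ 2 * ‖k‖ := (norm_sub_le _ _).trans (by linarith)
        have e3 := abs_le.mp (hz (k + l) (by linarith))
        have e4 := abs_le.mp (hz (k - l) (by linarith))
        rw [coneJet_neg, map_neg, norm_neg] at e2
        have n3 : C * ‖k + l‖ ^ 3 ≤ C * (2 * ‖k‖) ^ 3 := by gcongr
        have n4 : C * ‖k - l‖ ^ 3 ≤ C * (2 * ‖k‖) ^ 3 := by gcongr
        have n5 : C * ‖l‖ ^ 3 ≤ C * ‖k‖ ^ 3 := by gcongr
        have n6 : C * (2 * ‖k‖) ^ 3 = 8 * (C * ‖k‖ ^ 3) := by ring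
        have p1 : z + k + l = z + (k + l) := by abel
        have p2 : z + k + -l = z + (k - l) := by abel
        rw [p1] at e1
        rw [p2] at e2
        have hjet : coneJet (g z) (fderiv ℝ g z) (X z) (k + l) -
            coneJet (g z) (fderiv ℝ g z) (X z) (k - l) = 2 * A k l := by
          rw [hA]
          simp only [coneJet, map_add, map_sub, add_apply, sub_apply, hs l k, hds (X z) l k]
          ring
        rw [map_add] at e3
        rw [map_sub] at e4
        rw [sub_apply, sub_apply, abs_le]
        constructor <;> linarith)
    refine hbd.trans (le_of_eq ?_)
    field_simp
  refine hO.trans_isLittleO ?_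
  refine IsLittleO.of_norm_right ?_
  have := (isLittleO_pow_id (𝕜 := ℝ) (one_lt_two)).comp_tendsto (tendsto_norm_zero (E := Cn m))
  exact this

/-- A field whose image under a nondegenerate metric is differentiable is differentiable. -/
lemma differentiableAt_of_metric {U : Set (Cn m)} (hU : IsOpen U) {X : Cn m → Cn m} {z : Cn m}
    (hz : z ∈ U) (hpos : ∀ x ∈ U, ∀ v, v ≠ 0 → 0 < g x v v) (hg : DifferentiableAt ℝ g z)
    (hX : DifferentiableAt ℝ (fun x => g x (X x)) z) : DifferentiableAt ℝ X z := by
  have he : ∀ x ∈ U, ∃ e : Cn m ≃L[ℝ] (Cn m →L[ℝ] ℝ), (e : Cn m →L[ℝ] Cn m →L[ℝ] ℝ) = g x := by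
    intro x hx
    have hinj : Function.Injective (g x : Cn m →ₗ[ℝ] (Cn m →L[ℝ] ℝ)) := by
      rw [injective_iff_map_eq_zero]
      intro v hv
      by_contra hne
      have h1 : g x v v = 0 := by
        have hv : g x v = 0 := hv
        rw [hv]; rfl
      exact (hpos x hx v hne).ne' h1
    have hfr : Module.finrank ℝ (Cn m) = Module.finrank ℝ (Cn m →L[ℝ] ℝ) := by
      rw [← (LinearMap.toContinuousLinearMap (𝕜 := ℝ) (E := Cn m) (F' := ℝ)).finrank_eq]
      exact (Subspace.dual_finrank_eq (K := ℝ) (V := Cn m)).symm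
    refine ⟨(LinearEquiv.ofBijective (g x : Cn m →ₗ[ℝ] (Cn m →L[ℝ] ℝ)) ⟨hinj,
      (LinearMap.injective_iff_surjective_of_finrank_eq_finrank hfr).mp hinj⟩
      ).toContinuousLinearEquiv, ?_⟩
    ext v w
    rfl
  -- `X` is obtained by applying the inverse of `g x` to `g x (X x)`, and inversion of continuous
  -- linear maps is differentiable at an invertible one.
  have h1 : DifferentiableAt ℝ (fun x => ContinuousLinearMap.inverse (g x) (g x (X x))) z := by
    refine DifferentiableAt.clm_apply ?_ hX
    obtain ⟨e, he⟩ := he z hz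
    have h2 : DifferentiableAt ℝ (ContinuousLinearMap.inverse :
        (Cn m →L[ℝ] Cn m →L[ℝ] ℝ) → (Cn m →L[ℝ] ℝ) →L[ℝ] Cn m) (g z) := by
      rw [← he]
      exact (contDiffAt_map_inverse (n := 1) e).differentiableAt one_ne_zero
    exact h2.comp z hg
  refine h1.congr_of_eventuallyEq ?_
  filter_upwards [hU.mem_nhds hz] with x hx
  obtain ⟨e, he⟩ := he x hx
  rw [← he, ContinuousLinearMap.inverse_equiv]
  exact (e.symm_apply_apply _).symm

end Expansion

section Gradient

variable {ω : TwoForm m} {d : Cn m → Cn m → ℝ} {β K : ℝ}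

/-- The radial vector field of a Kähler cone metric. -/
theorem exists_gradient (hd : IsInducedDist ω d) (hcone : IsMetricCone d 0)
    (hg : IsKahlerMetricOn (metric ω) (divisorCompl m)) (hC : EquivModel (metric ω) β K) :
    ∃ X : Cn m → Cn m, ∀ z ∈ divisorCompl m, metric ω z (X z) (X z) = d z 0 ^ 2 ∧
      DifferentiableAt ℝ X z ∧ ∀ h k, metric ω z (fderiv ℝ X z h) k = metric ω z h k +
        1 / 2 * (fderiv ℝ (metric ω) z k h (X z) - fderiv ℝ (metric ω) z h k (X z)
          - fderiv ℝ (metric ω) z (X z) h k) := by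
  set φ : Cn m → ℝ := fun x => d x 0 ^ 2 / 2 with hφ
  have hex : ∀ z ∈ divisorCompl m, ∃ X, metric ω z X X = d z 0 ^ 2 ∧
      ∃ ε > 0, ∃ C, 0 ≤ C ∧ HasConeExpansion (metric ω) φ z X ε C := by
    intro z hz
    obtain ⟨ε, hε, C, hC0, h⟩ := exists_uniform_expansion hd hcone hg hC hz
    obtain ⟨-, X, hX, hexp⟩ := h z (Metric.mem_ball_self hε)
    exact ⟨X, hX, ε, hε, C, hC0, hexp⟩
  choose! X hX ε hε C hC0 hexp using hex
  refine ⟨X, fun z hz => ⟨hX z hz, ?_⟩⟩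
  obtain ⟨δ, hδ, c, hc, h⟩ := exists_uniform_expansion hd hcone hg hC hz
  have hunif : ∀ x ∈ Metric.ball z δ, HasConeExpansion (metric ω) φ x (X x) δ c := by
    intro x hx
    obtain ⟨hxU, Y, -, hY⟩ := h x hx
    have hY : HasConeExpansion (metric ω) φ x Y δ c := hY
    rwa [(hexp x hxU).unique (hg.pos x hxU) (hε x hxU) hδ (hC0 x hxU) hc hY]
  obtain ⟨A, hA⟩ := exists_coneHess (metric ω z) (fderiv ℝ (metric ω) z) (X z)
  have hL := hasFDerivAt_of_expansion hδ hc (fderiv_symm hg hz) (hg.symm z hz) hunif hA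
  have hXd := differentiableAt_of_metric isOpen_divisorCompl hz hg.pos
    (hg.hasFDerivAt hz).differentiableAt hL.differentiableAt
  refine ⟨hXd, fun h k => ?_⟩
  -- Comparing the product rule for `g X` with its derivative `A` solves for `∂X`. The result is `∇X
  -- = id` with the Christoffel symbols written out.
  have h1 := (hg.hasFDerivAt hz).clm_apply hXd.hasFDerivAt
  have h2 := DFunLike.congr_fun (DFunLike.congr_fun (h1.unique hL) h) k
  rw [hA] at h2
  have h3 : metric ω z (fderiv ℝ X z h) k + fderiv ℝ (metric ω) z h (X z) k =
      metric ω z h k + 1 / 2 * (fderiv ℝ (metric ω) z h k (X z) +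
        fderiv ℝ (metric ω) z k h (X z) - fderiv ℝ (metric ω) z (X z) h k) := h2
  rw [fderiv_symm hg hz h (X z) k] at h3
  linarith

/-- The radial vector field of a Kähler cone metric is holomorphic. -/
lemma fderiv_gradient_I_smul (hg : IsKahlerMetricOn (metric ω) (divisorCompl m)) {z v : Cn m}
    (hz : z ∈ divisorCompl m) {T : Cn m →L[ℝ] Cn m}
    (hT : ∀ h k, metric ω z (T h) k = metric ω z h k +
        1 / 2 * (fderiv ℝ (metric ω) z k h v - fderiv ℝ (metric ω) z h k v
          - fderiv ℝ (metric ω) z v h k)) (h : Cn m) :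
    T (Complex.I • h) = Complex.I • T h := by
  have hJ : ∀ x y, metric ω z (Complex.I • x) y = -metric ω z x (Complex.I • y) := fun x y => by
    rw [← hg.inv z hz x, I_smul_I_smul, map_neg, neg_neg]
  have key : ∀ k, metric ω z (T (Complex.I • h) - Complex.I • T h) k = 0 := by
    intro k
    rw [map_sub, sub_apply, hJ, hT, hT, hJ]
    have h1 := fderiv_kahler hg hz h k v
    rw [fderiv_symm hg hz (Complex.I • k) v h, fderiv_symm hg hz k v (Complex.I • h)] at h1
    have h2 := fderiv_I_left hg hz v h k
    linarith
  by_contra hne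
  exact (hg.pos z hz _ (sub_ne_zero.mpr hne)).ne' (key _)

lemma differentiableAt_complex_of_I_smul {X : Cn m → Cn m} {z : Cn m}
    (hX : DifferentiableAt ℝ X z)
    (h : ∀ v, fderiv ℝ X z (Complex.I • v) = Complex.I • fderiv ℝ X z v) :
    DifferentiableAt ℂ X z := by
  let T : Cn m →L[ℂ] Cn m :=
    { toFun := fderiv ℝ X z
      map_add' := map_add _
      map_smul' := fun c v => by
        rw [complex_smul_eq c v, map_add, map_smul, map_smul, h, RingHom.id_apply,
          ← complex_smul_eq]
      cont := (fderiv ℝ X z).continuous }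
  exact (hasFDerivAt_of_restrictScalars ℝ (f' := T) hX.hasFDerivAt rfl).differentiableAt

end Gradient

end KahlerCone
end

/-! ### Comparison of the radius with that of the model cone. -/

noncomputable section

namespace KahlerCone

open Filter Topology Asymptotics

variable {m : ℕ}

set_option maxSynthPendingDepth 3

section Radius

variable {ω : TwoForm m} {d : Cn m → Cn m → ℝ} {β C : ℝ}

/-- The orbit of `z` under the dilations of the model cone metric. -/
def dilate (β s : ℝ) (z : Cn m) : Cn m := fun i => (if i = 0 then s ^ β⁻¹ else s) • z i

lemma hasDerivAt_dilate (hβ : 0 < β) (hβ1 : β < 1) (z : Cn m) (s : ℝ) :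
    HasDerivAt (fun s => dilate β s z)
      (fun i => (if i = 0 then β⁻¹ * s ^ (β⁻¹ - 1) else 1) • z i) s := by
  rw [hasDerivAt_pi]
  intro i
  have h1 : 1 ≤ β⁻¹ := (one_le_inv₀ hβ).mpr hβ1.le
  by_cases hi : i = 0
  · simp only [dilate, hi, if_true]
    exact (Real.hasDerivAt_rpow_const (Or.inr h1)).smul_const (z 0)
  · simp only [dilate, hi, if_false]
    exact (hasDerivAt_id s).smul_const (z i)

/-- The dilations `(s^(1/β) u, s v)` are homotheties of the model, so the speed along an orbit does
not depend on `s`. -/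
lemma modelQ_dilate (hβ : 0 < β) (z : Cn m) (hz : z ∈ divisorCompl m) {s : ℝ} (hs : 0 < s) :
    modelQ β (dilate β s z) (fun i => (if i = 0 then β⁻¹ * s ^ (β⁻¹ - 1) else 1) • z i) =
      β⁻¹ ^ 2 * ‖z 0‖ ^ (2 * β) + sqn (tang m) z := by
  have hz0 : 0 < ‖z 0‖ := norm_pos_iff.mpr hz
  have h1 : sqn (tang m) (fun i => (if i = 0 then β⁻¹ * s ^ (β⁻¹ - 1) else 1) • z i) =
      sqn (tang m) z := by
    rw [sqn_tang, sqn_tang]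
    simp [Fin.succ_ne_zero]
  rw [modelQ, h1]
  congr 1
  simp only [dilate, if_true, norm_smul]
  rw [Real.norm_of_nonneg (by positivity), Real.norm_of_nonneg (by positivity),
    Real.mul_rpow (by positivity) hz0.le, ← Real.rpow_mul hs.le]
  have h2 : s ^ (β⁻¹ * (2 * β - 2)) * (s ^ (β⁻¹ - 1)) ^ 2 = 1 := by
    rw [← Real.rpow_natCast (s ^ (β⁻¹ - 1)), ← Real.rpow_mul hs.le, ← Real.rpow_add hs]
    rw [show β⁻¹ * (2 * β - 2) + (β⁻¹ - 1) * (2 : ℕ) = 0 by push_cast; field_simp; ring,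
      Real.rpow_zero]
  have h3 : ‖z 0‖ ^ (2 * β - 2) * ‖z 0‖ ^ 2 = ‖z 0‖ ^ (2 * β) := by
    rw [← Real.rpow_natCast ‖z 0‖, ← Real.rpow_add hz0]
    congr 1; push_cast; ring
  rw [← h3]
  linear_combination (β⁻¹ ^ 2 * ‖z 0‖ ^ (2 * β - 2) * ‖z 0‖ ^ 2) * h2

/-- The distance from the vertex is at most that of a model cone metric. -/
theorem dist_zero_sq_le (hβ : 0 < β) (hβ1 : β < 1) (hd : IsInducedDist ω d)
    (hC : EquivModel (metric ω) β C) {z : Cn m} (hz : z ∈ divisorCompl m) :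
    d z 0 ^ 2 ≤ C * (β⁻¹ ^ 2 * ‖z 0‖ ^ (2 * β) + sqn (tang m) z) := by
  set Q := β⁻¹ ^ 2 * ‖z 0‖ ^ (2 * β) + sqn (tang m) z with hQ
  have hC0 := hC.1
  have hQ0 : 0 ≤ Q := add_nonneg (by positivity) (sqn_nonneg _ _)
  have hz0 : z 0 ≠ 0 := hz
  have hd1 : dilate β 1 z = z := by ext i; simp [dilate]
  have hbeta : 0 < β⁻¹ := by positivity
  have hd0 : dilate β 0 z = 0 := by
    ext i
    by_cases hi : i = 0 <;> simp [dilate, hi, Real.zero_rpow hbeta.ne']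
  -- The orbit is stopped at `s = δ` because admissible paths avoid the divisor, which contains the
  -- origin. Continuity of `d` allows `δ → 0`.
  have hle : ∀ δ ∈ Set.Ioo (0 : ℝ) 1, d z (dilate β δ z) ≤ √(C * Q) := by
    intro δ hδ
    have hs : ∀ t : ℝ, HasDerivAt (fun t : ℝ => 1 - t * (1 - δ)) (-(1 - δ)) t := fun t => by
      simpa using ((hasDerivAt_id t).mul_const (1 - δ)).const_sub 1
    have hspos : ∀ t ∈ Set.Icc (0 : ℝ) 1, 0 < 1 - t * (1 - δ) := fun t ht => by
      have : t * (1 - δ) ≤ 1 * (1 - δ) :=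
        mul_le_mul_of_nonneg_right ht.2 (by linarith [hδ.2])
      linarith [hδ.1]
    have hγ : ∀ t : ℝ, HasDerivAt (fun t : ℝ => dilate β (1 - t * (1 - δ)) z)
        ((-(1 - δ)) • fun i => (if i = 0 then β⁻¹ * (1 - t * (1 - δ)) ^ (β⁻¹ - 1) else 1) • z i) t :=
      fun t => HasDerivAt.scomp (g₁ := fun s => dilate β s z) t
        (hasDerivAt_dilate hβ hβ1 z (1 - t * (1 - δ))) (hs t)
    have h1 := hd.le_of_path hγ (by
        refine continuousOn_pi.mpr fun i => ContinuousOn.const_smul (s := Set.Icc (0 : ℝ) 1)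
          (g := fun t : ℝ => (if i = 0 then β⁻¹ * (1 - t * (1 - δ)) ^ (β⁻¹ - 1) else 1) • z i) ?_ _
        by_cases hi : i = 0
        · simp only [hi, if_true]
          have hc : ContinuousOn (fun t : ℝ => (1 - t * (1 - δ)) ^ (β⁻¹ - 1)) (Set.Icc 0 1) :=
            ContinuousOn.rpow_const (by fun_prop) fun t ht => Or.inl (hspos t ht).ne'
          fun_prop
        · simp only [hi, if_false]
          exact continuousOn_const)
      (fun t ht => by
        change dilate β (1 - t * (1 - δ)) z 0 ≠ 0
        simp only [dilate, if_true]
        exact smul_ne_zero (Real.rpow_pos_of_pos (hspos t ht) _).ne' hz0)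
      (S := fun _ => √(C * Q)) continuousOn_const (fun t ht => by
        refine Real.sqrt_le_sqrt ?_
        have hU : dilate β (1 - t * (1 - δ)) z ∈ divisorCompl m := by
          change dilate β (1 - t * (1 - δ)) z 0 ≠ 0
          simp only [dilate, if_true]
          exact smul_ne_zero (Real.rpow_pos_of_pos (hspos t ht) _).ne' hz0
        have h2 := (hC.2 _ hU
          (fun i => (if i = 0 then β⁻¹ * (1 - t * (1 - δ)) ^ (β⁻¹ - 1) else 1) • z i)).2
        rw [modelQ_dilate hβ z hz (hspos t ht), ← hQ] at h2
        simp only [map_smul, smul_apply, smul_eq_mul]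
        have h3 : (-(1 - δ)) * (-(1 - δ)) ≤ 1 := by nlinarith [hδ.1, hδ.2]
        have h4 : 0 ≤ C * Q := by positivity
        calc _ = (-(1 - δ)) * (-(1 - δ)) * metric ω (dilate β (1 - t * (1 - δ)) z)
              (fun i => (if i = 0 then β⁻¹ * (1 - t * (1 - δ)) ^ (β⁻¹ - 1) else 1) • z i)
              (fun i => (if i = 0 then β⁻¹ * (1 - t * (1 - δ)) ^ (β⁻¹ - 1) else 1) • z i) := by
              ring
          _ ≤ (-(1 - δ)) * (-(1 - δ)) * (C * Q) :=
              mul_le_mul_of_nonneg_left h2 (mul_self_nonneg _)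
          _ ≤ C * Q := mul_le_of_le_one_left h4 h3)
    simp only [zero_mul, sub_zero, hd1, one_mul, sub_sub_cancel, intervalIntegral.integral_const,
      one_smul] at h1
    exact h1
  have hcont : ContinuousAt (fun δ : ℝ => d z (dilate β δ z)) 0 :=
    hd.continuous.continuousAt.comp (continuousAt_const.prodMk
      (hasDerivAt_dilate hβ hβ1 z 0).continuousAt)
  have hlim : Tendsto (fun δ : ℝ => d z (dilate β δ z)) (𝓝[>] 0) (𝓝 (d z 0)) := by
    have := hcont.tendsto.mono_left (nhdsWithin_le_nhds (s := Set.Ioi 0))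
    rwa [hd0] at this
  have h1 : d z 0 ≤ √(C * Q) := by
    refine le_of_tendsto hlim ?_
    filter_upwards [Ioo_mem_nhdsGT zero_lt_one] with δ hδ using hle δ hδ
  calc d z 0 ^ 2 ≤ √(C * Q) ^ 2 := pow_le_pow_left₀ (hd.nonneg _ _) h1 2
    _ = C * Q := Real.sq_sqrt (by positivity)

end Radius

/-! ### Linearity of holomorphic vector fields of linear growth. -/

section Linear

variable {β K : ℝ} {X : Cn m → Cn m}

/-- A holomorphic vector field of linear growth with respect to the model cone metric is linear. -/
theorem exists_linear_of_growth (hβ : 0 < β) (hβ1 : β < 1) (hK : 0 ≤ K)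
    (hX : ∀ z ∈ divisorCompl m, DifferentiableAt ℂ X z)
    (hgr : ∀ z ∈ divisorCompl m, modelQ β z (X z) ≤ K * (‖z 0‖ ^ (2 * β) + sqn (tang m) z)) :
    ∃ (a : ℂ) (A : Cn m →L[ℂ] Cn m), (∀ z, A z 0 = a * z 0) ∧
      (∀ c : ℂ, A (c • e₀) = (a * c) • e₀) ∧ ∀ z ∈ divisorCompl m, X z = A z := by
  set P : ℂ → (Fin m → ℂ) → Cn m := fun u v => Fin.cons u v with hP
  set S : (Fin m → ℂ) → ℝ := fun v => ∑ i, ‖v i‖ ^ 2 with hS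
  have hS0 : ∀ v, 0 ≤ S v := fun v => Finset.sum_nonneg fun _ _ => sq_nonneg _
  have hPS : ∀ u v, sqn (tang m) (P u v) = S v := fun u v => by rw [sqn_tang]; simp [hP, hS]
  have hPU : ∀ u v, u ≠ 0 → P u v ∈ divisorCompl m := fun u v hu => hu
  have hPd : ∀ u v, DifferentiableAt ℂ (fun p : ℂ × (Fin m → ℂ) => P p.1 p.2) (u, v) := by
    intro u v
    rw [differentiableAt_pi]
    intro i
    refine Fin.cases ?_ (fun j => ?_) i
    · simp only [hP, Fin.cons_zero]; fun_prop
    · simp only [hP, Fin.cons_succ]; fun_prop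
  have hXi : ∀ i, ∀ z ∈ divisorCompl m, DifferentiableAt ℂ (fun z => X z i) z := fun i z hz =>
    differentiableAt_pi.mp (hX z hz) i
  have hXP : ∀ i u v, u ≠ 0 →
      DifferentiableAt ℂ (fun p : ℂ × (Fin m → ℂ) => X (P p.1 p.2) i) (u, v) := fun i u v hu =>
    DifferentiableAt.comp (g := fun z => X z i) (f := fun p : ℂ × (Fin m → ℂ) => P p.1 p.2) (u, v)
      (hXi i _ (hPU u v hu)) (hPd u v)
  have hXu : ∀ i u v, u ≠ 0 → DifferentiableAt ℂ (fun u => X (P u v) i) u := fun i u v hu =>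
    DifferentiableAt.comp (g := fun p : ℂ × (Fin m → ℂ) => X (P p.1 p.2) i) (f := fun u => (u, v)) u
      (hXP i u v hu) (differentiableAt_id.prodMk (differentiableAt_const v))
  have hXv : ∀ i u v, u ≠ 0 → DifferentiableAt ℂ (fun v => X (P u v) i) v := fun i u v hu =>
    DifferentiableAt.comp (g := fun p : ℂ × (Fin m → ℂ) => X (P p.1 p.2) i) (f := fun v => (u, v)) v
      (hXP i u v hu) ((differentiableAt_const u).prodMk differentiableAt_id)
  -- Division by `u` leaves growth `|u|^(-β)` at the divisor and boundedness at infinity, within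
  -- reach of `eq_of_punctured_growth` as `β < 1`.
  have hb0 : ∀ v u, u ≠ 0 → ‖X (P u v) 0 / u‖ ≤ √K * (1 + √(S v) * ‖u‖ ^ (-β)) := by
    intro v u hu
    have hup : 0 < ‖u‖ := norm_pos_iff.mpr hu
    have h1 := hgr (P u v) (hPU u v hu)
    rw [hPS, modelQ] at h1
    have h2 : P u v 0 = u := rfl
    rw [h2] at h1
    have h3 := sqn_nonneg (tang m) (X (P u v))
    have e1 : ‖u‖ ^ (2 * β - 2) * ‖u‖ ^ 2 = (‖u‖ ^ β) ^ 2 := by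
      rw [← Real.rpow_natCast, ← Real.rpow_natCast, ← Real.rpow_add hup, ← Real.rpow_mul hup.le]
      congr 1; push_cast; ring
    have e2 : ‖u‖ ^ (2 * β) = (‖u‖ ^ β) ^ 2 := by
      rw [← Real.rpow_natCast, ← Real.rpow_mul hup.le]
      congr 1; push_cast; ring
    have e3 : ‖u‖ ^ (-β) * ‖u‖ ^ β = 1 := by rw [← Real.rpow_add hup]; simp
    have hpβ : 0 < ‖u‖ ^ β := by positivity
    set w := X (P u v) 0 / u with hw
    have h4 : X (P u v) 0 = w * u := (div_mul_cancel₀ _ hu).symm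
    rw [h4, norm_mul, e2, mul_pow] at h1
    have h5 : (‖u‖ ^ β) ^ 2 * ‖w‖ ^ 2 ≤ K * ((‖u‖ ^ β) ^ 2 + S v) := by
      rw [← e1] at h1 ⊢; linarith
    refine abs_le_of_sq_le_sq' ?_ (by positivity) |>.2
    rw [mul_pow, Real.sq_sqrt hK]
    have h6 : ‖w‖ ^ 2 ≤ K * (1 + S v * (‖u‖ ^ (-β)) ^ 2) := by
      refine le_of_mul_le_mul_left (h5.trans (le_of_eq ?_)) (by positivity : 0 < (‖u‖ ^ β) ^ 2)
      have e4 : (‖u‖ ^ (-β)) ^ 2 * (‖u‖ ^ β) ^ 2 = 1 := by rw [← mul_pow, e3, one_pow]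
      linear_combination (- K * S v) * e4
    refine h6.trans (mul_le_mul_of_nonneg_left ?_ hK)
    have h7 : √(S v) ^ 2 = S v := Real.sq_sqrt (hS0 v)
    have h8 : 0 ≤ √(S v) * ‖u‖ ^ (-β) := by positivity
    nlinarith
  have hbj : ∀ v u, u ≠ 0 → ∀ j : Fin m, ‖X (P u v) j.succ‖ ≤ √K * (‖u‖ ^ β + √(S v)) := by
    intro v u hu j
    have hup : 0 < ‖u‖ := norm_pos_iff.mpr hu
    have h1 := hgr (P u v) (hPU u v hu)
    rw [hPS, modelQ] at h1
    have h2 : P u v 0 = u := rfl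
    rw [h2] at h1
    have h3 : ‖X (P u v) j.succ‖ ^ 2 ≤ sqn (tang m) (X (P u v)) := by
      rw [sqn_tang]
      exact Finset.single_le_sum (f := fun i : Fin m => ‖X (P u v) i.succ‖ ^ 2)
        (fun _ _ => sq_nonneg _) (Finset.mem_univ j)
    have e2 : ‖u‖ ^ (2 * β) = (‖u‖ ^ β) ^ 2 := by
      rw [← Real.rpow_natCast, ← Real.rpow_mul hup.le]
      congr 1; push_cast; ring
    have h4 : 0 ≤ ‖u‖ ^ (2 * β - 2) * ‖X (P u v) 0‖ ^ 2 := by positivity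
    rw [e2] at h1
    refine abs_le_of_sq_le_sq' ?_ (by positivity) |>.2
    rw [mul_pow, Real.sq_sqrt hK]
    have h5 : ‖X (P u v) j.succ‖ ^ 2 ≤ K * ((‖u‖ ^ β) ^ 2 + S v) := by linarith
    refine h5.trans (mul_le_mul_of_nonneg_left ?_ hK)
    have h7 : √(S v) ^ 2 = S v := Real.sq_sqrt (hS0 v)
    have h8 : 0 ≤ √(S v) * ‖u‖ ^ β := by positivity
    nlinarith
  have hc0 : ∀ v u, u ≠ 0 → X (P u v) 0 = X (P 1 v) 0 * u := by
    intro v u hu0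
    have hdiff : DifferentiableOn ℂ (fun u => X (P u v) 0 / u) {0}ᶜ := fun u hu0 =>
      ((hXu 0 u v hu0).div differentiableAt_id hu0).differentiableWithinAt
    have h1 := eq_of_punctured_growth hdiff (C := √K * (1 + √(S v))) (α := β) hβ.le hβ1
      (fun u hu => (hb0 v u hu).trans (by
        rw [mul_assoc]
        refine mul_le_mul_of_nonneg_left ?_ (Real.sqrt_nonneg _)
        have h2 := Real.sqrt_nonneg (S v)
        have h3 : 0 ≤ ‖u‖ ^ (-β) := by positivity
        have h4 : 0 ≤ ‖u‖ ^ β := by positivity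
        nlinarith [mul_nonneg h2 h4])) u hu0 1 one_ne_zero
    simp only [div_one] at h1
    rw [← h1, div_mul_cancel₀ _ hu0]
  have hcj : ∀ v u, u ≠ 0 → ∀ j : Fin m, X (P u v) j.succ = X (P 1 v) j.succ := by
    intro v u hu0 j
    have hdiff : DifferentiableOn ℂ (fun u => X (P u v) j.succ) {0}ᶜ := fun u hu0 =>
      (hXu j.succ u v hu0).differentiableWithinAt
    exact eq_of_punctured_growth hdiff (C := √K * (1 + √(S v))) (α := β) hβ.le hβ1
      (fun u hu => (hbj v u hu j).trans (by
        rw [mul_assoc]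
        refine mul_le_mul_of_nonneg_left ?_ (Real.sqrt_nonneg _)
        have h2 := Real.sqrt_nonneg (S v)
        have h3 : 0 ≤ ‖u‖ ^ (-β) := by positivity
        have h4 : 0 ≤ ‖u‖ ^ β := by positivity
        nlinarith [mul_nonneg h2 h4, mul_nonneg h2 h3])) u hu0 1 one_ne_zero
  -- Letting `u → ∞` removes the dependence of the bound on `v`, and Liouville's theorem in `v`
  -- applies.
  have ha : ∀ v, X (P 1 v) 0 = X (P 1 0) 0 := by
    intro v
    have hdiff : Differentiable ℂ fun v => X (P 1 v) 0 := fun v =>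
      hXv 0 1 v one_ne_zero
    refine hdiff.apply_eq_apply_of_bounded ?_ v 0
    refine isBounded_iff_forall_norm_le.mpr ⟨√K, ?_⟩
    rintro _ ⟨v, rfl⟩
    have hlim : Tendsto (fun R : ℝ => √K * (1 + √(S v) * R ^ (-β))) atTop (𝓝 (√K)) := by
      simpa using (((tendsto_rpow_neg_atTop hβ).const_mul √(S v)).const_add 1).const_mul √K
    refine ge_of_tendsto hlim ?_
    filter_upwards [eventually_gt_atTop 0] with R hR
    have hR0 : (R : ℂ) ≠ 0 := by exact_mod_cast hR.ne'
    have h1 := hb0 v R hR0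
    rwa [hc0 v R hR0, mul_div_cancel_right₀ _ hR0, Complex.norm_real, Real.norm_of_nonneg hR.le]
      at h1
  set b : (Fin m → ℂ) → (Fin m → ℂ) := fun v j => X (P 1 v) j.succ with hb
  have hbd : Differentiable ℂ b := fun v => differentiableAt_pi.mpr fun j =>
    hXv j.succ 1 v one_ne_zero
  -- The other components do not depend on `u`, so their bound may be read off as `u → 0`.
  have hbb : ∀ v j, ‖b v j‖ ≤ √K * √(S v) := by
    intro v j
    have hlim : Tendsto (fun R : ℝ => √K * (R ^ β + √(S v))) (𝓝[>] 0) (𝓝 (√K * √(S v))) := by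
      have h1 : ContinuousAt (fun R : ℝ => √K * (R ^ β + √(S v))) 0 :=
        continuousAt_const.mul ((Real.continuousAt_rpow_const 0 β (Or.inr hβ.le)).add
          continuousAt_const)
      have := h1.tendsto.mono_left (nhdsWithin_le_nhds (s := Set.Ioi 0))
      simpa [Real.zero_rpow hβ.ne'] using this
    refine ge_of_tendsto hlim ?_
    filter_upwards [self_mem_nhdsWithin] with R hR
    have hR : 0 < R := hR
    have hR0 : (R : ℂ) ≠ 0 := by exact_mod_cast hR.ne'
    have h1 := hbj v R hR0 j
    rwa [hcj v R hR0, Complex.norm_real, Real.norm_of_nonneg hR.le] at h1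
  have hSs : ∀ (t : ℂ) v, √(S (t • v)) = ‖t‖ * √(S v) := by
    intro t v
    have : S (t • v) = ‖t‖ ^ 2 * S v := by
      simp only [hS, Pi.smul_apply, norm_smul, mul_pow, Finset.mul_sum]
    rw [this, Real.sqrt_mul (sq_nonneg _), Real.sqrt_sq (norm_nonneg _)]
  -- For `v` fixed, `b (t • v) / t` is holomorphic and bounded on `t ≠ 0`, hence constant.
  have hhom : ∀ (t : ℂ) v, b (t • v) = t • b v := by
    intro t v
    ext j
    by_cases ht : t = 0
    · have h1 := hbb (t • v) j
      rw [hSs, ht, norm_zero, zero_mul, mul_zero, ← ht] at h1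
      rw [norm_le_zero_iff.mp h1, ht]; simp
    · have hdiff : DifferentiableOn ℂ (fun t : ℂ => b (t • v) j / t) {0}ᶜ := fun t ht => by
        have h1 : DifferentiableAt ℂ (fun t : ℂ => b (t • v)) t :=
          (hbd _).comp t (differentiableAt_id.smul_const v)
        exact ((differentiableAt_pi.mp h1 j).div differentiableAt_id ht).differentiableWithinAt
      have h1 := eq_of_punctured_growth hdiff (C := √K * √(S v)) (α := 0) le_rfl one_pos
        (fun t ht => by
          have htp : 0 < ‖t‖ := norm_pos_iff.mpr ht
          have h2 := hbb (t • v) j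
          rw [hSs] at h2
          rw [norm_div, div_le_iff₀ htp]
          simp only [neg_zero, Real.rpow_zero]
          have h3 : 0 ≤ √K * √(S v) * ‖t‖ := by positivity
          nlinarith) t ht 1 one_ne_zero
      simp only [one_smul, div_one] at h1
      rw [Pi.smul_apply, smul_eq_mul, ← h1, mul_div_cancel₀ _ ht]
  -- A homogeneous map which is differentiable at the origin equals its derivative there.
  have hlin : ∀ v, b v = fderiv ℂ b 0 v := by
    intro v
    have h1 : HasDerivAt (fun t : ℂ => b (t • v)) (fderiv ℂ b 0 v) 0 := by
      have h2 : HasDerivAt (fun t : ℂ => t • v) v 0 := by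
        simpa using (hasDerivAt_id (0 : ℂ)).smul_const v
      have h3 : HasFDerivAt b (fderiv ℂ b 0) ((0 : ℂ) • v) := by
        rw [zero_smul]; exact (hbd 0).hasFDerivAt
      exact h3.comp_hasDerivAt 0 h2
    have h4 : HasDerivAt (fun t : ℂ => b (t • v)) (b v) 0 := by
      simp only [hhom]
      simpa using (hasDerivAt_id (0 : ℂ)).smul_const (b v)
    exact h4.unique h1
  set a := X (P 1 0) 0 with hadef
  set T := fderiv ℂ b 0 with hT
  let A₀ : Cn m →ₗ[ℂ] Cn m :=
    { toFun := fun z => Fin.cons (a * z 0) (T (Fin.tail z))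
      map_add' := fun x y => by
        have : Fin.tail (x + y) = Fin.tail x + Fin.tail y := rfl
        rw [this, map_add]
        ext i; refine Fin.cases ?_ (fun j => ?_) i <;> simp [mul_add]
      map_smul' := fun c x => by
        have : Fin.tail (c • x) = c • Fin.tail x := rfl
        rw [this, map_smul]
        ext i; refine Fin.cases ?_ (fun j => ?_) i <;> simp [mul_left_comm] }
  refine ⟨a, LinearMap.toContinuousLinearMap A₀, fun z => rfl, fun c => ?_, fun z hz => ?_⟩
  · change (Fin.cons (a * (c • e₀ : Cn m) 0) (T (Fin.tail (c • e₀ : Cn m))) : Cn m) = _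
    have : Fin.tail (c • e₀ : Cn m) = 0 := by
      ext j; simp [Fin.tail, e₀]
    rw [this, map_zero]
    ext i; refine Fin.cases ?_ (fun j => ?_) i <;> simp [e₀]
  · change X z = (Fin.cons (a * z 0) (T (Fin.tail z)) : Cn m)
    have hz0 : z 0 ≠ 0 := hz
    have hzP : z = P (z 0) (Fin.tail z) := (Fin.cons_self_tail z).symm
    ext i
    refine Fin.cases ?_ (fun j => ?_) i
    · rw [Fin.cons_zero]
      conv_lhs => rw [hzP]
      rw [hc0 _ _ hz0, ha]
    · rw [Fin.cons_succ, ← hlin]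
      conv_lhs => rw [hzP]
      rw [hcj _ _ hz0]

end Linear

end KahlerCone
end

/-! ### Assembly of the argument. -/

noncomputable section

namespace KahlerCone

open Filter Topology Asymptotics

variable {m : ℕ}

set_option maxSynthPendingDepth 3

/-- The tangential part of a Kähler cone metric with the volume form of the model is constant. -/
theorem metric_tang_const_of_isMetricCone {ω : TwoForm m} {d : Cn m → Cn m → ℝ} {β C : ℝ}
    (hβ : 0 < β) (hβ1 : β < 1) (hg : IsKahlerMetricOn (metric ω) (divisorCompl m))
    (hvol : ∀ z ∈ divisorCompl m, (gram (metric ω z) (realBasis m)).det = (‖z 0‖ ^ (2 * β - 2)) ^ 2)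
    (hC : EquivModel (metric ω) β C) (hd : IsInducedDist ω d) (hcone : IsMetricCone d 0)
    {w : Cn m} (hw : w 0 = 0) : ∃ M, ∀ z ∈ divisorCompl m, metric ω z w w = M := by
  obtain ⟨X, hX⟩ := exists_gradient hd hcone hg hC
  have hC0 := hC.1
  have hXd : ∀ z ∈ divisorCompl m, DifferentiableAt ℂ X z := fun z hz =>
    differentiableAt_complex_of_I_smul (hX z hz).2.1
      (fderiv_gradient_I_smul hg hz (hX z hz).2.2)
  obtain ⟨a, A, h0, he, hA⟩ := exists_linear_of_growth (K := C * (C * β⁻¹ ^ 2)) hβ hβ1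
    (by positivity) hXd (fun z hz => by
      have h1 := (hC.2 z hz (X z)).1
      rw [(hX z hz).1, inv_mul_le_iff₀ hC0] at h1
      have h2 := dist_zero_sq_le hβ hβ1 hd hC hz
      have h3 : 1 ≤ β⁻¹ ^ 2 := one_le_pow₀ ((one_le_inv₀ hβ).mpr hβ1.le)
      have h4 : sqn (tang m) z ≤ β⁻¹ ^ 2 * sqn (tang m) z :=
        le_mul_of_one_le_left (sqn_nonneg _ _) h3
      calc modelQ β z (X z) ≤ C * d z 0 ^ 2 := h1
        _ ≤ C * (C * (β⁻¹ ^ 2 * ‖z 0‖ ^ (2 * β) + β⁻¹ ^ 2 * sqn (tang m) z)) := by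
            gcongr
            exact h2.trans (by gcongr)
        _ = _ := by ring)
  refine metric_tang_const (A := A.restrictScalars ℝ) hg hβ hC (realBasis m) hvol h0 he
    (fun z hz h k => ?_) hw
  -- With `X` linear, adding the formula `∇X = id` for `(h, k)` and for `(k, h)` gives the homothety
  -- equation `L_X g = 2 g`.
  have hder : fderiv ℝ X z = A.restrictScalars ℝ := by
    have h1 : X =ᶠ[𝓝 z] A.restrictScalars ℝ := by
      filter_upwards [isOpen_divisorCompl.mem_nhds hz] with p hp using hA p hp
    rw [h1.fderiv_eq, ContinuousLinearMap.fderiv]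
  have h1 := (hX z hz).2.2 h k
  have h2 := (hX z hz).2.2 k h
  rw [hder, hA z hz] at h1 h2
  have h3 := fderiv_symm hg hz (A z) h k
  have h4 := hg.symm z hz h k
  have h5 := hg.symm z hz h (A k)
  have h6 : metric ω z (A k) h = metric ω z k h + 1 / 2 * (fderiv ℝ (metric ω) z h k (A z) -
    fderiv ℝ (metric ω) z k h (A z) - fderiv ℝ (metric ω) z (A z) k h) := h2
  change metric ω z (A h) k + metric ω z h (A k) =
    2 * metric ω z h k - fderiv ℝ (metric ω) z (A z) h k
  have h7 : metric ω z (A h) k = metric ω z h k + 1 / 2 * (fderiv ℝ (metric ω) z k h (A z) -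
    fderiv ℝ (metric ω) z h k (A z) - fderiv ℝ (metric ω) z (A z) h k) := h1
  linarith

end KahlerCone
end

theorem proposition25 (m : ℕ) (β : ℝ) (hβ₀ : 0 < β) (hβ₁ : β < 1)
    (ω' : KahlerCone.TwoForm m)
    (hKahler : KahlerCone.IsKahlerOn ω' (KahlerCone.divisorCompl m))
    (hvol : ∀ z ∈ KahlerCone.divisorCompl m,
      KahlerCone.volForm (ω' z) = KahlerCone.volForm (KahlerCone.modelForm m β z))
    (hequiv : KahlerCone.UniformlyEquivalentOn ω' (KahlerCone.modelForm m β)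
      (KahlerCone.divisorCompl m))
    (hcone : ∃ d : KahlerCone.Cn m → KahlerCone.Cn m → ℝ,
      KahlerCone.IsInducedDist ω' d ∧ KahlerCone.IsMetricCone d 0) :
    ∃ g : KahlerCone.Cn m ≃L[ℂ] KahlerCone.Cn m,
      (g '' {z | z 0 = 0} = {z | z 0 = 0}) ∧
      ∀ z ∈ KahlerCone.divisorCompl m,
        ω' z = (KahlerCone.modelForm m β (g z)).compContinuousLinearMap
          ((g : KahlerCone.Cn m →L[ℂ] KahlerCone.Cn m).restrictScalars ℝ) := by
  obtain ⟨d, hd, hcone⟩ := hcone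
  obtain ⟨C, hC0, hC⟩ := hequiv
  have hE : KahlerCone.EquivModel (KahlerCone.metric ω') β C := ⟨hC0, fun z hz x => by
    have := hC z hz x
    rwa [KahlerCone.riem_modelForm_self] at this⟩
  exact KahlerCone.exists_linearEquiv_of_tang_const hβ₀ hβ₁ hKahler
    (fun z hz => KahlerCone.gram_det_of_volForm_eq hz (hvol z hz)) hE
    fun w hw => KahlerCone.metric_tang_const_of_isMetricCone hβ₀ hβ₁ hKahler.isKahlerMetricOn
      (fun z hz => KahlerCone.gram_det_of_volForm_eq hz (hvol z hz)) hE hd hcone hw
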